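/- Let $K$ be a field of characteristic different from $2$ and $3$, let $E/K$ be a quadratic étale extension (a separable quadratic field extension, or $E\simeq K\times K$) with non-identity $K$-automorphism $\iota$, and let $C$ be an octonion algebra over $E$ (an octonion algebra over $K\times K$ is a pair of octonion algebras over $K$) with norm $n$ and canonical involution $\bar{\ }$. Conventions: a quadratic form $q$ has associated symmetric bilinear form $b$ with $b(x,x)=q(x)$; a symmetric bilinear form $b$ is identified with $x\mapsto b(x,x)$; $\simeq$ denotes isometry; $\langle c\rangle q$ is $c\cdot q$; $\langle c_1,c_2,c_3\rangle q=\langle c_1\rangle q\perp\langle c_2\rangle q\perp\langle c_3\rangle q$. For an $E$-module $V$ let ${}^\iota V$ be $V$ with $e\in E$ acting as $\iota(e)$. For a quadratic form $q$ on $V$, the form ${}^\iota q(v)=\iota(q(v))$ is a quadratic form on ${}^\iota V$, and the multiplicative transfer $N_{E/K}(q)$ is the $K$-valued quadratic form obtained by restricting ${}^\iota q\otimes_E q$ to the $K$-space of tensors in ${}^\iota V\otimes_E V$ fixed by the switch map $x\otimes y\mapsto y\otimes x$. The bi-octonion algebra $(A,-)=N_{E/K}(C)$ is the $K$-algebra of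 tensors in ${}^\iota C\otimes_E C$ fixed by the switch map, with the restriction of the tensor product of the canonical involutions. The form $\lambda^2(n)$ is the exterior square of $n$, a form on $\bigwedge^2_E C$; it is $\perp_{i<j}\langle x_ix_j\rangle$ if $n\simeq\langle x_1,\dots,x_8\rangle$. The form $\operatorname{tr}_{E/K}(\lambda^2(n))$ is its composite with the trace $E\to K$. For $a,b\in A$ and $i\in\{1,2,3\}$ (indices mod $3$) let $T^i_{a,b}=(T_1,T_2,T_3)\in\operatorname{End}_K(A)^3$ with $$T_i=L_{\bar b}L_a-L_{\bar a}L_b,\quad T_{i+1}=R_{\bar b}R_a-R_{\bar a}R_b,\quad T_{i+2}=R_{\bar ab-\bar ba}+L_bL_{\bar a}-L_aL_{\bar b},$$ where $L$ and $R$ denote left and right multiplications, and let $\mathcal T_I$ be the $K$-span of all $T^i_{a,b}$. For $\gamma=(\gamma_1,\gamma_2,\gamma_3)\in (K^\times)^3$ let $$K(A,-,\gamma)=\mathcal T_I\oplus A[12]\oplus A[23]\oplus A[31],$$ where the $A[ij]$ are copies of $A$ and $a[ij]=-\gamma_i\gamma_j^{-1}\bar a[ji]$, with the bilinear product given by the commutator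 on $\mathcal T_I$ and, for $(i\ j\ k)$ a cyclic permutation of $(1\ 2\ 3)$, $$[a[ij],b[jk]]=-[b[jk],a[ij]]=ab[ik],\quad [T,a[ij]]=-[a[ij],T]=T_k(a)[ij],\quad [a[ij],b[ij]]=\gamma_i\gamma_j^{-1}T^i_{a,b}.$$ Then $K(A,-,\gamma)$ is a Lie algebra over $K$ (in particular, it is closed under this product), and its Killing form is isometric to $$\langle-15\rangle\big(\operatorname{tr}_{E/K}(\lambda^2(n))\perp\langle\gamma_1\gamma_2^{-1},\gamma_2\gamma_3^{-1},\gamma_3\gamma_1^{-1}\rangle N_{E/K}(n)\big).$$ -/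

import Mathlib

open scoped TensorProduct

noncomputable section

/-! ### Octonion algebras and exterior squares of quadratic forms -/

section Octonion

variable {E C : Type*} [CommRing E] [NonAssocRing C] [Module E C]

/-- The unital nonassociative `E`-algebra `C` is an octonion algebra with norm `n`: it is free of
rank `8`, and `n` is a nondegenerate quadratic form permitting composition. -/
structure IsOctonionAlgebra (n : QuadraticForm E C) : Prop where
  free : Module.Free E C
  finrank_eq : Module.finrank E C = 8
  nondegenerate : n.polarBilin.Nondegenerate
  map_mul : ∀ x y : C, n (x * y) = n x * n y

/-- The canonical involution `x ↦ n(x,1) 1 - x` of an octonion algebra with norm `n`, where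
`n(x,y) = n(x+y) - n(x) - n(y)`. -/
def octConj (n : QuadraticForm E C) : C →ₗ[E] C :=
  (n.polarBilin.flip 1).smulRight (1 : C) - LinearMap.id

end Octonion

section ExteriorSquare

variable {E V : Type*} [CommRing E] [AddCommGroup V] [Module E V] [Invertible (2 : E)]

/-- The exterior square `λ²(q)` of a quadratic form: the quadratic form on `⋀² V` whose
bilinear form is `(u ∧ v, u' ∧ v') ↦ b(u,u') b(v,v') - b(u,v') b(v,u')`, where `b` is the
symmetric bilinear form with `b(x,x) = q(x)`. -/
def lambdaSq (q : QuadraticForm E V) : QuadraticForm E (⋀[E]^2 V) :=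
  LinearMap.BilinMap.toQuadraticMap
    (exteriorPower.pairingDual E V 2 ∘ₗ exteriorPower.map 2 (QuadraticMap.associated q))

/-- The bilinear form of `λ²(q)` is given by determinants. -/
theorem lambdaSq_bilin_apply (q : QuadraticForm E V) (u v : Fin 2 → V) :
    (exteriorPower.pairingDual E V 2 ∘ₗ exteriorPower.map 2 (QuadraticMap.associated q))
      (exteriorPower.ιMulti E 2 u) (exteriorPower.ιMulti E 2 v) =
    (Matrix.of fun i j => QuadraticMap.associated q (u j) (v i)).det := by
  simp [exteriorPower.pairingDual_ιMulti_ιMulti]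

/-- `λ²(q)` takes the value `xᵢ xⱼ` on `eᵢ ∧ eⱼ` if `eᵢ`, `eⱼ` are orthogonal vectors with
`q(eᵢ) = xᵢ` and `q(eⱼ) = xⱼ`. -/
theorem lambdaSq_apply_of_orthogonal (q : QuadraticForm E V) (u v : V)
    (h : QuadraticMap.associated q u v = 0) :
    lambdaSq q (exteriorPower.ιMulti E 2 ![u, v]) = q u * q v := by
  have h2 := lambdaSq_bilin_apply q ![u, v] ![u, v]
  simp only [lambdaSq, LinearMap.BilinMap.toQuadraticMap_apply]
  rw [h2, Matrix.det_fin_two]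
  have h' : QuadraticMap.associated q v u = 0 := by
    rw [← h]; exact QuadraticMap.associated_isSymm E q v u
  simp only [Matrix.of_apply, Matrix.cons_val_zero, Matrix.cons_val_one, h, h']
  rw [QuadraticMap.associated_eq_self_apply, QuadraticMap.associated_eq_self_apply]
  ring

end ExteriorSquare

/-! ### Transfers along a quadratic étale extension -/

/-- The additive (Scharlau) transfer `tr_{E/K}(q) = Tr_{E/K} ∘ q`, a quadratic form over `K`. -/
def traceTransfer (K : Type*) {E V : Type*} [Field K] [CommRing E] [Algebra K E]
    [AddCommGroup V] [Module E V] [Module K V] [IsScalarTower K E V]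
    (q : QuadraticForm E V) : QuadraticForm K V :=
  (Algebra.trace K E).compQuadraticMap' q

theorem apply_apply_of_orderOf_eq_two {K E : Type*} [Field K] [CommRing E] [Algebra K E]
    {ι : E ≃ₐ[K] E} (hι : orderOf ι = 2) (e : E) : ι (ι e) = e := by
  have h := pow_orderOf_eq_one ι
  rw [hι, pow_two] at h
  exact DFunLike.congr_fun h e

/-- The conjugate module `ᶥV`: the additive group `V`, with `e` acting as `ι(e)`. -/
@[nolint unusedArguments]
def Conjugate {K E : Type*} [Field K] [CommRing E] [Algebra K E]
    (_ : E ≃ₐ[K] E) (V : Type*) : Type _ := V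

namespace Conjugate

variable {K E : Type*} [Field K] [CommRing E] [Algebra K E] (ι : E ≃ₐ[K] E)

section Module

variable {V : Type*} [AddCommGroup V] [Module E V] [Module K V]

instance : AddCommGroup (Conjugate ι V) := inferInstanceAs (AddCommGroup V)

instance : Module E (Conjugate ι V) := Module.compHom V (ι : E →+* E)

instance : Module K (Conjugate ι V) := inferInstanceAs (Module K V)

/-- The identity map `V → ᶥV`. -/
def of : V ≃ₗ[K] Conjugate ι V := LinearEquiv.refl K V

theorem smul_def (e : E) (v : Conjugate ι V) :
    e • v = of ι (ι e • (of ι).symm v) := rfl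

theorem of_symm_smul (e : E) (v : Conjugate ι V) :
    (of ι).symm (e • v) = ι e • (of ι).symm v := rfl

instance [IsScalarTower K E V] : IsScalarTower K E (Conjugate ι V) where
  smul_assoc k e v := by
    apply (of ι).symm.injective
    rw [of_symm_smul, map_smul, smul_assoc, map_smul, of_symm_smul]

/-- An `E`-linear endomorphism of `V`, seen as an endomorphism of `ᶥV`. -/
def map (f : V →ₗ[E] V) : Conjugate ι V →ₗ[E] Conjugate ι V where
  toFun v := of ι (f ((of ι).symm v))
  map_add' v w := by simp
  map_smul' e v := by simp [smul_def]

variable {ι} in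
/-- The conjugate form `ᶥq(v) = ι(q(v))` on `ᶥV`. -/
def quadraticForm (hι : orderOf ι = 2) (q : QuadraticForm E V) :
    QuadraticForm E (Conjugate ι V) where
  toFun v := ι (q ((of ι).symm v))
  toFun_smul e v := by
    rw [of_symm_smul, QuadraticMap.map_smul]
    simp [apply_apply_of_orderOf_eq_two hι]
  exists_companion' :=
    ⟨LinearMap.mk₂ E (fun v w => ι (QuadraticMap.polar q ((of ι).symm v) ((of ι).symm w)))
      (fun _ _ _ => by simp [QuadraticMap.polar_add_left])
      (fun _ _ _ => by
        simp [of_symm_smul, QuadraticMap.polar_smul_left, apply_apply_of_orderOf_eq_two hι])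
      (fun _ _ _ => by simp [QuadraticMap.polar_add_right])
      (fun _ _ _ => by
        simp [of_symm_smul, QuadraticMap.polar_smul_right, apply_apply_of_orderOf_eq_two hι]),
     fun v w => by simp [QuadraticMap.polar]⟩

end Module

section Algebra

variable {C : Type*} [NonAssocRing C] [Module E C]

instance : NonAssocRing (Conjugate ι C) := inferInstanceAs (NonAssocRing C)

instance [SMulCommClass E C C] : SMulCommClass E (Conjugate ι C) (Conjugate ι C) where
  smul_comm e x y := mul_smul_comm (ι e) (show C from x) (show C from y)|>.symm

instance [IsScalarTower E C C] : IsScalarTower E (Conjugate ι C) (Conjugate ι C) where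
  smul_assoc e x y := smul_mul_assoc (ι e) (show C from x) (show C from y)

end Algebra

end Conjugate

section Transfer

variable {K E : Type*} [Field K] [CommRing E] [Algebra K E] {ι : E ≃ₐ[K] E}

section Module

variable (hι : orderOf ι = 2) (V : Type*) [AddCommGroup V] [Module E V] [Module K V]
  [IsScalarTower K E V]

/-- The switch map `x ⊗ y ↦ y ⊗ x` on `ᶥV ⊗[E] V`. -/
def switch : (Conjugate ι V ⊗[E] V) →ₗ[K] (Conjugate ι V ⊗[E] V) where
  toFun := TensorProduct.liftAddHom
    (AddMonoidHom.mk' (fun x : Conjugate ι V =>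
      AddMonoidHom.mk' (fun y : V =>
        (Conjugate.of ι y) ⊗ₜ[E] ((Conjugate.of ι).symm x : V))
        (fun y y' => by simp [TensorProduct.add_tmul]))
      (fun x x' => by ext y; simp [TensorProduct.tmul_add]))
    (fun e x y => by
      change (Conjugate.of ι y) ⊗ₜ[E] (ι e • ((Conjugate.of ι).symm x : V)) =
        (Conjugate.of ι (e • y)) ⊗ₜ[E] ((Conjugate.of ι).symm x : V)
      rw [← TensorProduct.smul_tmul, Conjugate.smul_def, apply_apply_of_orderOf_eq_two hι]
      rfl)
  map_add' s t := map_add _ s t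
  map_smul' k t := by
    induction t with
    | zero => simp
    | add s t hs ht => simp only [smul_add, map_add, hs, ht]
    | tmul x y =>
      simp only [TensorProduct.smul_tmul', RingHom.id_apply]
      change (Conjugate.of ι y) ⊗ₜ[E] ((Conjugate.of ι).symm (k • x) : V) =
        k • (Conjugate.of ι y) ⊗ₜ[E] ((Conjugate.of ι).symm x : V)
      rw [map_smul, TensorProduct.tmul_smul]

@[simp]
theorem switch_tmul (x : Conjugate ι V) (y : V) :
    switch hι V (x ⊗ₜ[E] y) = (Conjugate.of ι y) ⊗ₜ[E] ((Conjugate.of ι).symm x : V) := rfl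

/-- The multiplicative transfer of the `E`-module `V`: the `K`-space of tensors in
`ᶥV ⊗[E] V` fixed by the switch map. -/
def transferSubmodule : Submodule K (Conjugate ι V ⊗[E] V) :=
  LinearMap.eqLocus (switch hι V) LinearMap.id

/-- The space underlying the multiplicative transfer `N_{E/K}`. -/
def Transfer : Type _ := ↥(transferSubmodule hι V)

instance : AddCommGroup (Transfer hι V) := inferInstanceAs (AddCommGroup ↥(transferSubmodule hι V))

instance : Module K (Transfer hι V) := inferInstanceAs (Module K ↥(transferSubmodule hι V))

/-- The inclusion `N_{E/K}(V) → ᶥV ⊗[E] V`. -/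
def Transfer.val : Transfer hι V →ₗ[K] (Conjugate ι V ⊗[E] V) := (transferSubmodule hι V).subtype

variable {V}

theorem Transfer.val_injective : Function.Injective (Transfer.val hι V) :=
  Subtype.val_injective

theorem Transfer.switch_val (t : Transfer hι V) : switch hι V (t.val hι V) = t.val hι V := t.2

/-- The quadratic form `ᶥq ⊗ q` on `ᶥV ⊗[E] V`. -/
def conjTensorForm [Invertible (2 : E)] (q : QuadraticForm E V) :
    QuadraticForm E (Conjugate ι V ⊗[E] V) :=
  (Conjugate.quadraticForm hι q).tmul q

/-- The multiplicative transfer `N_{E/K}(q)`: the restriction of `ᶥq ⊗ q` to `N_{E/K}(V)`. The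
values of this restriction lie in `K`, and `½ Tr_{E/K}` is the identity on `K`; see
`algebraMap_transferForm`. -/
def transferForm [Invertible (2 : K)] [Invertible (2 : E)] (q : QuadraticForm E V) :
    QuadraticForm K (Transfer hι V) :=
  (⅟(2 : K) • (Algebra.trace K E).compQuadraticMap' (conjTensorForm hι q)).comp (Transfer.val hι V)

theorem associated_conjTensorForm_switch [Invertible (2 : E)] (q : QuadraticForm E V)
    (s t : Conjugate ι V ⊗[E] V) :
    QuadraticMap.associated (conjTensorForm hι q) (switch hι V s) (switch hι V t) =
      ι (QuadraticMap.associated (conjTensorForm hι q) s t) := by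
  have h2 : ι (⅟(2 : E)) = ⅟(2 : E) := by
    apply (isUnit_of_invertible (2 : E)).mul_left_cancel
    have h := congrArg ι (mul_invOf_self (2 : E))
    rw [map_mul, map_ofNat, map_one] at h
    rw [h, mul_invOf_self]
  have key : ∀ v w : Conjugate ι V,
      QuadraticMap.associated (Conjugate.quadraticForm hι q) v w =
        ι (QuadraticMap.associated q ((Conjugate.of ι).symm v) ((Conjugate.of ι).symm w)) := by
    intro v w
    simp [QuadraticMap.associated_apply, Conjugate.quadraticForm, h2]
  have key' : ∀ v w : V, QuadraticMap.associated (Conjugate.quadraticForm hι q)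
      (Conjugate.of ι v) (Conjugate.of ι w) = ι (QuadraticMap.associated q v w) := by
    intro v w
    simp [key]
  have e : QuadraticMap.associated (conjTensorForm hι q) =
      LinearMap.BilinForm.tmul (QuadraticMap.associated (Conjugate.quadraticForm hι q))
        (QuadraticMap.associated q) := QuadraticForm.associated_tmul _ _
  rw [e]
  induction s with
  | zero => simp
  | add s s' hs hs' => simp only [map_add, LinearMap.add_apply, hs, hs']
  | tmul x y =>
    induction t with
    | zero => simp
    | add t t' ht ht' => simp only [map_add, ht, ht']
    | tmul x' y' =>
      rw [switch_tmul, switch_tmul, LinearMap.BilinForm.tensorDistrib_tmul,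
        LinearMap.BilinForm.tensorDistrib_tmul, key', key]
      simp [apply_apply_of_orderOf_eq_two hι, mul_comm]

theorem algebraMap_transferForm [Invertible (2 : K)] [Invertible (2 : E)]
    (hE : Module.finrank K E = 2) (q : QuadraticForm E V) (t : Transfer hι V) :
    algebraMap K E (transferForm hι q t) = conjTensorForm hι q (t.val hι V) := by
  have hfix : ι (conjTensorForm hι q (t.val hι V)) = conjTensorForm hι q (t.val hι V) := by
    have h := associated_conjTensorForm_switch hι q (t.val hι V) (t.val hι V)
    rw [t.switch_val, QuadraticMap.associated_eq_self_apply] at h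
    exact h.symm
  have hmem : ∃ c : K, algebraMap K E c = conjTensorForm hι q (t.val hι V) := by
    have : Module.Finite K E := Module.finite_of_finrank_pos (by omega)
    have : Nontrivial E := Module.nontrivial_of_finrank_pos (R := K) (by omega)
    set F : Submodule K E := LinearMap.eqLocus ι.toLinearMap LinearMap.id with hF
    have h1 : (1 : E) ∈ F := by simp [hF]
    have hlt : Module.finrank K F < 2 := by
      rw [← hE]
      refine Submodule.finrank_lt fun htop => ?_
      have : ι = 1 := by
        ext e
        have : e ∈ F := htop ▸ Submodule.mem_top
        exact this
      rw [this, orderOf_one] at hι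
      omega
    have hpos : 0 < Module.finrank K F :=
      Module.finrank_pos_iff_exists_ne_zero.2
        ⟨⟨1, h1⟩, fun h => one_ne_zero (congrArg Subtype.val h)⟩
    obtain ⟨c, hc⟩ := exists_smul_eq_of_finrank_eq_one (by omega : Module.finrank K F = 1)
      (x := ⟨1, h1⟩) (fun h => one_ne_zero (congrArg Subtype.val h))
      (⟨conjTensorForm hι q (t.val hι V), hfix⟩ : F)
    refine ⟨c, ?_⟩
    rw [Algebra.algebraMap_eq_smul_one]
    exact congrArg Subtype.val hc
  obtain ⟨c, hc⟩ := hmem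
  have : transferForm hι q t = c := by
    change ⅟(2 : K) • Algebra.trace K E (conjTensorForm hι q (t.val hι V)) = c
    rw [← hc, Algebra.trace_algebraMap, hE, nsmul_eq_mul, Nat.cast_ofNat, smul_eq_mul,
      invOf_mul_cancel_left]
  rw [this, hc]

end Module

section Algebra

variable (hι : orderOf ι = 2) {C : Type*} [NonAssocRing C] [Module E C] [SMulCommClass E C C]
  [IsScalarTower E C C] [Module K C] [IsScalarTower K E C]

theorem switch_mul (s t : Conjugate ι C ⊗[E] C) :
    switch hι C (s * t) = switch hι C s * switch hι C t := by
  induction s with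
  | zero => simp
  | add s s' hs hs' => simp only [add_mul, map_add, hs, hs']
  | tmul x y =>
    induction t with
    | zero => simp
    | add t t' ht ht' => simp only [mul_add, map_add, ht, ht']
    | tmul x' y' =>
      simp only [Algebra.TensorProduct.tmul_mul_tmul, switch_tmul]
      rfl

instance : NonUnitalNonAssocRing (Transfer hι C) where
  mul s t := ⟨s.val hι C * t.val hι C, by
    change switch hι C _ = _
    rw [switch_mul, s.switch_val, t.switch_val]; rfl⟩
  left_distrib r s t := Subtype.ext (mul_add (r.val hι C) (s.val hι C) (t.val hι C))
  right_distrib r s t := Subtype.ext (add_mul (r.val hι C) (s.val hι C) (t.val hι C))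
  zero_mul r := Subtype.ext (zero_mul (r.val hι C))
  mul_zero r := Subtype.ext (mul_zero (r.val hι C))

theorem Transfer.val_mul (s t : Transfer hι C) :
    (s * t).val hι C = s.val hι C * t.val hι C := rfl

instance : SMulCommClass K (Transfer hι C) (Transfer hι C) where
  smul_comm k s t := by
    apply Transfer.val_injective hι
    simp only [smul_eq_mul, map_smul, Transfer.val_mul]
    simp only [← algebraMap_smul E k, mul_smul_comm]

instance : IsScalarTower K (Transfer hι C) (Transfer hι C) where
  smul_assoc k s t := by
    apply Transfer.val_injective hι
    simp only [smul_eq_mul, map_smul, Transfer.val_mul]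
    simp only [← algebraMap_smul E k, smul_mul_assoc]

/-- The tensor product of the canonical involutions on `ᶥC ⊗[E] C`. -/
def conjTensorInvolution (ι : E ≃ₐ[K] E) (n : QuadraticForm E C) :
    (Conjugate ι C ⊗[E] C) →ₗ[E] (Conjugate ι C ⊗[E] C) :=
  TensorProduct.map (Conjugate.map ι (octConj n)) (octConj n)

set_option linter.unusedSectionVars false in
theorem switch_conjTensorInvolution (n : QuadraticForm E C) (t : Conjugate ι C ⊗[E] C) :
    switch hι C (conjTensorInvolution ι n t) = conjTensorInvolution ι n (switch hι C t) := by
  induction t with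
  | zero => simp
  | add t t' ht ht' => simp only [map_add, ht, ht']
  | tmul x y => rfl

/-- The involution of `N_{E/K}(C)`, where `C` is an octonion algebra with norm `n`: the
restriction of the tensor product of the canonical involutions. -/
def transferInvolution (n : QuadraticForm E C) : Transfer hι C →ₗ[K] Transfer hι C :=
  ((conjTensorInvolution ι n).restrictScalars K).restrict (p := transferSubmodule hι C)
    (q := transferSubmodule hι C) fun t ht => by
      change switch hι C _ = _
      rw [LinearMap.restrictScalars_apply, switch_conjTensorInvolution]
      exact congrArg _ ht

end Algebra

end Transfer

/-! ### Lie algebras on subspaces closed under a bracket -/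

section LieOn

variable {K W : Type*} [CommRing K] [AddCommGroup W] [Module K W]

/-- The subspace `p` is closed under the bilinear product `β`, and `β` satisfies the Lie algebra
identities on `p`. -/
structure IsLieOn (β : W →ₗ[K] W →ₗ[K] W) (p : Submodule K W) : Prop where
  mem : ∀ x ∈ p, ∀ y ∈ p, β x y ∈ p
  self : ∀ x ∈ p, β x x = 0
  leibniz : ∀ x ∈ p, ∀ y ∈ p, ∀ z ∈ p, β x (β y z) = β (β x y) z + β y (β x z)

variable {β : W →ₗ[K] W →ₗ[K] W} {p : Submodule K W}

/-- The subspace `p` as a Lie algebra with bracket `β`. -/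
@[nolint unusedArguments]
def LieOn (_ : IsLieOn β p) : Type _ := ↥p

instance (h : IsLieOn β p) : AddCommGroup (LieOn h) := inferInstanceAs (AddCommGroup ↥p)

instance (h : IsLieOn β p) : Module K (LieOn h) := inferInstanceAs (Module K ↥p)

instance (h : IsLieOn β p) : LieRing (LieOn h) where
  bracket x y := ⟨β x.1 y.1, h.mem _ x.2 _ y.2⟩
  add_lie x y z := Subtype.ext (LinearMap.map_add₂ β x.1 y.1 z.1)
  lie_add x y z := Subtype.ext (map_add (β x.1) y.1 z.1)
  lie_self x := Subtype.ext (h.self _ x.2)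
  leibniz_lie x y z := Subtype.ext (h.leibniz _ x.2 _ y.2 _ z.2)

instance (h : IsLieOn β p) : LieAlgebra K (LieOn h) where
  lie_smul k x y := Subtype.ext (map_smul (β x.1) k y.1)

end LieOn

/-! ### The Allison–Faulkner construction -/

namespace AllisonFaulkner

variable {K A : Type*} [Field K] [NonUnitalNonAssocRing A] [Module K A] [SMulCommClass K A A]
  [IsScalarTower K A A] (bar : A →ₗ[K] A) (γ : Fin 3 → Kˣ)


/-- The triple `T^i_{a,b}`, with indices mod 3, as a function of its index `m`. -/
def tripleFun (i : Fin 3) (a b : A) : Fin 3 → Module.End K A :=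
  let L : A → Module.End K A := LinearMap.mulLeft K
  let R : A → Module.End K A := LinearMap.mulRight K
  fun m =>
    if m = i then L (bar b) ∘ₗ L a - L (bar a) ∘ₗ L b
    else if m = i + 1 then R (bar b) ∘ₗ R a - R (bar a) ∘ₗ R b
    else R (bar a * b - bar b * a) + L b ∘ₗ L (bar a) - L a ∘ₗ L (bar b)

/-- The triple `T^i_{a,b}` as a bilinear function of `(a, b)`. -/
def triple (i : Fin 3) : A →ₗ[K] A →ₗ[K] (Fin 3 → Module.End K A) :=
  LinearMap.mk₂ K (tripleFun bar i)
    (fun a a' b => by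
      funext m; ext x
      simp only [tripleFun, Pi.add_apply]
      split_ifs <;> simp [add_mul, mul_add, mul_sub] <;> abel)
    (fun c a b => by
      funext m; ext x
      simp only [tripleFun, Pi.smul_apply]
      split_ifs <;> simp [mul_sub, smul_sub, smul_mul_assoc, mul_smul_comm])
    (fun a b b' => by
      funext m; ext x
      simp only [tripleFun, Pi.add_apply]
      split_ifs <;> simp [add_mul, mul_add, mul_sub] <;> abel)
    (fun c a b => by
      funext m; ext x
      simp only [tripleFun, Pi.smul_apply]
      split_ifs <;> simp [mul_sub, smul_sub, smul_mul_assoc, mul_smul_comm])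

/-- The span `𝒯_I` of the triples `T^i_{a,b}` in `End(A)³`. -/
def innerTriples : Submodule K (Fin 3 → Module.End K A) :=
  Submodule.span K {T | ∃ (i : Fin 3) (a b : A), T = tripleFun bar i a b}

/-- The ambient space `End(A)³ ⊕ A³` of the construction. In a pair `(T, a)` the entry `a k`
stands for `a[ij]`, where `(i j k)` is a cyclic permutation of the three indices, i.e.
`i = k + 1` and `j = k + 2` mod 3. -/
abbrev Ambient (K A : Type*) [Field K] [NonUnitalNonAssocRing A] [Module K A] : Type _ :=
  (Fin 3 → Module.End K A) × (Fin 3 → A)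

/-- The product on `End(A)³ ⊕ A³` determined by
`[a[ij], b[jk]] = -[b[jk], a[ij]] = ab[ik]`, `[T, a[ij]] = -[a[ij], T] = T_k(a)[ij]` and
`[a[ij], b[ij]] = γ_i γ_j⁻¹ T^i_{a,b}` for `(i j k)` cyclic, by the commutator in `End(A)³`, and
by the identification `a[ij] = -γ_i γ_j⁻¹ \overline{a}[ji]`. By the last one,
`[a[jk], b[ki]] = ab[ji] = -γ_j γ_i⁻¹ \overline{ab}[ij]`. -/
def bracketFun (x y : Ambient K A) : Ambient K A :=
  (x.1 * y.1 - y.1 * x.1 + ∑ k : Fin 3,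
      ((γ (k + 1) : K) * (γ (k + 2) : K)⁻¹) • triple bar (k + 1) (x.2 k) (y.2 k),
   fun k => x.1 k (y.2 k) - y.1 k (x.2 k)
      - ((γ (k + 2) : K) * (γ (k + 1) : K)⁻¹) •
          bar (x.2 (k + 1) * y.2 (k + 2) - y.2 (k + 1) * x.2 (k + 2)))

/-- `bracketFun` as a bilinear map. -/
def bracket : Ambient K A →ₗ[K] Ambient K A →ₗ[K] Ambient K A :=
  LinearMap.mk₂ K (bracketFun bar γ)
    (fun x x' y => by
      ext1
      · simp [bracketFun, Finset.sum_add_distrib, smul_add, add_mul, mul_add]; abel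
      · funext k
        simp [bracketFun, add_mul, mul_add, smul_sub, smul_add]; abel)
    (fun c x y => by
      ext1
      · simp [bracketFun, Finset.smul_sum, smul_add, smul_sub, smul_comm c]
      · funext k
        simp [bracketFun, smul_sub, smul_mul_assoc, mul_smul_comm, smul_comm c])
    (fun x y y' => by
      ext1
      · simp [bracketFun, Finset.sum_add_distrib, smul_add, add_mul, mul_add]; abel
      · funext k
        simp [bracketFun, add_mul, mul_add, smul_sub, smul_add]; abel)
    (fun c x y => by
      ext1
      · simp [bracketFun, Finset.smul_sum, smul_add, smul_sub, smul_comm c]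
      · funext k
        simp [bracketFun, smul_sub, smul_mul_assoc, mul_smul_comm, smul_comm c])

/-- The subspace `K(A,-,γ) = 𝒯_I ⊕ A[12] ⊕ A[23] ⊕ A[31]`. -/
def space : Submodule K (Ambient K A) :=
  (innerTriples bar).prod ⊤

end AllisonFaulkner

end

open scoped TensorProduct

noncomputable section

set_option linter.unusedSectionVars false

open QuadraticMap (polar)

/-! ### Identities in octonion algebras -/

section Octonion

variable {E C : Type*} [CommRing E] [NonAssocRing C] [Module E C] {n : QuadraticForm E C}

/-! The Lie structure rests on local triality. In an octonion algebra the component of $T^i_{a,b}$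
of relative index 2 is twice the infinitesimal rotation attached to $a\wedge b$. The components of
relative index 0 and 1 complete it to a triple of skew maps that acts as a derivation up to a cyclic
shift of indices (`IsRelated`). This relation and the duality `polar_tri` give the identities
collected in `IsTrialitarian`, which are what the Jacobi identity needs. Each expression such as
$\bar b(ax)$ has a scalar symmetrization in $a,b$, so on a tensor product $2T_{a\otimes a',b\otimes
b'}$ equals $n(a',b')\,T_{a,b}\otimes 1+n(a,b)\,1\otimes T_{a',b'}$ (`two_smul_tri_tmul`). The
identities therefore pass to ${}^\iota C\otimes C$, and then to the tensors fixed by the switch.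

On fixed tensors the two halves of $T_{a,b}$ are conjugate to each other, so $\mathcal T_I$ is the
image of a single copy of $\bigwedge^2C$ (`wedgeTriple`). The shifted triples add nothing, because
every related triple of skew maps comes from $\bigwedge^2C$ (`exists_extTri_eq`). Such a triple is
determined by one entry, since the middle nucleus contains no nonzero element of trace zero; this is
where $6$ must be invertible.

For the Killing form, sign automorphisms make $\mathcal T_I$ and the three copies of $A$ mutually
orthogonal. On $A[ij]$ a block computation reduces the form to the trace of one operator on $A$.
This trace is $60$ times the tensor product of the polar forms over $E$, hence $30$ times its trace
to $K$, so the Killing form there is $-240\,\gamma_i\gamma_j^{-1}N_{E/K}(n)$. Invariance then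
determines the form on $\mathcal T_I$, namely $-960\operatorname{tr}_{E/K}\lambda^2(n)$ on
$\bigwedge^2C$. Rescaling by $1/8$ on $\bigwedge^2C$ and by $1/4$ on $A$ turns both constants into
$-15$. -/

theorem octConj_apply (x : C) : octConj n x = polar n x 1 • (1 : C) - x := rfl

namespace IsOctonionAlgebra

theorem eq_of_polar (hn : IsOctonionAlgebra n) {x y : C} (h : ∀ z, polar n x z = polar n y z) :
    x = y := by
  rw [← sub_eq_zero]
  refine hn.nondegenerate.1 _ fun z => ?_
  change polar n (x - y) z = 0
  rw [QuadraticMap.polar_sub_left, h, sub_self]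

theorem map_one (hn : IsOctonionAlgebra n) : n 1 = 1 := by
  have := hn.free
  -- From $n(1)n(y)=n(y)$ the scalar $1-n(1)$ kills all values of $n$, hence of the polar form. By
  -- nondegeneracy it kills $C$, which is free of positive rank.
  have h : ∀ x : C, (1 - n 1) • x = 0 := fun x => hn.eq_of_polar fun z => by
    have h2 : ∀ y, n 1 * n y = n y := fun y => by rw [← hn.map_mul, one_mul]
    rw [QuadraticMap.polar_smul_left, QuadraticMap.polar_zero_left, smul_eq_mul, sub_mul, one_mul,
      polar, mul_sub, mul_sub, h2, h2, h2, sub_self]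
  rcases subsingleton_or_nontrivial E with hE | hE
  · exact Subsingleton.elim _ _
  have hr : ¬ Subsingleton C := fun hs => by
    have h8 := hn.finrank_eq
    rw [Module.finrank_zero_of_subsingleton] at h8
    omega
  rw [not_subsingleton_iff_nontrivial] at hr
  let b := Module.Free.chooseBasis E C
  obtain ⟨i⟩ : Nonempty (Module.Free.ChooseBasisIndex E C) := b.index_nonempty
  have h1 := congrArg (fun v => b.repr v i) (h (b i))
  simp only [map_smul, Module.Basis.repr_self, Finsupp.smul_apply, Finsupp.single_eq_same, map_zero,
    Finsupp.zero_apply, smul_eq_mul, mul_one] at h1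
  exact (sub_eq_zero.1 h1).symm

theorem polar_one_one (hn : IsOctonionAlgebra n) : polar n 1 1 = 2 := by
  rw [QuadraticMap.polar_self, hn.map_one]; simp

theorem polar_mul_left (hn : IsOctonionAlgebra n) (x y z : C) :
    polar n (z * x) (z * y) = n z * polar n x y := by
  simp only [polar, ← mul_add, hn.map_mul]; ring

theorem polar_mul_right (hn : IsOctonionAlgebra n) (x y z : C) :
    polar n (x * z) (y * z) = polar n x y * n z := by
  simp only [polar, ← add_mul, hn.map_mul]; ring

/-- Full linearization of $n(xz)=n(x)n(z)$. Adjointness of multiplications and all substitutes for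
associativity below come from it. -/
theorem polar_mul_mul (hn : IsOctonionAlgebra n) (x y z w : C) :
    polar n (x * z) (y * w) + polar n (x * w) (y * z) = polar n x y * polar n z w := by
  have h := hn.polar_mul_right x y (z + w)
  simp only [mul_add, QuadraticMap.polar_add_left, QuadraticMap.polar_add_right,
    hn.polar_mul_right] at h
  have h2 : n (z + w) = polar n z w + n z + n w := by rw [polar]; ring
  rw [h2] at h
  linear_combination h

section Algebra

variable [SMulCommClass E C C] [IsScalarTower E C C]

theorem polar_mul_eq_right (hn : IsOctonionAlgebra n) (x y z : C) :
    polar n (x * z) y = polar n x (y * octConj n z) := by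
  have h := hn.polar_mul_mul x y z 1
  simp only [mul_one] at h
  rw [octConj_apply, mul_sub, mul_smul_comm, mul_one, QuadraticMap.polar_sub_right,
    QuadraticMap.polar_smul_right, smul_eq_mul]
  linear_combination h

theorem polar_mul_eq_left (hn : IsOctonionAlgebra n) (x y z : C) :
    polar n (z * x) y = polar n x (octConj n z * y) := by
  have h := hn.polar_mul_mul z 1 x y
  simp only [one_mul] at h
  rw [octConj_apply, sub_mul, smul_mul_assoc, one_mul, QuadraticMap.polar_sub_right,
    QuadraticMap.polar_smul_right, smul_eq_mul]
  rw [QuadraticMap.polar_comm n (z * y)] at h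
  linear_combination h

theorem polar_octConj_one (hn : IsOctonionAlgebra n) (x : C) :
    polar n (octConj n x) 1 = polar n x 1 := by
  rw [octConj_apply, QuadraticMap.polar_sub_left, QuadraticMap.polar_smul_left, hn.polar_one_one,
    smul_eq_mul]
  ring

theorem octConj_octConj (hn : IsOctonionAlgebra n) (x : C) : octConj n (octConj n x) = x := by
  rw [octConj_apply (octConj n x), hn.polar_octConj_one, octConj_apply, sub_sub_cancel]

theorem polar_octConj_octConj (hn : IsOctonionAlgebra n) (x y : C) :
    polar n (octConj n x) (octConj n y) = polar n x y := by
  simp only [octConj_apply, QuadraticMap.polar_sub_left, QuadraticMap.polar_smul_left,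
    QuadraticMap.polar_sub_right, QuadraticMap.polar_smul_right, hn.polar_one_one, smul_eq_mul,
    QuadraticMap.polar_comm n 1 y]
  ring

theorem polar_octConj_left (hn : IsOctonionAlgebra n) (x y : C) :
    polar n (octConj n x) y = polar n x (octConj n y) := by
  rw [← hn.polar_octConj_octConj, hn.octConj_octConj]

theorem octConj_mul (hn : IsOctonionAlgebra n) (x y : C) :
    octConj n (x * y) = octConj n y * octConj n x := by
  refine hn.eq_of_polar fun z => ?_
  rw [hn.polar_octConj_left, hn.polar_mul_eq_left, ← hn.polar_mul_eq_right,
    hn.polar_mul_eq_left _ _ (octConj n y), hn.octConj_octConj, QuadraticMap.polar_comm]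

/-- Tested against $w$, with the left factors moved across by adjointness, this is `polar_mul_mul`.
It is the linearized form of $\bar x(xz)=n(x)z$. -/
theorem mul_octConj_mul_add (hn : IsOctonionAlgebra n) (x y z : C) :
    octConj n x * (y * z) + octConj n y * (x * z) = polar n x y • z := by
  refine hn.eq_of_polar fun w => ?_
  have h := hn.polar_mul_mul x y z w
  rw [QuadraticMap.polar_add_left, hn.polar_mul_eq_left, hn.polar_mul_eq_left (x * z),
    hn.octConj_octConj, hn.octConj_octConj, QuadraticMap.polar_smul_left, smul_eq_mul,
    QuadraticMap.polar_comm n (y * z)]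
  linear_combination h

theorem mul_octConj_add (hn : IsOctonionAlgebra n) (x y z : C) :
    (z * x) * octConj n y + (z * y) * octConj n x = polar n x y • z := by
  refine hn.eq_of_polar fun w => ?_
  have h := hn.polar_mul_mul z w x y
  rw [QuadraticMap.polar_add_left, hn.polar_mul_eq_right, hn.polar_mul_eq_right (z * y),
    hn.octConj_octConj, hn.octConj_octConj, QuadraticMap.polar_smul_left, smul_eq_mul]
  linear_combination h

theorem mul_mul_octConj_add (hn : IsOctonionAlgebra n) (x y z : C) :
    x * (octConj n y * z) + y * (octConj n x * z) = polar n x y • z := by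
  have h := hn.mul_octConj_mul_add (octConj n x) (octConj n y) z
  rwa [hn.octConj_octConj, hn.octConj_octConj, hn.polar_octConj_octConj] at h

theorem mul_octConj_mul_add' (hn : IsOctonionAlgebra n) (x y z : C) :
    (z * octConj n x) * y + (z * octConj n y) * x = polar n x y • z := by
  have h := hn.mul_octConj_add (octConj n x) (octConj n y) z
  rwa [hn.octConj_octConj, hn.octConj_octConj, hn.polar_octConj_octConj] at h

theorem octConj_mul_add (hn : IsOctonionAlgebra n) (x y : C) :
    octConj n x * y + octConj n y * x = polar n x y • (1 : C) := by
  simpa using hn.mul_octConj_mul_add x y 1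

end Algebra

end IsOctonionAlgebra

end Octonion

/-! ### Triality triples -/

section Tri

variable {R B : Type*} [CommRing R] [NonUnitalNonAssocRing B] [Module R B] [SMulCommClass R B B]
  [IsScalarTower R B B] (bar : B →ₗ[R] B)

/-- The components of the triples `T^i_{a,b}`: the component of index `i + j` of `T^i_{a,b}` is
`tri bar j a b`. -/
def triFun (j : Fin 3) (a b : B) : Module.End R B :=
  if j = 0 then LinearMap.mulLeft R (bar b) ∘ₗ LinearMap.mulLeft R a
    - LinearMap.mulLeft R (bar a) ∘ₗ LinearMap.mulLeft R b
  else if j = 1 then LinearMap.mulRight R (bar b) ∘ₗ LinearMap.mulRight R a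
    - LinearMap.mulRight R (bar a) ∘ₗ LinearMap.mulRight R b
  else LinearMap.mulRight R (bar a * b - bar b * a)
    + LinearMap.mulLeft R b ∘ₗ LinearMap.mulLeft R (bar a)
    - LinearMap.mulLeft R a ∘ₗ LinearMap.mulLeft R (bar b)

/-- `triFun` as a bilinear map. -/
def tri (j : Fin 3) : B →ₗ[R] B →ₗ[R] Module.End R B :=
  LinearMap.mk₂ R (triFun bar j)
    (fun a a' b => by
      ext x
      simp only [triFun]
      split_ifs <;> simp [add_mul, mul_add, mul_sub] <;> abel)
    (fun c a b => by
      ext x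
      simp only [triFun]
      split_ifs <;> simp [mul_sub, smul_sub, smul_mul_assoc, mul_smul_comm])
    (fun a b b' => by
      ext x
      simp only [triFun]
      split_ifs <;> simp [add_mul, mul_add, mul_sub] <;> abel)
    (fun c a b => by
      ext x
      simp only [triFun]
      split_ifs <;> simp [mul_sub, smul_sub, smul_mul_assoc, mul_smul_comm])

theorem tri_zero_apply (a b x : B) : tri bar 0 a b x = bar b * (a * x) - bar a * (b * x) := by
  simp [tri, triFun]

theorem tri_one_apply (a b x : B) : tri bar 1 a b x = (x * a) * bar b - (x * b) * bar a := by
  simp [tri, triFun]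

theorem tri_two_apply (a b x : B) :
    tri bar 2 a b x = x * (bar a * b - bar b * a) + b * (bar a * x) - a * (bar b * x) := by
  simp [tri, triFun]

theorem tri_self (j : Fin 3) (a : B) : tri bar j a a = 0 := by
  ext x
  fin_cases j
  · simp [tri_zero_apply]
  · simp [tri_one_apply]
  · simp [tri_two_apply]

theorem tri_swap (j : Fin 3) (a b : B) : tri bar j a b = - tri bar j b a := by
  have h := tri_self bar j (a + b)
  simp only [map_add, LinearMap.add_apply, tri_self, zero_add, add_zero] at h
  exact eq_neg_of_add_eq_zero_right h

/-- The triples of endomorphisms compatible with the product up to triality. -/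
def IsRelated (s : Fin 3 → Module.End R B) : Prop :=
  ∀ k x y, s k (bar (x * y)) = bar (s (k + 1) x * y + x * s (k + 2) y)

end Tri

/-- Only the difference $m-i$ matters, so every statement on $T^i_{a,b}$ becomes a statement on
three fixed families of operators, up to a cyclic shift. -/
theorem AllisonFaulkner.tripleFun_apply {K A : Type*} [Field K] [NonUnitalNonAssocRing A]
    [Module K A] [SMulCommClass K A A] [IsScalarTower K A A] (bar : A →ₗ[K] A) (i : Fin 3)
    (a b : A) (m : Fin 3) : tripleFun bar i a b m = tri bar (m - i) a b := by
  have h : ∀ m i : Fin 3, (m - i = 0 ↔ m = i) ∧ (m - i = 1 ↔ m = i + 1) := by decide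
  change _ = triFun bar (m - i) a b
  simp only [triFun, tripleFun, h]

/-! ### Local triality in an octonion algebra -/

namespace IsOctonionAlgebra

variable {E C : Type*} [CommRing E] [NonAssocRing C] [Module E C] {n : QuadraticForm E C}
  [SMulCommClass E C C] [IsScalarTower E C C]

/-- This explicit rotation, valid in one component only, is the anchor for identifying the triples
with elements of $\bigwedge^2C$. -/
theorem tri_two (hn : IsOctonionAlgebra n) (a b x : C) :
    tri (octConj n) 2 a b x = (2 : E) • (polar n a x • b - polar n b x • a) := by
  have h1 := hn.mul_mul_octConj_add x a b
  have h2 := hn.mul_mul_octConj_add x b a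
  have h3 := congrArg (b * ·) (hn.octConj_mul_add x a)
  have h4 := congrArg (a * ·) (hn.octConj_mul_add x b)
  simp only [mul_add, mul_smul_comm, mul_one] at h3 h4
  rw [tri_two_apply, mul_sub, QuadraticMap.polar_comm n a, QuadraticMap.polar_comm n b]
  linear_combination (norm := module) h1 - h2 + h3 - h4

/-- Adjointness exchanges the labels $a,b$ with the arguments $x,y$ and turns left multiplications
into right ones. Hence components 0 and 1 are swapped and component 2 is fixed, that is, $j\mapsto
1-j$ mod 3. -/
theorem polar_tri (hn : IsOctonionAlgebra n) (j : Fin 3) (a b x y : C) :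
    polar n (tri (octConj n) j a b x) y = polar n (tri (octConj n) (1 - j) x y a) b := by
  fin_cases j
  · change polar n (tri (octConj n) 0 a b x) y = polar n (tri (octConj n) 1 x y a) b
    rw [tri_zero_apply, tri_one_apply, QuadraticMap.polar_sub_left, QuadraticMap.polar_sub_left,
      hn.polar_mul_eq_left (a * x), hn.polar_mul_eq_left (b * x), hn.polar_mul_eq_right _ b,
      hn.polar_mul_eq_right _ b]
    simp only [hn.octConj_octConj]
    rw [QuadraticMap.polar_comm n (b * x), QuadraticMap.polar_comm n (a * y)]
  · change polar n (tri (octConj n) 1 a b x) y = polar n (tri (octConj n) 0 x y a) b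
    rw [tri_zero_apply, tri_one_apply, QuadraticMap.polar_sub_left, QuadraticMap.polar_sub_left,
      hn.polar_mul_eq_left (x * a), hn.polar_mul_eq_left (y * a), hn.polar_mul_eq_right _ y,
      hn.polar_mul_eq_right _ y]
    simp only [hn.octConj_octConj]
    rw [QuadraticMap.polar_comm n (x * b)]
  · change polar n (tri (octConj n) 2 a b x) y = polar n (tri (octConj n) 2 x y a) b
    rw [hn.tri_two, hn.tri_two]
    simp only [QuadraticMap.polar_sub_left, QuadraticMap.polar_smul_left, smul_eq_mul,
      QuadraticMap.polar_comm n x, QuadraticMap.polar_comm n y]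
    ring

/-- Two uses of the duality `polar_tri`, with the alternation of $T_{x,y}$ in between, return to the
same operator with $x,y$ exchanged and a sign. -/
theorem tri_skew (hn : IsOctonionAlgebra n) (j : Fin 3) (a b x y : C) :
    polar n (tri (octConj n) j a b x) y = - polar n x (tri (octConj n) j a b y) := by
  rw [hn.polar_tri, tri_swap, LinearMap.neg_apply, QuadraticMap.polar_neg_left,
    ← sub_sub_cancel 1 j, ← hn.polar_tri, QuadraticMap.polar_comm, sub_sub_cancel]

theorem polar_mul_octConj_rotate (hn : IsOctonionAlgebra n) (x y z : C) :
    polar n (x * y) (octConj n z) = polar n (y * z) (octConj n x) := by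
  rw [hn.polar_mul_eq_left, hn.polar_mul_eq_right]

/-- Related triples of skew maps, in terms of the trilinear form `n(xy, z̄)`. -/
theorem isRelated_iff (hn : IsOctonionAlgebra n) {s : Fin 3 → Module.End E C}
    (hs : ∀ k x y, polar n (s k x) y = - polar n x (s k y)) (k : Fin 3) :
    IsRelated (octConj n) s ↔ ∀ x y z, polar n (s (k + 1) x * y) (octConj n z)
      + polar n (x * s (k + 2) y) (octConj n z) + polar n (x * y) (octConj n (s k z)) = 0 := by
  have key : ∀ k, (∀ x y, s k (octConj n (x * y)) = octConj n (s (k + 1) x * y + x * s (k + 2) y))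
      ↔ ∀ x y z, polar n (s (k + 1) x * y) (octConj n z)
      + polar n (x * s (k + 2) y) (octConj n z) + polar n (x * y) (octConj n (s k z)) = 0 := by
    intro k
    have h : ∀ x y z, polar n (octConj n (s (k + 1) x * y + x * s (k + 2) y)) z
        - polar n (s k (octConj n (x * y))) z = polar n (s (k + 1) x * y) (octConj n z)
      + polar n (x * s (k + 2) y) (octConj n z) + polar n (x * y) (octConj n (s k z)) := by
      intro x y z
      rw [hs, hn.polar_octConj_left, hn.polar_octConj_left, QuadraticMap.polar_add_left]
      ring
    constructor
    · intro h2 x y z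
      rw [← h, h2, sub_self]
    · intro h2 x y
      refine hn.eq_of_polar fun z => ?_
      rw [eq_comm, ← sub_eq_zero, h, h2]
  -- The trilinear form $n(xy,\bar z)$ is invariant under cyclic permutations, so the identity for
  -- one index yields the next; one index suffices for all.
  have rot : ∀ k, (∀ x y z, polar n (s (k + 1) x * y) (octConj n z)
      + polar n (x * s (k + 2) y) (octConj n z) + polar n (x * y) (octConj n (s k z)) = 0) →
      (∀ x y z, polar n (s (k + 1 + 1) x * y) (octConj n z)
      + polar n (x * s (k + 1 + 2) y) (octConj n z)
      + polar n (x * y) (octConj n (s (k + 1) z)) = 0) := by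
    intro k h x y z
    have h1 := h z x y
    have e1 : k + 1 + 1 = k + 2 := by rw [add_assoc]; rfl
    have e2 : k + 1 + 2 = k := by rw [add_assoc]; exact add_zero k
    rw [e1, e2]
    rw [hn.polar_mul_octConj_rotate, hn.polar_mul_octConj_rotate z,
      hn.polar_mul_octConj_rotate z x] at h1
    linear_combination h1
  constructor
  · intro h
    exact (key k).1 (h k)
  · intro h k'
    refine (key k').2 ?_
    have e : k' = k ∨ k' = k + 1 ∨ k' = k + 1 + 1 := by
      clear h; revert k k'; decide
    rcases e with rfl | rfl | rfl
    · exact h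
    · exact rot _ h
    · exact rot _ (rot _ h)

/-- By cyclic invariance only index 2 has to be checked. There the rotation formula applies, and
linearized alternativity shows that $T_0(x)y+xT_1(y)$ is the matching rotation of $xy$ by $\bar
a,\bar b$. -/
theorem isRelated_tri (hn : IsOctonionAlgebra n) (a b : C) :
    IsRelated (octConj n) fun k => tri (octConj n) k a b := by
  rw [hn.isRelated_iff (fun k => hn.tri_skew k a b) 2]
  intro x y z
  have h1 := fun a b => hn.mul_octConj_mul_add' (octConj n (a * x)) y (octConj n b)
  have h2 := fun a b => hn.mul_mul_octConj_add x (octConj n (y * a)) (octConj n b)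
  have h : tri (octConj n) 0 a b x * y + x * tri (octConj n) 1 a b y = (2 : E) •
      (polar n (x * y) (octConj n a) • octConj n b
        - polar n (x * y) (octConj n b) • octConj n a) := by
    have e1 := fun a => (hn.polar_octConj_left (a * x) y).trans
      (hn.polar_mul_octConj_rotate a x y)
    simp only [hn.octConj_octConj, hn.octConj_mul] at h1 h2 e1
    simp only [e1, ← hn.polar_mul_eq_right] at h1 h2
    simp only [tri_zero_apply, tri_one_apply, sub_mul, mul_sub]
    linear_combination (norm := module) h1 a b - h1 b a + h2 a b - h2 b a
  have h' := congrArg (fun v => polar n v (octConj n z)) h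
  simp only [QuadraticMap.polar_add_left, QuadraticMap.polar_sub_left,
    QuadraticMap.polar_smul_left, hn.polar_octConj_octConj, smul_eq_mul] at h'
  change polar n (tri (octConj n) 0 a b x * y) _ + polar n (x * tri (octConj n) 1 a b y) _ +
    polar n (x * y) (octConj n (tri (octConj n) 2 a b z)) = 0
  rw [h', hn.tri_two]
  simp only [map_sub, map_smul, QuadraticMap.polar_sub_right,
    QuadraticMap.polar_smul_right, smul_eq_mul]
  ring


/-- Components 0 and 1 of $T_{a,b}$ are iterated products, on which a related triple acts as a
derivation with shifted indices; in component 2 skewness of $s_{i+2}$ and the rotation formula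
suffice. -/
theorem commutator_tri (hn : IsOctonionAlgebra n) {s : Fin 3 → Module.End E C}
    (hs : ∀ k x y, polar n (s k x) y = - polar n x (s k y)) (hr : IsRelated (octConj n) s)
    (i j : Fin 3) (a b x : C) :
    s (j + i) (tri (octConj n) j a b x) - tri (octConj n) j a b (s (j + i) x) =
      tri (octConj n) j (s (i + 2) a) b x + tri (octConj n) j a (s (i + 2) b) x := by
  have e1 : i + 2 + 1 = i := by revert i; decide
  have e2 : i + 1 + 1 = i + 2 := by rw [add_assoc]; rfl
  have e3 : i + 1 + 2 = i := by revert i; decide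
  have e4 : i + 2 + 2 = i + 1 := by revert i; decide
  fin_cases j
  · change s (0 + i) (tri (octConj n) 0 a b x) - tri (octConj n) 0 a b (s (0 + i) x) =
      tri (octConj n) 0 (s (i + 2) a) b x + tri (octConj n) 0 a (s (i + 2) b) x
    rw [zero_add]
    -- Relatedness is used twice, at $i$ for the outer product and at $i+1$ for the inner one, after
    -- writing each product as the conjugate of a product.
    have h : ∀ a b, s i (octConj n b * (a * x)) = octConj n (s (i + 2) b) * (a * x)
        + octConj n b * (s (i + 2) a * x) + octConj n b * (a * s i x) := by
      intro a b
      have h1 := hr i (octConj n (a * x)) b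
      have h2 := hr (i + 1) a x
      rw [hn.octConj_mul, hn.octConj_octConj] at h1
      rw [h1, map_add, hn.octConj_mul, h2, hn.octConj_mul (octConj n (a * x)), hn.octConj_octConj,
        hn.octConj_octConj, e2, e3, mul_add]
      abel
    simp only [tri_zero_apply, map_sub, h]
    abel
  · change s (1 + i) (tri (octConj n) 1 a b x) - tri (octConj n) 1 a b (s (1 + i) x) =
      tri (octConj n) 1 (s (i + 2) a) b x + tri (octConj n) 1 a (s (i + 2) b) x
    rw [add_comm 1 i]
    have h : ∀ a b, s (i + 1) (x * a * octConj n b) = x * a * octConj n (s (i + 2) b)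
        + x * s (i + 2) a * octConj n b + s (i + 1) x * a * octConj n b := by
      intro a b
      have h1 := hr (i + 1) b (octConj n (x * a))
      have h2 := hr i x a
      rw [hn.octConj_mul, hn.octConj_octConj] at h1
      rw [h1, map_add, hn.octConj_mul, e3, h2, hn.octConj_mul b, hn.octConj_octConj,
        hn.octConj_octConj, e2, add_mul]
      abel
    simp only [tri_one_apply, map_sub, h]
    abel
  · change s (2 + i) (tri (octConj n) 2 a b x) - tri (octConj n) 2 a b (s (2 + i) x) =
      tri (octConj n) 2 (s (i + 2) a) b x + tri (octConj n) 2 a (s (i + 2) b) x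
    rw [add_comm 2 i]
    simp only [hn.tri_two, map_sub, map_smul, hs (i + 2) a x, hs (i + 2) b x]
    module

/-- Paired with $y$ and transformed by `polar_tri`, the three terms become the trilinear relation
for the single triple $T_{x,y}$ at index $1-j$, evaluated at $b,c,a$. -/
theorem tri_add_tri_add_tri (hn : IsOctonionAlgebra n) (j : Fin 3) (a b c x : C) :
    tri (octConj n) j a (octConj n (b * c)) x + tri (octConj n) (j - 1) b (octConj n (c * a)) x
      + tri (octConj n) (j - 2) c (octConj n (a * b)) x = 0 := by
  refine hn.eq_of_polar fun y => ?_
  have e1 : 1 - (j - 1) = 1 - j + 1 := by revert j; decide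
  have e2 : 1 - (j - 2) = 1 - j + 2 := by revert j; decide
  have h := (hn.isRelated_iff (fun k => hn.tri_skew k x y) (1 - j)).1 (hn.isRelated_tri x y) b c a
  rw [hn.polar_mul_eq_right, hn.polar_mul_eq_left, ← hn.octConj_mul, ← hn.octConj_mul]
    at h
  simp only [QuadraticMap.polar_add_left, QuadraticMap.polar_zero_left]
  rw [hn.polar_tri j, hn.polar_tri (j - 1), hn.polar_tri (j - 2), e1, e2,
    QuadraticMap.polar_comm n _ (octConj n (b * c)),
    hn.polar_octConj_left (b * c)]
  linear_combination h

end IsOctonionAlgebra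

/-! ### Traces -/

/-- The base $E$ may be $K\times K$, so the argument avoids field hypotheses on $E$. An endomorphism
is a sum of maps $\varphi(\cdot)v$, and cyclicity turns the $K$-trace of such a map into the trace
of multiplication by $\varphi(v)$ on $E$. -/
theorem LinearMap.trace_restrictScalars_eq {K E V : Type*} [Field K] [CommRing E] [Algebra K E]
    [AddCommGroup V] [Module E V] [Module K V] [IsScalarTower K E V] [Module.Finite K E]
    [Module.Free E V] [Module.Finite E V] (f : V →ₗ[E] V) :
    trace K V (f.restrictScalars K) = Algebra.trace K E (trace E V f) := by
  have : Module.Finite K V := Module.Finite.trans E V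
  have key : ∀ (φ : V →ₗ[E] E) (v : V), trace K V ((φ.smulRight v).restrictScalars K) =
      Algebra.trace K E (φ v) := by
    intro φ v
    have h : (φ.smulRight v).restrictScalars K =
        (LinearMap.toSpanSingleton E V v).restrictScalars K ∘ₗ φ.restrictScalars K := by
      ext x; simp
    rw [h, trace_comp_comm', Algebra.trace_apply]
    congr 1
    ext e
    simp [mul_comm]
  let b := Module.Free.chooseBasis E V
  have hf : f = ∑ i, (b.coord i).smulRight (f (b i)) := by
    refine b.ext fun j => ?_
    simp [LinearMap.sum_apply, Finsupp.single_apply, ite_smul]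
  have h2 : ∀ s : Finset (Module.Free.ChooseBasisIndex E V),
      trace K V ((∑ i ∈ s, (b.coord i).smulRight (f (b i))).restrictScalars K) =
      Algebra.trace K E (trace E V (∑ i ∈ s, (b.coord i).smulRight (f (b i)))) := by
    intro s
    induction s using Finset.cons_induction with
    | empty => simp
    | cons i s hi ih =>
      rw [Finset.sum_cons, LinearMap.restrictScalars_add, map_add, ih, key, map_add, map_add,
        trace_smulRight]
  rw [hf, h2]

namespace IsOctonionAlgebra

variable {E C : Type*} [CommRing E] [NonAssocRing C] [Module E C] {n : QuadraticForm E C}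

theorem nontrivial (hn : IsOctonionAlgebra n) : Nontrivial E := by
  by_contra h
  rw [not_nontrivial_iff_subsingleton] at h
  have h8 := hn.finrank_eq
  rw [Module.finrank, rank_subsingleton] at h8
  norm_num at h8

theorem finite (hn : IsOctonionAlgebra n) : Module.Finite E C :=
  have := hn.nontrivial
  have := hn.free
  Module.finite_of_finrank_pos (by rw [hn.finrank_eq]; norm_num)

theorem trace_id (hn : IsOctonionAlgebra n) : LinearMap.trace E C LinearMap.id = 8 := by
  have := hn.free
  have := hn.finite
  have := hn.nontrivial
  rw [LinearMap.trace_id, hn.finrank_eq]; norm_num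

/-! ### The middle nucleus and uniqueness in local triality -/

variable [SMulCommClass E C C] [IsScalarTower E C C]

/-- The middle nucleus of an octonion algebra has no nonzero elements of trace zero. -/
theorem eq_zero_of_mem_middle_nucleus (hn : IsOctonionAlgebra n) [IsReduced E]
    (h6 : IsUnit (6 : E)) {p : C} (hp : octConj n p = -p)
    (h : ∀ x y : C, (x * p) * y = x * (p * y)) : p = 0 := by
  have := hn.free
  have := hn.finite
  have h2 : IsUnit (2 : E) := isUnit_of_mul_isUnit_left (y := 3) (by norm_num; exact h6)
  have hpp : ∀ z, (z * p) * p = - (n p • z) := fun z => hn.eq_of_polar fun w => by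
    rw [hn.polar_mul_eq_right, hp, mul_neg, QuadraticMap.polar_neg_right, hn.polar_mul_right,
      QuadraticMap.polar_neg_left, QuadraticMap.polar_smul_left, smul_eq_mul, mul_comm]
  have hmid : ∀ x q : C, x * (q * p) = (x * q) * p := by
    intro x q
    have h1 := hn.mul_octConj_add q p x
    have h2 := congrArg (x * ·) (hn.mul_octConj_add q p 1)
    simp only [one_mul, hp, mul_neg, mul_add, mul_smul_comm, mul_one, ← h] at h1 h2
    linear_combination (norm := module) h1 - h2
  -- The operator $M=L_xR_p$ satisfies $M^2=n(x)n(p)$, because $p$ lies in the middle nucleus. Also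
  -- $2M$ is the scalar $n(x,p)$ plus four maps of rank at most one. Computing the trace of $2M^2$
  -- from both descriptions gives the relation.
  have key : ∀ x : C, octConj n x = -x → polar n x p ^ 2 = 4 * n x * n p := by
    intro x hx
    have hxx : ∀ z, x * (x * z) = - (n x • z) := fun z => hn.eq_of_polar fun w => by
      rw [hn.polar_mul_eq_left, hx, neg_mul, QuadraticMap.polar_neg_right, hn.polar_mul_left,
        QuadraticMap.polar_neg_left, QuadraticMap.polar_smul_left, smul_eq_mul]
    have hxp : polar n (x * p) 1 = - polar n x p := by
      rw [hn.polar_mul_eq_right, hp, one_mul, QuadraticMap.polar_neg_right]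
    set M : C →ₗ[E] C := LinearMap.mulLeft E x ∘ₗ LinearMap.mulRight E p with hM
    set F : C →ₗ[E] C := (n.polarBilin (x * p)).smulRight 1 + (n.polarBilin 1).smulRight (x * p)
      - (n.polarBilin x).smulRight p - (n.polarBilin p).smulRight x with hF
    have e1 : (2 : E) • M = polar n x p • LinearMap.id + F := by
      ext q
      have h1 := hn.mul_octConj_mul_add q (x * p) 1
      have h3 := hn.mul_octConj_mul_add q x p
      have h4 : octConj n (x * p) * q = - (polar n x p • q) - x * (p * q) := by
        rw [octConj_apply, hxp, sub_mul, smul_mul_assoc, one_mul, neg_smul, h]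
      have h5 := congrArg (x * ·) (hn.octConj_mul_add p q)
      simp only [hp, mul_add, neg_mul, mul_neg, octConj_apply q, sub_mul, smul_mul_assoc, one_mul,
        mul_sub, mul_smul_comm, mul_one, hx] at h1 h3 h5
      simp only [hM, hF, LinearMap.comp_apply, LinearMap.mulLeft_apply, LinearMap.mulRight_apply,
        LinearMap.smul_apply, LinearMap.id_apply, LinearMap.add_apply, LinearMap.sub_apply,
        LinearMap.smulRight_apply, QuadraticMap.polarBilin_apply_apply]
      rw [h4] at h1
      rw [QuadraticMap.polar_comm n (x * p), QuadraticMap.polar_comm n 1,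
        QuadraticMap.polar_comm n x q]
      linear_combination (norm := module) h1 - h3 - h5
    have e2 : M ∘ₗ M = (n x * n p) • LinearMap.id := by
      ext q
      simp only [hM, LinearMap.comp_apply, LinearMap.mulLeft_apply, LinearMap.mulRight_apply,
        LinearMap.smul_apply, LinearMap.id_apply]
      rw [← hmid, hpp, mul_neg, mul_neg, mul_smul_comm, mul_smul_comm, hxx, smul_neg, neg_neg,
        smul_smul, mul_comm]
    have e3 : (2 : E) • (M ∘ₗ M) = polar n x p • M + M ∘ₗ F := by
      rw [← LinearMap.comp_smul, e1, LinearMap.comp_add, LinearMap.comp_smul, LinearMap.comp_id]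
    have t1 := congrArg (LinearMap.trace E C) e1
    have t3 := congrArg (LinearMap.trace E C) e3
    have e4 : M ∘ₗ F = (n.polarBilin (x * p)).smulRight (x * p)
        + (n.polarBilin 1).smulRight ((n x * n p) • 1)
        + (n.polarBilin x).smulRight (n p • x) + (n.polarBilin p).smulRight (n x • p) := by
      have m1 : x * (x * p * p) = (n x * n p) • 1 := by
        have h1 := hxx 1
        rw [mul_one] at h1
        rw [hpp, mul_neg, mul_smul_comm, h1, smul_neg, neg_neg, smul_smul, mul_comm]
      have m2 : x * (p * p) = - (n p • x) := by
        rw [← h, hpp]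
      ext q
      simp only [hM, hF, LinearMap.comp_apply, LinearMap.mulLeft_apply, LinearMap.mulRight_apply,
        LinearMap.add_apply, LinearMap.sub_apply, one_mul, mul_add, add_mul, mul_sub, sub_mul,
        smul_mul_assoc, mul_smul_comm, m1, m2, hxx,
        LinearMap.smulRight_apply, QuadraticMap.polarBilin_apply_apply]
      module
    rw [e2, e4] at t3
    rw [hF] at t1
    simp only [map_add, map_smul, map_sub, LinearMap.trace_smulRight, hn.trace_id,
      QuadraticMap.polarBilin_apply_apply, smul_eq_mul,
      QuadraticMap.polar_self, hxp, QuadraticMap.polar_comm n 1, hn.map_mul, hn.polar_one_one,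
      QuadraticMap.polar_comm n p x, nsmul_eq_mul, Nat.cast_ofNat] at t1 t3
    refine (h2.mul h2).mul_left_cancel ?_
    linear_combination -polar n x p * t1 - 2 * t3
  have hpure : ∀ q : C, octConj n (q - octConj n q) = - (q - octConj n q) := fun q => by
    rw [map_sub, hn.octConj_octConj, neg_sub]
  have hqp : ∀ q, polar n (q - octConj n q) p = 2 * polar n q p := fun q => by
    rw [QuadraticMap.polar_sub_left, hn.polar_octConj_left, hp, QuadraticMap.polar_neg_right]
    ring
  -- Polarizing `key` on trace-zero elements says that $n(p)$ times the norm form there is a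
  -- multiple of the square of the functional $n(p,\cdot)$, absurd on a space of rank 7 unless
  -- $n(p)=0$. The traces of both sides are $16\,n(p)$ and $112\,n(p)$, and the difference
  -- $96=6\cdot 16$ is a unit.
  have hnp : n p = 0 := by
    have e : (8 : E) • (n.polarBilin p).smulRight p = (16 * n p) • LinearMap.id
        - (8 * n p) • (n.polarBilin 1).smulRight 1 := by
      ext q
      refine hn.eq_of_polar fun w => ?_
      have hx := hpure q
      have hy := hpure w
      have k1 := key _ hx
      have k2 := key _ hy
      have k3 := key (q - octConj n q + (w - octConj n w)) (by rw [map_add, hx, hy, neg_add])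
      have k4 : n (q - octConj n q + (w - octConj n w)) = 4 * polar n q w
          - 2 * (polar n q 1 * polar n w 1) + n (q - octConj n q) + n (w - octConj n w) := by
        have : polar n (q - octConj n q) (w - octConj n w) = 4 * polar n q w
          - 2 * (polar n q 1 * polar n w 1) := by
          simp only [octConj_apply, QuadraticMap.polar_sub_left, QuadraticMap.polar_smul_left,
            QuadraticMap.polar_sub_right, QuadraticMap.polar_smul_right, hn.polar_one_one,
            smul_eq_mul, QuadraticMap.polar_comm n 1 w]
          ring
        rw [← this, polar]; ring
      rw [QuadraticMap.polar_add_left, hqp, hqp, k4] at k3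
      rw [hqp] at k1 k2
      simp only [LinearMap.smul_apply, LinearMap.id_apply, LinearMap.sub_apply,
        LinearMap.smulRight_apply, QuadraticMap.polarBilin_apply_apply,
        QuadraticMap.polar_sub_left, QuadraticMap.polar_smul_left, smul_eq_mul,
        QuadraticMap.polar_comm n p, QuadraticMap.polar_comm n 1]
      linear_combination k3 - k1 - k2
    have t := congrArg (LinearMap.trace E C) e
    simp only [map_smul, map_sub, LinearMap.trace_smulRight, hn.trace_id, hn.polar_one_one,
      QuadraticMap.polarBilin_apply_apply, smul_eq_mul, QuadraticMap.polar_self, nsmul_eq_mul,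
      Nat.cast_ofNat] at t
    refine (h6.mul ((h2.mul h2).mul (h2.mul h2))).mul_left_cancel ?_
    linear_combination -t
  refine hn.eq_of_polar fun z => ?_
  have k := key _ (hpure z)
  rw [hqp, hnp, mul_zero] at k
  rw [QuadraticMap.polar_zero_left, QuadraticMap.polar_comm]
  exact (h2.mul_right_eq_zero).1 (pow_eq_zero_iff two_ne_zero |>.1 k)

/-- A related triple of skew maps on an octonion algebra is determined by one of its entries. -/
theorem eq_zero_of_isRelated (hn : IsOctonionAlgebra n) [IsReduced E] (h6 : IsUnit (6 : E))
    {s : Fin 3 → Module.End E C}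
    (hs : ∀ k x y, polar n (s k x) y = - polar n x (s k y)) (hr : IsRelated (octConj n) s)
    (h : s 2 = 0) : s = 0 := by
  have h2 : IsUnit (2 : E) := isUnit_of_mul_isUnit_left (y := 3) (by norm_num; exact h6)
  have h0 : ∀ x y, s 0 x * y + x * s 1 y = 0 := by
    intro x y
    have h1 := hr 2 x y
    rw [h, LinearMap.zero_apply] at h1
    rw [← hn.octConj_octConj (s 0 x * y + x * s 1 y)]
    exact (congrArg (octConj n) h1.symm).trans (map_zero _)
  -- With $s_2=0$ the relation reads $s_0(x)y=-x\,s_1(y)$. Setting one argument to $1$ gives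
  -- $s_0=R_p$ and $s_1=-L_p$, so $p$ is in the middle nucleus; skewness of $s_0$ makes its trace
  -- zero.
  set p := s 0 1 with hp
  have e1 : ∀ y, s 1 y = - (p * y) := fun y => by
    have := h0 1 y
    rw [one_mul] at this
    exact eq_neg_of_add_eq_zero_right this
  have e0 : ∀ x, s 0 x = x * p := fun x => by
    have := h0 x 1
    rw [e1, mul_one, mul_one, mul_neg] at this
    exact (add_neg_eq_zero.1 this)
  have hp0 : p = 0 := by
    refine hn.eq_zero_of_mem_middle_nucleus h6 ?_ fun x y => ?_
    · have h1 := hs 0 1 1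
      rw [QuadraticMap.polar_comm n 1, ← hp, eq_neg_iff_add_eq_zero, ← two_mul,
        h2.mul_right_eq_zero] at h1
      rw [octConj_apply, h1, zero_smul, zero_sub]
    · have h1 := h0 x y
      rw [e0, e1, mul_neg] at h1
      exact (add_neg_eq_zero.1 h1)
  funext k
  fin_cases k
  · ext x; change s 0 x = 0; rw [e0, hp0, mul_zero]
  · ext x; change s 1 x = 0; rw [e1, hp0, zero_mul, neg_zero]
  · exact h

end IsOctonionAlgebra

/-! ### Exterior squares and bilinear alternating maps -/

section Wedge

variable {R V M : Type*} [CommRing R] [AddCommGroup V] [Module R V] [AddCommGroup M] [Module R M]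

/-- The bilinear map `(u, v) ↦ u ∧ v`. -/
def wedge : V →ₗ[R] V →ₗ[R] ⋀[R]^2 V :=
  LinearMap.mk₂ R (fun u v => exteriorPower.ιMulti R 2 ![u, v])
    (fun u u' v => (exteriorPower.ιMulti R 2).map_vecCons_add ![v] u u')
    (fun c u v => (exteriorPower.ιMulti R 2).map_vecCons_smul ![v] c u)
    (fun u v v' => by
      have h := (exteriorPower.ιMulti R 2).map_update_add ![u, v] 1 v v'
      have e : ∀ w : V, Function.update ![u, v] 1 w = ![u, w] := fun w => by
        ext i; fin_cases i <;> rfl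
      rwa [e, e, e] at h)
    (fun c u v => by
      have h := (exteriorPower.ιMulti R 2).map_update_smul ![u, v] 1 c v
      have e : ∀ w : V, Function.update ![u, v] 1 w = ![u, w] := fun w => by
        ext i; fin_cases i <;> rfl
      rwa [e, e] at h)

theorem wedge_self (u : V) : wedge (R := R) u u = 0 :=
  (exteriorPower.ιMulti R 2).map_eq_zero_of_eq ![u, u] (i := 0) (j := 1) rfl (by decide)

theorem wedge_swap (u v : V) : wedge (R := R) u v = - wedge v u := by
  have h := wedge_self (R := R) (u + v)
  simp only [map_add, LinearMap.add_apply, wedge_self, zero_add, add_zero] at h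
  exact eq_neg_of_add_eq_zero_right h

theorem span_wedge : Submodule.span R {w : ⋀[R]^2 V | ∃ u v, w = wedge u v} = ⊤ := by
  rw [eq_top_iff, ← exteriorPower.ιMulti_span R 2 V]
  refine Submodule.span_mono ?_
  rintro _ ⟨a, rfl⟩
  refine ⟨a 0, a 1, congrArg _ ?_⟩
  ext i; fin_cases i <;> rfl

theorem wedge_induction {p : ⋀[R]^2 V → Prop} (hw : ∀ u v, p (wedge u v))
    (hz : p 0) (ha : ∀ x y, p x → p y → p (x + y)) (w : ⋀[R]^2 V) : p w := by
  have h : w ∈ Submodule.span R {w : ⋀[R]^2 V | ∃ u v, w = wedge u v} := by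
    rw [span_wedge]; trivial
  induction h using Submodule.closure_induction with
  | zero => exact hz
  | add x y _ _ hx hy => exact ha x y hx hy
  | smul_mem c x hx =>
    obtain ⟨u, v, rfl⟩ := hx
    rw [← LinearMap.smul_apply, ← map_smul]
    exact hw _ _

/-- The linear map on `⋀² V` induced by an alternating bilinear map. -/
def wedgeLift (f : V →ₗ[R] V →ₗ[R] M) (hf : ∀ v, f v v = 0) : ⋀[R]^2 V →ₗ[R] M :=
  exteriorPower.alternatingMapLinearEquiv
    { toFun := fun v => f (v 0) (v 1)
      map_update_add' := fun v i x y => by fin_cases i <;> simp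
      map_update_smul' := fun v i c x => by fin_cases i <;> simp
      map_eq_zero_of_eq' := fun v i j h hij => by
        have : v 0 = v 1 := by
          fin_cases i <;> fin_cases j <;> first | exact h | exact h.symm | exact absurd rfl hij
        simp [this, hf] }

theorem wedgeLift_wedge (f : V →ₗ[R] V →ₗ[R] M) (hf : ∀ v, f v v = 0) (u v : V) :
    wedgeLift f hf (wedge u v) = f u v :=
  exteriorPower.alternatingMapLinearEquiv_apply_ιMulti _ _

/-- The factor $4$ appears because each polar value is twice the bilinear form used in `lambdaSq`,
and the determinant has degree two. -/
theorem lambdaSq_bilin_wedge [Invertible (2 : R)] (q : QuadraticForm R V) (u v u' v' : V) :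
    4 * (exteriorPower.pairingDual R V 2 ∘ₗ exteriorPower.map 2 (QuadraticMap.associated q))
      (wedge u v) (wedge u' v') = polar q u u' * polar q v v' - polar q u v' * polar q v u' := by
  have h := lambdaSq_bilin_apply q ![u, v] ![u', v']
  rw [Matrix.det_fin_two] at h
  have h2 : ∀ x y, polar q x y = 2 * QuadraticMap.associated q x y := fun x y => by
    have h3 := congrArg (fun f => f x y) (QuadraticMap.two_nsmul_associated R q)
    rw [← QuadraticMap.polarBilin_apply_apply, ← h3, two_smul, two_mul]
    rfl
  refine (congrArg (4 * ·) h).trans ?_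
  simp [h2]
  ring

end Wedge

/-! ### The triality Lie algebra of an octonion algebra -/

/-- The related triples of skew endomorphisms. -/
def skewTriples {E C : Type*} [CommRing E] [NonAssocRing C] [Module E C]
    [SMulCommClass E C C] [IsScalarTower E C C] (n : QuadraticForm E C) :
    Submodule E (Fin 3 → Module.End E C) where
  carrier := {s | (∀ k x y, polar n (s k x) y = - polar n x (s k y)) ∧ IsRelated (octConj n) s}
  add_mem' := by
    rintro s t ⟨hs, hs'⟩ ⟨ht, ht'⟩
    refine ⟨fun k x y => ?_, fun k x y => ?_⟩
    · simp only [Pi.add_apply, LinearMap.add_apply, QuadraticMap.polar_add_left,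
        QuadraticMap.polar_add_right, hs k x, ht k x]
      ring
    · simp only [Pi.add_apply, LinearMap.add_apply, hs' k, ht' k, add_mul, mul_add, map_add]
      abel
  zero_mem' := ⟨fun k x y => by simp, fun k x y => by simp⟩
  smul_mem' := by
    rintro c s ⟨hs, hs'⟩
    refine ⟨fun k x y => ?_, fun k x y => ?_⟩
    · simp only [Pi.smul_apply, LinearMap.smul_apply, QuadraticMap.polar_smul_left,
        QuadraticMap.polar_smul_right, hs k x, smul_eq_mul]
      ring
    · simp only [Pi.smul_apply, LinearMap.smul_apply, hs' k, smul_mul_assoc, mul_smul_comm,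
        map_smul, ← smul_add]

/-- The bilinear map `tri (octConj n) j` as a linear map on the exterior square. -/
def extTri {E C : Type*} [CommRing E] [NonAssocRing C] [Module E C]
    [SMulCommClass E C C] [IsScalarTower E C C] (n : QuadraticForm E C) (j : Fin 3) :
    ⋀[E]^2 C →ₗ[E] Module.End E C :=
  wedgeLift (tri (octConj n) j) (tri_self _ j)

theorem extTri_wedge {E C : Type*} [CommRing E] [NonAssocRing C] [Module E C]
    [SMulCommClass E C C] [IsScalarTower E C C] (n : QuadraticForm E C) (j : Fin 3) (u v : C) :
    extTri n j (wedge u v) = tri (octConj n) j u v :=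
  wedgeLift_wedge _ _ _ _

namespace IsOctonionAlgebra

variable {E C : Type*} [CommRing E] [NonAssocRing C] [Module E C] {n : QuadraticForm E C}

/-- Over a ring that is not a field, nondegeneracy only makes the map to the dual injective. An
injective endomorphism of a finite module over an Artinian ring is bijective. -/
theorem exists_dual_bases (hn : IsOctonionAlgebra n) [IsArtinianRing E] :
    ∃ e f : Fin 8 → C, (∀ c, ∑ i, polar n (f i) c • e i = c) ∧
      (∀ c, ∑ i, polar n (e i) c • f i = c) := by
  have := hn.free
  have := hn.finite
  have := hn.nontrivial
  let b := Module.finBasisOfFinrankEq E C hn.finrank_eq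
  have hinj : Function.Injective (b.toDualEquiv.symm.toLinearMap ∘ₗ n.polarBilin) := by
    refine b.toDualEquiv.symm.injective.comp fun x y h => hn.eq_of_polar fun z => ?_
    exact DFunLike.congr_fun h z
  have hbij := IsArtinian.bijective_of_injective_endomorphism _ hinj
  choose f hf using fun i => hbij.2 (b.toDualEquiv.symm (b.coord i))
  have hf' : ∀ i c, polar n (f i) c = b.coord i c := fun i c =>
    DFunLike.congr_fun (b.toDualEquiv.symm.injective (hf i)) c
  have h1 : ∀ c, ∑ i, polar n (f i) c • b i = c := fun c => by
    simp only [hf', Module.Basis.coord_apply, b.sum_repr]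
  refine ⟨b, f, h1, fun c => hn.eq_of_polar fun z => ?_⟩
  change n.polarBilin (∑ i, polar n (b i) c • f i) z = n.polarBilin c z
  conv_rhs => rw [← h1 z]
  simp only [map_sum, LinearMap.sum_apply, map_smul, LinearMap.smul_apply,
    QuadraticMap.polarBilin_apply_apply, smul_eq_mul]
  exact Finset.sum_congr rfl fun i _ => by rw [mul_comm, QuadraticMap.polar_comm n c]

/-- In dual bases the trace is $\sum n(f_i,s e_i)$ and also $\sum n(e_i,s f_i)$. Skewness makes the
two expressions opposite. -/
theorem trace_eq_zero_of_skew (hn : IsOctonionAlgebra n) [IsArtinianRing E] (h2 : IsUnit (2 : E))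
    {s : Module.End E C} (hs : ∀ x y, polar n (s x) y = - polar n x (s y)) :
    LinearMap.trace E C s = 0 := by
  have := hn.free
  have := hn.finite
  obtain ⟨e, f, he, hf⟩ := hn.exists_dual_bases
  have h1 : s = ∑ i, (n.polarBilin (f i)).smulRight (s (e i)) := by
    ext x
    conv_lhs => rw [← he x]
    simp
  have h1' : s = ∑ i, (n.polarBilin (e i)).smulRight (s (f i)) := by
    ext x
    conv_lhs => rw [← hf x]
    simp
  have t1 := congrArg (LinearMap.trace E C) h1
  have t2 := congrArg (LinearMap.trace E C) h1'
  simp only [map_sum, LinearMap.trace_smulRight, QuadraticMap.polarBilin_apply_apply] at t1 t2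
  refine h2.mul_right_eq_zero.1 ?_
  rw [two_mul]
  nth_rw 1 [t1]
  rw [t2, ← Finset.sum_add_distrib]
  refine Finset.sum_eq_zero fun i _ => ?_
  rw [QuadraticMap.polar_comm, hs, add_comm, add_neg_cancel]

variable [SMulCommClass E C C] [IsScalarTower E C C]

/-- Twice the operator $L_{\bar a}L_b$ is the scalar $n(a,b)$ plus a skew map, which has trace zero;
the rank 8 gives the constant. -/
theorem trace_mulLeft_mulLeft (hn : IsOctonionAlgebra n) [IsArtinianRing E]
    (h2 : IsUnit (2 : E)) (a b : C) :
    LinearMap.trace E C (LinearMap.mulLeft E (octConj n a) ∘ₗ LinearMap.mulLeft E b) =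
      4 * polar n a b := by
  have h1 := hn.trace_eq_zero_of_skew h2 (hn.tri_skew 0 b a)
  have e1 : tri (octConj n) 0 b a = (2 : E) •
      (LinearMap.mulLeft E (octConj n a) ∘ₗ LinearMap.mulLeft E b)
      - polar n a b • LinearMap.id := by
    ext x
    have h := hn.mul_octConj_mul_add a b x
    simp only [tri_zero_apply, LinearMap.sub_apply, LinearMap.smul_apply, LinearMap.comp_apply,
      LinearMap.mulLeft_apply, LinearMap.id_apply]
    linear_combination (norm := module) -h
  rw [e1, map_sub, map_smul, map_smul, hn.trace_id, smul_eq_mul, smul_eq_mul] at h1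
  refine h2.mul_left_cancel ?_
  linear_combination h1

theorem trace_mulRight_mulRight (hn : IsOctonionAlgebra n) [IsArtinianRing E]
    (h2 : IsUnit (2 : E)) (a b : C) :
    LinearMap.trace E C (LinearMap.mulRight E (octConj n a) ∘ₗ LinearMap.mulRight E b) =
      4 * polar n a b := by
  have h1 := hn.trace_eq_zero_of_skew h2 (hn.tri_skew 1 b a)
  have e1 : tri (octConj n) 1 b a = (2 : E) •
      (LinearMap.mulRight E (octConj n a) ∘ₗ LinearMap.mulRight E b)
      - polar n a b • LinearMap.id := by
    ext x
    have h := hn.mul_octConj_add a b x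
    simp only [tri_one_apply, LinearMap.sub_apply, LinearMap.smul_apply, LinearMap.comp_apply,
      LinearMap.mulRight_apply, LinearMap.id_apply]
    linear_combination (norm := module) -h
  rw [e1, map_sub, map_smul, map_smul, hn.trace_id, smul_eq_mul, smul_eq_mul] at h1
  refine h2.mul_left_cancel ?_
  linear_combination h1

theorem tri_mem_skewTriples (hn : IsOctonionAlgebra n) (a b : C) :
    (fun k => tri (octConj n) k a b) ∈ skewTriples n :=
  ⟨fun k => hn.tri_skew k a b, hn.isRelated_tri a b⟩

theorem extTri_mem_skewTriples (hn : IsOctonionAlgebra n) (w : ⋀[E]^2 C) :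
    (fun k => extTri n k w) ∈ skewTriples n := by
  induction w using wedge_induction with
  | hw u v => simpa only [extTri_wedge] using hn.tri_mem_skewTriples u v
  | hz => simp only [map_zero]; exact (skewTriples n).zero_mem
  | ha x y hx hy => simp only [map_add]; exact (skewTriples n).add_mem hx hy

/-- The element $w$ is recovered from its rotation by contraction with dual bases: $\sum f_i\wedge
T_w(e_i)=4w$. -/
theorem extTri_injective (hn : IsOctonionAlgebra n) [IsArtinianRing E]
    (h2 : IsUnit (2 : E)) : Function.Injective (extTri n 2) := by
  obtain ⟨e, f, he, hf⟩ := hn.exists_dual_bases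
  have h : ∀ w, ∑ i, wedge (f i) (extTri n 2 w (e i)) = (4 : E) • w := by
    intro w
    induction w using wedge_induction with
    | hw u v =>
      simp only [extTri_wedge, hn.tri_two, map_smul, map_sub, ← Finset.smul_sum,
        Finset.sum_sub_distrib]
      have h3 : ∀ u v : C, ∑ i, polar n u (e i) • wedge (R := E) (f i) v = wedge u v := by
        intro u v
        conv_rhs => rw [← hf u]
        simp [QuadraticMap.polar_comm n u]
      rw [h3, h3, wedge_swap v u]
      module
    | hz => simp
    | ha x y hx hy => simp only [map_add, LinearMap.add_apply, Finset.sum_add_distrib, hx, hy,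
        smul_add]
  intro w w' hw
  have h4 : IsUnit (4 : E) := by
    have := h2.mul h2
    norm_num at this
    exact this
  rw [← h4.smul_left_cancel, ← h, ← h, hw]

/-- The contraction formula, with its factor $1/4$, yields a $w$ whose rotation is $s_2$. The
difference of the two triples is then related and skew with zero entry at index 2, hence zero by
`eq_zero_of_isRelated`. -/
theorem exists_extTri_eq (hn : IsOctonionAlgebra n) [IsArtinianRing E] [IsReduced E]
    (h6 : IsUnit (6 : E)) {s : Fin 3 → Module.End E C} (hs : s ∈ skewTriples n) :
    ∃ w, ∀ k, s k = extTri n k w := by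
  have h2 : IsUnit (2 : E) := isUnit_of_mul_isUnit_left (y := 3) (by norm_num; exact h6)
  have h4 : IsUnit (4 : E) := by
    have := h2.mul h2
    norm_num at this
    exact this
  obtain ⟨e, f, he, hf⟩ := hn.exists_dual_bases
  obtain ⟨c, hc⟩ := h4.exists_left_inv
  set w : ⋀[E]^2 C := c • ∑ i, wedge (f i) (s 2 (e i)) with hw
  have hd := (skewTriples n).sub_mem hs (hn.extTri_mem_skewTriples w)
  have h0 := hn.eq_zero_of_isRelated h6 hd.1 hd.2 ?_
  · exact ⟨w, fun k => sub_eq_zero.1 (congrFun h0 k)⟩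
  rw [Pi.sub_apply, sub_eq_zero]
  ext x
  have e1 : ∑ i, polar n (f i) x • s 2 (e i) = s 2 x := by
    conv_rhs => rw [← he x]
    simp
  have e2 : ∑ i, polar n (s 2 (e i)) x • f i = - s 2 x := by
    simp only [hs.1, neg_smul, Finset.sum_neg_distrib, hf]
  simp only [hw, map_smul, map_sum, LinearMap.smul_apply, LinearMap.sum_apply, extTri_wedge,
    hn.tri_two, ← Finset.smul_sum, Finset.sum_sub_distrib, e1, e2]
  calc s 2 x = (c * 4) • s 2 x := by rw [hc, one_smul]
    _ = _ := by module

end IsOctonionAlgebra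

/-! ### The Lie algebra identities -/

/-- The identities of an algebra with involution under which the Allison–Faulkner construction
gives a Lie algebra. -/
structure IsTrialitarian {R B : Type*} [CommRing R] [NonUnitalNonAssocRing B] [Module R B]
    [SMulCommClass R B B] [IsScalarTower R B B] (bar : B →ₗ[R] B) : Prop where
  bar_bar : ∀ a, bar (bar a) = a
  bar_mul : ∀ a b, bar (a * b) = bar b * bar a
  related : ∀ a b, IsRelated bar fun k => tri bar k a b
  commutator : ∀ i j a b c d x,
    tri bar (j + i) c d (tri bar j a b x) - tri bar j a b (tri bar (j + i) c d x) =
      tri bar j (tri bar (i + 2) c d a) b x + tri bar j a (tri bar (i + 2) c d b) x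
  cyclic : ∀ a b c, tri bar 2 a b c + tri bar 2 b c a + tri bar 2 c a b = 0
  sum : ∀ j a b c x, tri bar j a (bar (b * c)) x + tri bar (j - 1) b (bar (c * a)) x
    + tri bar (j - 2) c (bar (a * b)) x = 0

namespace IsTrialitarian

open AllisonFaulkner

variable {K A : Type*} [Field K] [NonUnitalNonAssocRing A] [Module K A] [SMulCommClass K A A]
  [IsScalarTower K A A] {bar : A →ₗ[K] A}

theorem _root_.AllisonFaulkner.triple_apply (bar : A →ₗ[K] A) (i : Fin 3) (a b : A) (m : Fin 3) :
    triple bar i a b m = tri bar (m - i) a b :=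
  tripleFun_apply bar i a b m

theorem triple_mem (bar : A →ₗ[K] A) (i : Fin 3) (a b : A) :
    triple bar i a b ∈ innerTriples bar :=
  Submodule.subset_span ⟨i, a, b, rfl⟩

theorem isRelated_of_mem (h : IsTrialitarian bar) {T : Fin 3 → Module.End K A}
    (hT : T ∈ innerTriples bar) : IsRelated bar T := by
  induction hT using Submodule.span_induction with
  | mem T hT =>
    obtain ⟨i, a, b, rfl⟩ := hT
    intro k x y
    have h1 := h.related a b (k - i) x y
    rw [tripleFun_apply, tripleFun_apply, tripleFun_apply, h1, sub_add_eq_add_sub,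
      sub_add_eq_add_sub]
  | zero => intro k x y; simp
  | add S T _ _ hS hT =>
    intro k x y
    simp only [Pi.add_apply, LinearMap.add_apply, hS k, hT k, add_mul, mul_add, map_add]
    abel
  | smul c T _ hT =>
    intro k x y
    simp only [Pi.smul_apply, LinearMap.smul_apply, hT k, smul_mul_assoc, mul_smul_comm,
      map_smul, ← smul_add]

/-- Elements of $\mathcal T_I$ act on the symbols $T^i_{a,b}$ by derivations through their entry of
index $i+2$. This gives closure of $\mathcal T_I$ under commutators as well as part of the Jacobi
identity. -/
theorem mul_triple (h : IsTrialitarian bar) {T : Fin 3 → Module.End K A}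
    (hT : T ∈ innerTriples bar) (i : Fin 3) (a b : A) :
    T * triple bar i a b = triple bar i a b * T + triple bar i (T (i + 2) a) b
      + triple bar i a (T (i + 2) b) := by
  induction hT using Submodule.span_induction with
  | mem T hT =>
    obtain ⟨l, c, d, rfl⟩ := hT
    funext m
    ext x
    have h1 := h.commutator (i - l) (m - i) a b c d x
    have e : i - l + 2 = i + 2 - l := sub_add_eq_add_sub _ _ _
    rw [sub_add_sub_cancel, e, ← tripleFun_apply, ← tripleFun_apply, sub_eq_iff_eq_add] at h1
    simp only [Pi.mul_apply, Pi.add_apply, Module.End.mul_apply, LinearMap.add_apply,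
      triple_apply]
    rw [← tripleFun_apply bar i a b, h1, tripleFun_apply, tripleFun_apply bar l c d (i + 2)]
    abel
  | zero => simp
  | add S T _ _ hS hT =>
    simp only [add_mul, mul_add, hS, hT, Pi.add_apply, LinearMap.add_apply, map_add]
    abel
  | smul c T _ hT =>
    simp only [smul_mul_assoc, mul_smul_comm, hT, Pi.smul_apply, LinearMap.smul_apply, map_smul,
      ← smul_add]

/-- This is the Jacobi identity for three elements of one copy of $A$. -/
theorem triple_two (h : IsTrialitarian bar) (k : Fin 3) (a b c : A) :
    triple bar (k + 1) a b k c + triple bar (k + 1) b c k a + triple bar (k + 1) c a k b = 0 := by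
  have e : k - (k + 1) = 2 := by revert k; decide
  simpa only [triple_apply, e] using h.cyclic a b c

/-- This is the Jacobi identity for three elements taken from three different copies of $A$. -/
theorem triple_sum (h : IsTrialitarian bar) (k : Fin 3) (a b c : A) :
    triple bar (k + 1) a (bar (b * c)) + triple bar (k + 2) b (bar (c * a))
      + triple bar k c (bar (a * b)) = 0 := by
  funext m
  ext x
  have e1 : m - (k + 1) - 1 = m - (k + 2) := by revert k m; decide
  have e2 : m - (k + 1) - 2 = m - k := by revert k m; decide
  have h1 := h.sum (m - (k + 1)) a b c x
  rw [e1, e2] at h1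
  simp only [Pi.add_apply, LinearMap.add_apply, triple_apply, h1]
  rfl

theorem innerTriples_commutator_mem (h : IsTrialitarian bar) {S T : Fin 3 → Module.End K A}
    (hS : S ∈ innerTriples bar) (hT : T ∈ innerTriples bar) :
    S * T - T * S ∈ innerTriples bar := by
  induction hT using Submodule.span_induction with
  | mem T hT =>
    obtain ⟨i, a, b, rfl⟩ := hT
    have h1 := h.mul_triple hS i a b
    change S * triple bar i a b - triple bar i a b * S ∈ _
    rw [h1, add_assoc, add_sub_cancel_left]
    exact Submodule.add_mem _ (triple_mem _ _ _ _) (triple_mem _ _ _ _)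
  | zero => simp
  | add T T' _ _ hT hT' =>
    have : S * (T + T') - (T + T') * S = (S * T - T * S) + (S * T' - T' * S) := by noncomm_ring
    rw [this]
    exact Submodule.add_mem _ hT hT'
  | smul c T _ hT =>
    rw [mul_smul_comm, smul_mul_assoc, ← smul_sub]
    exact Submodule.smul_mem _ _ hT

/-! ### Jacobi identity of the Allison–Faulkner product -/

theorem bracket_fst (γ : Fin 3 → Kˣ) (x y : Ambient K A) :
    (bracket bar γ x y).1 = x.1 * y.1 - y.1 * x.1 + ∑ k : Fin 3,
      ((γ (k + 1) : K) * (γ (k + 2) : K)⁻¹) • triple bar (k + 1) (x.2 k) (y.2 k) := rfl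

theorem bracket_snd (γ : Fin 3 → Kˣ) (x y : Ambient K A) (k : Fin 3) :
    (bracket bar γ x y).2 k = x.1 k (y.2 k) - y.1 k (x.2 k)
      - ((γ (k + 2) : K) * (γ (k + 1) : K)⁻¹) •
          bar (x.2 (k + 1) * y.2 (k + 2) - y.2 (k + 1) * x.2 (k + 2)) := rfl

theorem triple_self (bar : A →ₗ[K] A) (i : Fin 3) (a : A) : triple bar i a a = 0 := by
  funext m
  rw [triple_apply, tri_self]; rfl

theorem triple_swap (bar : A →ₗ[K] A) (i : Fin 3) (a b : A) :
    triple bar i a b = - triple bar i b a := by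
  funext m
  rw [Pi.neg_apply, triple_apply, tri_swap, triple_apply]

/-- In the $\mathcal T_I$ component, terms with an operator entry cancel by `mul_triple`. In the
terms with three entries from $A$ the factors $\gamma$ cancel, leaving two instances of
`triple_sum`. -/
theorem leibniz_fst (h : IsTrialitarian bar) (γ : Fin 3 → Kˣ) {x y z : Ambient K A}
    (hx : x.1 ∈ innerTriples bar) (hy : y.1 ∈ innerTriples bar) (hz : z.1 ∈ innerTriples bar) :
    (bracket bar γ x (bracket bar γ y z)).1 =
      (bracket bar γ (bracket bar γ x y) z).1 + (bracket bar γ y (bracket bar γ x z)).1 := by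
  obtain ⟨T, a⟩ := x
  obtain ⟨S, b⟩ := y
  obtain ⟨U, c⟩ := z
  have hc : ∀ k : Fin 3, ((γ (k + 1) : K) * (γ (k + 2) : K)⁻¹) *
      ((γ (k + 2) : K) * (γ (k + 1) : K)⁻¹) = 1 := fun k => by
    field_simp
  simp only [bracket_fst, bracket_snd]
  have e : ∀ k : Fin 3, k + 1 + 2 = k := by decide
  have s1 : ∀ (T : Fin 3 → Module.End K A) (_ : T ∈ innerTriples bar) (b c : Fin 3 → A),
      T * (∑ k : Fin 3, ((γ (k + 1) : K) * (γ (k + 2) : K)⁻¹) • triple bar (k + 1) (b k) (c k)) =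
      (∑ k : Fin 3, ((γ (k + 1) : K) * (γ (k + 2) : K)⁻¹) • triple bar (k + 1) (b k) (c k)) * T
      + (∑ k : Fin 3, ((γ (k + 1) : K) * (γ (k + 2) : K)⁻¹) • triple bar (k + 1) (T k (b k)) (c k))
      + (∑ k : Fin 3, ((γ (k + 1) : K) * (γ (k + 2) : K)⁻¹) •
          triple bar (k + 1) (b k) (T k (c k))) := by
    intro T hT b c
    simp only [Finset.mul_sum, Finset.sum_mul, ← Finset.sum_add_distrib, mul_smul_comm,
      smul_mul_assoc, h.mul_triple hT, e, smul_add]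
  have s2 : ∀ a b c : Fin 3 → A,
      ∑ k : Fin 3, triple bar (k + 1) (a k) (bar (b (k + 1) * c (k + 2)))
      + ∑ k : Fin 3, triple bar (k + 1) (b k) (bar (c (k + 1) * a (k + 2)))
      + ∑ k : Fin 3, triple bar (k + 1) (c k) (bar (a (k + 1) * b (k + 2))) = 0 := by
    intro a b c
    have h0 := h.triple_sum 0 (a 0) (b 1) (c 2)
    have h1 := h.triple_sum 1 (a 1) (b 2) (c 0)
    have h2 := h.triple_sum 2 (a 2) (b 0) (c 1)
    simp only [Fin.sum_univ_three]
    have := congrArg₂ (· + ·) (congrArg₂ (· + ·) h0 h1) h2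
    simp only [add_zero] at this
    rw [← this]
    simp only [show (2 : Fin 3) + 1 = 0 from rfl, show (1 : Fin 3) + 1 = 2 from rfl,
      show (2 : Fin 3) + 2 = 1 from rfl, show (1 : Fin 3) + 2 = 0 from rfl, zero_add]
    abel
  have s3 : ∀ (a : Fin 3 → A) (u : Fin 3 → A),
      ∑ k : Fin 3, ((γ (k + 1) : K) * (γ (k + 2) : K)⁻¹) • triple bar (k + 1) (a k)
        (((γ (k + 2) : K) * (γ (k + 1) : K)⁻¹) • bar (u k)) =
      ∑ k : Fin 3, triple bar (k + 1) (a k) (bar (u k)) := by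
    intro a u
    simp only [map_smul, smul_smul, hc, one_smul]
  have s4 : ∀ (a : Fin 3 → A) (u : Fin 3 → A),
      ∑ k : Fin 3, ((γ (k + 1) : K) * (γ (k + 2) : K)⁻¹) • triple bar (k + 1)
        (((γ (k + 2) : K) * (γ (k + 1) : K)⁻¹) • bar (u k)) (a k) =
      - ∑ k : Fin 3, triple bar (k + 1) (a k) (bar (u k)) := by
    intro a u
    rw [← s3, ← Finset.sum_neg_distrib]
    exact Finset.sum_congr rfl fun k _ => by rw [triple_swap, smul_neg]
  have s5 : ∀ b c : Fin 3 → A,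
      ∑ k : Fin 3, ((γ (k + 1) : K) * (γ (k + 2) : K)⁻¹) • triple bar (k + 1) (b k) (c k) =
      - ∑ k : Fin 3, ((γ (k + 1) : K) * (γ (k + 2) : K)⁻¹) • triple bar (k + 1) (c k) (b k) := by
    intro b c
    rw [← Finset.sum_neg_distrib]
    exact Finset.sum_congr rfl fun k _ => by rw [triple_swap, smul_neg]
  have r1 := s2 a b c
  have r2 := s2 a c b
  simp only [mul_add, add_mul, mul_sub, sub_mul, s1 T hx, s1 S hy, s1 U hz, map_sub,
    LinearMap.sub_apply, smul_sub, Finset.sum_sub_distrib, s3, s4, mul_assoc]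
  rw [s5 (fun k => S k (a k)) c, s5 b (fun k => U k (a k))]
  linear_combination (norm := abel) r2 - r1


/-- Three sources contribute to an $A$ component: relatedness for one operator and two copies of
$A$, the formulas for components 0 and 1 when two entries share a copy, and `triple_two` when all
three do. -/
theorem leibniz_snd (h : IsTrialitarian bar) (γ : Fin 3 → Kˣ) {x y z : Ambient K A}
    (hx : x.1 ∈ innerTriples bar) (hy : y.1 ∈ innerTriples bar) (hz : z.1 ∈ innerTriples bar)
    (k : Fin 3) : (bracket bar γ x (bracket bar γ y z)).2 k =
      (bracket bar γ (bracket bar γ x y) z).2 k + (bracket bar γ y (bracket bar γ x z)).2 k := by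
  obtain ⟨T, a⟩ := x
  obtain ⟨S, b⟩ := y
  obtain ⟨U, c⟩ := z
  have e1 : k + 1 + 1 = k + 2 := by revert k; decide
  have e2 : k + 1 + 2 = k := by revert k; decide
  have e3 : k + 2 + 1 = k := by revert k; decide
  have e4 : k + 2 + 2 = k + 1 := by revert k; decide
  have e5 : k - (k + 2) = 1 := by revert k; decide
  have hsum : ∀ f : Fin 3 → Fin 3 → Module.End K A,
      (∑ m : Fin 3, f m) k = f k k + f (k + 1) k + f (k + 2) k := by
    intro f
    rw [Fin.sum_univ_three]
    fin_cases k
    · rfl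
    · change f 0 1 + f 1 1 + f 2 1 = f 1 1 + f 2 1 + f 0 1; abel
    · change f 0 2 + f 1 2 + f 2 2 = f 2 2 + f 0 2 + f 1 2; abel
  have hT := fun x y => h.isRelated_of_mem hx k x y
  have hS := fun x y => h.isRelated_of_mem hy k x y
  have hU := fun x y => h.isRelated_of_mem hz k x y
  simp only [h.bar_mul, map_add] at hT hS hU
  have c1 : ((γ (k + 2) : K) * (γ (k + 1) : K)⁻¹) * ((γ (k + 1) : K) * (γ k : K)⁻¹) =
      (γ (k + 2) : K) * (γ k : K)⁻¹ := by field_simp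
  have c2 : ((γ (k + 2) : K) * (γ (k + 1) : K)⁻¹) * ((γ k : K) * (γ (k + 2) : K)⁻¹) =
      (γ k : K) * (γ (k + 1) : K)⁻¹ := by field_simp
  have t1 : ∀ a b x, triple bar (k + 2) a b k x = (x * a) * bar b - (x * b) * bar a := by
    intro a b x
    rw [triple_apply, e5, tri_one_apply]
  have t0 : ∀ a b x, triple bar k a b k x = bar b * (a * x) - bar a * (b * x) := by
    intro a b x
    rw [triple_apply, sub_self, tri_zero_apply]
  have t2 := h.triple_two k (a k) (b k) (c k)
  rw [triple_swap bar (k + 1) (c k) (a k)] at t2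
  simp only [bracket_fst, bracket_snd, e1, e2, e3, e4, Pi.add_apply, Pi.sub_apply, Pi.mul_apply,
    hsum, Pi.smul_apply, LinearMap.add_apply, LinearMap.sub_apply, Module.End.mul_apply, map_sub,
    LinearMap.smul_apply, t0, t1, map_smul, smul_sub, mul_sub, sub_mul, mul_smul_comm,
    smul_mul_assoc, hT, hS, hU, h.bar_mul, h.bar_bar, smul_smul, c1, c2, smul_add]
  have t3 := congrArg (fun v => ((γ (k + 1) : K) * (γ (k + 2) : K)⁻¹) • v) t2
  simp only [smul_add, smul_neg, smul_zero, Pi.neg_apply, LinearMap.neg_apply] at t3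
  linear_combination (norm := abel) -t3

theorem isLieOn (h : IsTrialitarian bar) (γ : Fin 3 → Kˣ) :
    IsLieOn (bracket bar γ) (space bar) where
  mem := by
    rintro x ⟨hx, -⟩ y ⟨hy, -⟩
    refine ⟨?_, trivial⟩
    rw [bracket_fst]
    refine Submodule.add_mem _ (h.innerTriples_commutator_mem hx hy)
      (Submodule.sum_mem _ fun k _ => Submodule.smul_mem _ _ (triple_mem _ _ _ _))
  self := by
    rintro x -
    ext1
    · rw [bracket_fst]
      simp only [triple_self, smul_zero, Finset.sum_const_zero, sub_self, add_zero]
      rfl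
    · funext k
      rw [bracket_snd]
      simp
  leibniz := by
    rintro x ⟨hx, -⟩ y ⟨hy, -⟩ z ⟨hz, -⟩
    ext1
    · exact h.leibniz_fst γ hx hy hz
    · funext k
      exact h.leibniz_snd γ hx hy hz k

end IsTrialitarian

section IsRelated

variable {R B : Type*} [CommRing R] [NonUnitalNonAssocRing B] [Module R B] [SMulCommClass R B B]
  [IsScalarTower R B B] {bar : B →ₗ[R] B}

theorem IsRelated.add {s t : Fin 3 → Module.End R B} (hs : IsRelated bar s)
    (ht : IsRelated bar t) : IsRelated bar (s + t) := fun k x y => by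
  simp only [Pi.add_apply, LinearMap.add_apply, hs k, ht k, add_mul, mul_add, map_add]
  abel

theorem IsRelated.smul {s : Fin 3 → Module.End R B} (hs : IsRelated bar s) (c : R) :
    IsRelated bar (c • s) := fun k x y => by
  simp only [Pi.smul_apply, LinearMap.smul_apply, hs k, smul_mul_assoc, mul_smul_comm,
    map_smul, ← smul_add]

/-- The identities involve only sums, products and the involution, never scalars. Additivity of
$\varphi$ is therefore enough, and the two base rings may differ. -/
theorem IsTrialitarian.of_injective {K A : Type*} [Field K] [NonUnitalNonAssocRing A] [Module K A]
    [SMulCommClass K A A] [IsScalarTower K A A] {bar' : A →ₗ[K] A} (h : IsTrialitarian bar)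
    (φ : A →+ B) (hφ : Function.Injective φ) (hmul : ∀ x y, φ (x * y) = φ x * φ y)
    (hbar : ∀ x, φ (bar' x) = bar (φ x)) : IsTrialitarian bar' := by
  have htri : ∀ j a b x, φ (tri bar' j a b x) = tri bar j (φ a) (φ b) (φ x) := by
    intro j a b x
    fin_cases j
    · change φ (tri bar' 0 a b x) = tri bar 0 (φ a) (φ b) (φ x)
      simp only [tri_zero_apply, map_sub, hmul, hbar]
    · change φ (tri bar' 1 a b x) = tri bar 1 (φ a) (φ b) (φ x)
      simp only [tri_one_apply, map_sub, hmul, hbar]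
    · change φ (tri bar' 2 a b x) = tri bar 2 (φ a) (φ b) (φ x)
      simp only [tri_two_apply, map_sub, map_add, hmul, hbar]
  constructor
  · intro a
    apply hφ
    rw [hbar, hbar, h.bar_bar]
  · intro a b
    apply hφ
    rw [hbar, hmul, hmul, h.bar_mul, hbar, hbar]
  · intro a b k x y
    apply hφ
    have := h.related (φ a) (φ b) k (φ x) (φ y)
    simpa only [htri, hbar, hmul, map_add] using this
  · intro i j a b c d x
    apply hφ
    have := h.commutator i j (φ a) (φ b) (φ c) (φ d) (φ x)
    simpa only [htri, hbar, hmul, map_add, map_sub] using this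
  · intro a b c
    apply hφ
    have := h.cyclic (φ a) (φ b) (φ c)
    simpa only [htri, hbar, hmul, map_add, map_zero] using this
  · intro j a b c x
    apply hφ
    have := h.sum j (φ a) (φ b) (φ c) (φ x)
    simpa only [htri, hbar, hmul, map_add, map_zero] using this

end IsRelated

/-! ### Tensor products of octonion algebras -/

namespace IsOctonionAlgebra

variable {E C D : Type*} [CommRing E] [NonAssocRing C] [Module E C] [NonAssocRing D] [Module E D]
  [SMulCommClass E C C] [IsScalarTower E C C] [SMulCommClass E D D] [IsScalarTower E D D]
  {n : QuadraticForm E C} {m : QuadraticForm E D}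

/-- The tensor product of the canonical involutions. -/
abbrev tensorConj (n : QuadraticForm E C) (m : QuadraticForm E D) : C ⊗[E] D →ₗ[E] C ⊗[E] D :=
  TensorProduct.map (octConj n) (octConj m)

/-- The reduction of everything on the tensor product to its factors. It holds because each
component of $T_{a,b}$ is a difference, or a sum of two differences, of terms $p,q$ for which $p+q$
is $n(a,b)$ times the argument. -/
theorem two_smul_tri_tmul (hn : IsOctonionAlgebra n) (hm : IsOctonionAlgebra m) (j : Fin 3)
    (a b : C) (a' b' : D) :
    (2 : E) • tri (tensorConj n m) j (a ⊗ₜ a') (b ⊗ₜ b') =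
      polar m a' b' • TensorProduct.map (tri (octConj n) j a b) LinearMap.id
      + polar n a b • TensorProduct.map LinearMap.id (tri (octConj m) j a' b') := by
  -- This is $2(p\otimes p'-q\otimes q')=(p-q)\otimes(p'+q')+(p+q)\otimes(p'-q')$ with scalar
  -- symmetric parts.
  have key : ∀ {p q x : C} {p' q' x' : D}, p + q = polar n a b • x → p' + q' = polar m a' b' • x' →
      (2 : E) • (p ⊗ₜ[E] p' - q ⊗ₜ[E] q') =
        polar m a' b' • ((p - q) ⊗ₜ[E] x') + polar n a b • (x ⊗ₜ[E] (p' - q')) := by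
    intro p q x p' q' x' h h'
    rw [← TensorProduct.tmul_smul, ← h', TensorProduct.smul_tmul', ← h]
    simp only [TensorProduct.tmul_add, TensorProduct.add_tmul, TensorProduct.sub_tmul,
      TensorProduct.tmul_sub]
    module
  ext x x'
  simp only [TensorProduct.AlgebraTensorModule.curry_apply, LinearMap.restrictScalars_self,
    TensorProduct.curry_apply, LinearMap.smul_apply, LinearMap.add_apply,
    TensorProduct.map_tmul, LinearMap.id_apply]
  fin_cases j
  · change (2 : E) • tri (tensorConj n m) 0 (a ⊗ₜ a') (b ⊗ₜ b') (x ⊗ₜ x') = polar m a' b' •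
      (tri (octConj n) 0 a b x ⊗ₜ x') + polar n a b • (x ⊗ₜ tri (octConj m) 0 a' b' x')
    simp only [tri_zero_apply, TensorProduct.map_tmul, Algebra.TensorProduct.tmul_mul_tmul]
    refine key ?_ ?_
    · rw [add_comm]; exact hn.mul_octConj_mul_add _ _ _
    · rw [add_comm]; exact hm.mul_octConj_mul_add _ _ _
  · change (2 : E) • tri (tensorConj n m) 1 (a ⊗ₜ a') (b ⊗ₜ b') (x ⊗ₜ x') = polar m a' b' •
      (tri (octConj n) 1 a b x ⊗ₜ x') + polar n a b • (x ⊗ₜ tri (octConj m) 1 a' b' x')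
    simp only [tri_one_apply, TensorProduct.map_tmul, Algebra.TensorProduct.tmul_mul_tmul]
    exact key (hn.mul_octConj_add _ _ _) (hm.mul_octConj_add _ _ _)
  · change (2 : E) • tri (tensorConj n m) 2 (a ⊗ₜ a') (b ⊗ₜ b') (x ⊗ₜ x') = polar m a' b' •
      (tri (octConj n) 2 a b x ⊗ₜ x') + polar n a b • (x ⊗ₜ tri (octConj m) 2 a' b' x')
    simp only [tri_two_apply, TensorProduct.map_tmul, Algebra.TensorProduct.tmul_mul_tmul, mul_sub]
    have h1 := key (p := x * (octConj n a * b)) (q := x * (octConj n b * a))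
      (p' := x' * (octConj m a' * b')) (q' := x' * (octConj m b' * a')) (x := x) (x' := x')
      (by rw [← mul_add, hn.octConj_mul_add, mul_smul_comm, mul_one])
      (by rw [← mul_add, hm.octConj_mul_add, mul_smul_comm, mul_one])
    have h2 := key (p := b * (octConj n a * x)) (q := a * (octConj n b * x))
      (p' := b' * (octConj m a' * x')) (q' := a' * (octConj m b' * x')) (x := x) (x' := x')
      (by rw [add_comm]; exact hn.mul_mul_octConj_add _ _ _)
      (by rw [add_comm]; exact hm.mul_mul_octConj_add _ _ _)
    simp only [TensorProduct.tmul_add, TensorProduct.add_tmul, TensorProduct.sub_tmul,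
      TensorProduct.tmul_sub] at h1 h2 ⊢
    linear_combination (norm := module) h1 + h2

theorem tri_tmul (hn : IsOctonionAlgebra n) (hm : IsOctonionAlgebra m) [Invertible (2 : E)]
    (j : Fin 3) (a b : C) (a' b' : D) :
    tri (tensorConj n m) j (a ⊗ₜ a') (b ⊗ₜ b') =
      (⅟2 : E) • (polar m a' b' • TensorProduct.map (tri (octConj n) j a b) LinearMap.id
      + polar n a b • TensorProduct.map LinearMap.id (tri (octConj m) j a' b')) := by
  rw [← two_smul_tri_tmul hn hm, smul_smul, invOf_mul_self, one_smul]

theorem polar_octConj_mul_rotate (hn : IsOctonionAlgebra n) (x y z : C) :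
    polar n x (octConj n (y * z)) = polar n y (octConj n (z * x)) := by
  have h : ∀ x y, polar n x (octConj n y) = polar n y (octConj n x) := fun x y => by
    rw [← hn.polar_octConj_left, QuadraticMap.polar_comm]
  rw [h, h y, ← hn.polar_mul_octConj_rotate, ← hn.polar_mul_octConj_rotate]

theorem isRelated_map_left (m : QuadraticForm E D) {s : Fin 3 → Module.End E C} (hs : IsRelated (octConj n) s) :
    IsRelated (tensorConj n m) fun k => TensorProduct.map (s k) LinearMap.id := by
  intro k x y
  induction x with
  | zero => simp
  | add x x' hx hx' =>
    simp only [add_mul, map_add] at hx hx' ⊢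
    rw [hx, hx']; abel
  | tmul x x' =>
    induction y with
    | zero => simp
    | add y y' hy hy' =>
      simp only [mul_add, map_add] at hy hy' ⊢
      rw [hy, hy']; abel
    | tmul y y' =>
      simp only [Algebra.TensorProduct.tmul_mul_tmul, TensorProduct.map_tmul, hs k,
        LinearMap.id_apply, map_add, TensorProduct.add_tmul]

theorem isRelated_map_right (n : QuadraticForm E C) {s : Fin 3 → Module.End E D} (hs : IsRelated (octConj m) s) :
    IsRelated (tensorConj n m) fun k => TensorProduct.map LinearMap.id (s k) := by
  intro k x y
  induction x with
  | zero => simp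
  | add x x' hx hx' =>
    simp only [add_mul, map_add] at hx hx' ⊢
    rw [hx, hx']; abel
  | tmul x x' =>
    induction y with
    | zero => simp
    | add y y' hy hy' =>
      simp only [mul_add, map_add] at hy hy' ⊢
      rw [hy, hy']; abel
    | tmul y y' =>
      simp only [Algebra.TensorProduct.tmul_mul_tmul, TensorProduct.map_tmul, hs k,
        LinearMap.id_apply, map_add, TensorProduct.tmul_add]

theorem isRelated_tri_tensor (hn : IsOctonionAlgebra n) (hm : IsOctonionAlgebra m)
    [Invertible (2 : E)] (a b : C ⊗[E] D) :
    IsRelated (tensorConj n m) fun k => tri (tensorConj n m) k a b := by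
  induction a with
  | zero =>
    intro k x y
    simp
  | add a a' ha ha' =>
    simp only [map_add, LinearMap.add_apply]
    exact ha.add ha'
  | tmul a a' =>
    induction b with
    | zero =>
      intro k x y
      simp
    | add b b' hb hb' =>
      simp only [map_add]
      exact hb.add hb'
    | tmul b b' =>
      have h := (((isRelated_map_left m (hn.isRelated_tri a b)).smul (polar m a' b')).add
        ((isRelated_map_right n (hm.isRelated_tri a' b')).smul (polar n a b))).smul (⅟2 : E)
      convert h using 2 with k
      simp only [Pi.smul_apply, Pi.add_apply, ← two_smul_tri_tmul hn hm, smul_smul,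
        invOf_mul_self, one_smul]

/-- The derivation property of the triples on a tensor product of octonion algebras. -/
theorem commutator_tri_map_left (hn : IsOctonionAlgebra n) (hm : IsOctonionAlgebra m)
    [Invertible (2 : E)] {s : Fin 3 → Module.End E C} (hs : s ∈ skewTriples n)
    (i j : Fin 3) (a b : C ⊗[E] D) :
    TensorProduct.map (s (j + i)) LinearMap.id * tri (tensorConj n m) j a b
      - tri (tensorConj n m) j a b * TensorProduct.map (s (j + i)) LinearMap.id =
      tri (tensorConj n m) j (TensorProduct.map (s (i + 2)) LinearMap.id a) b
      + tri (tensorConj n m) j a (TensorProduct.map (s (i + 2)) LinearMap.id b) := by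
  induction a with
  | zero => simp
  | add a a' ha ha' =>
    simp only [map_add, LinearMap.add_apply, mul_add, add_mul] at ha ha' ⊢
    linear_combination (norm := abel) ha + ha'
  | tmul a a' =>
    induction b with
    | zero => simp
    | add b b' hb hb' =>
      simp only [map_add, mul_add, add_mul] at hb hb' ⊢
      linear_combination (norm := abel) hb + hb'
    | tmul b b' =>
      simp only [TensorProduct.map_tmul, LinearMap.id_apply, tri_tmul hn hm, mul_smul_comm,
        smul_mul_assoc]
      -- A skew map annihilates the coefficient $n(a,b)$ infinitesimally, so the second summand of
      -- `tri_tmul` produces no extra term.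
      have h0 : polar n (s (i + 2) a) b + polar n a (s (i + 2) b) = 0 := by
        rw [hs.1, neg_add_cancel]
      ext x x'
      have h := hn.commutator_tri hs.1 hs.2 i j a b x
      have h1 := congrArg (fun v => polar m a' b' • (v ⊗ₜ[E] x')) h
      simp only [TensorProduct.sub_tmul, TensorProduct.add_tmul, smul_add, smul_sub] at h1
      have h2 := congrArg (fun v => v • (x ⊗ₜ[E] tri (octConj m) j a' b' x')) h0
      simp only [add_smul, zero_smul] at h2
      simp only [TensorProduct.AlgebraTensorModule.curry_apply, LinearMap.restrictScalars_self,
        TensorProduct.curry_apply, LinearMap.smul_apply, LinearMap.add_apply, LinearMap.sub_apply,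
        Module.End.mul_apply, mul_add, add_mul,
        TensorProduct.map_tmul, LinearMap.id_apply, map_smul]
      linear_combination (norm := module) (⅟2 : E) • h1 - (⅟2 : E) • h2

theorem commutator_tri_map_right (hn : IsOctonionAlgebra n) (hm : IsOctonionAlgebra m)
    [Invertible (2 : E)] {s : Fin 3 → Module.End E D} (hs : s ∈ skewTriples m)
    (i j : Fin 3) (a b : C ⊗[E] D) :
    TensorProduct.map LinearMap.id (s (j + i)) * tri (tensorConj n m) j a b
      - tri (tensorConj n m) j a b * TensorProduct.map LinearMap.id (s (j + i)) =
      tri (tensorConj n m) j (TensorProduct.map LinearMap.id (s (i + 2)) a) b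
      + tri (tensorConj n m) j a (TensorProduct.map LinearMap.id (s (i + 2)) b) := by
  induction a with
  | zero => simp
  | add a a' ha ha' =>
    simp only [map_add, LinearMap.add_apply, mul_add, add_mul] at ha ha' ⊢
    linear_combination (norm := abel) ha + ha'
  | tmul a a' =>
    induction b with
    | zero => simp
    | add b b' hb hb' =>
      simp only [map_add, mul_add, add_mul] at hb hb' ⊢
      linear_combination (norm := abel) hb + hb'
    | tmul b b' =>
      simp only [TensorProduct.map_tmul, LinearMap.id_apply, tri_tmul hn hm, mul_smul_comm,
        smul_mul_assoc]
      have h0 : polar m (s (i + 2) a') b' + polar m a' (s (i + 2) b') = 0 := by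
        rw [hs.1, neg_add_cancel]
      ext x x'
      have h := hm.commutator_tri hs.1 hs.2 i j a' b' x'
      have h1 := congrArg (fun v => polar n a b • (x ⊗ₜ[E] v)) h
      simp only [TensorProduct.tmul_sub, TensorProduct.tmul_add, smul_add, smul_sub] at h1
      have h2 := congrArg (fun v => v • (tri (octConj n) j a b x ⊗ₜ[E] x')) h0
      simp only [add_smul, zero_smul] at h2
      simp only [TensorProduct.AlgebraTensorModule.curry_apply, LinearMap.restrictScalars_self,
        TensorProduct.curry_apply, LinearMap.smul_apply, LinearMap.add_apply, LinearMap.sub_apply,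
        Module.End.mul_apply, mul_add, add_mul,
        TensorProduct.map_tmul, LinearMap.id_apply, map_smul]
      linear_combination (norm := module) (⅟2 : E) • h1 - (⅟2 : E) • h2

theorem commutator_tri_tensor (hn : IsOctonionAlgebra n) (hm : IsOctonionAlgebra m)
    [Invertible (2 : E)] (i j : Fin 3) (a b c d : C ⊗[E] D) :
    tri (tensorConj n m) (j + i) c d * tri (tensorConj n m) j a b
      - tri (tensorConj n m) j a b * tri (tensorConj n m) (j + i) c d =
      tri (tensorConj n m) j (tri (tensorConj n m) (i + 2) c d a) b
      + tri (tensorConj n m) j a (tri (tensorConj n m) (i + 2) c d b) := by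
  induction c with
  | zero => simp
  | add c c' hc hc' =>
    simp only [map_add, LinearMap.add_apply, mul_add, add_mul] at hc hc' ⊢
    linear_combination (norm := abel) hc + hc'
  | tmul c c' =>
    induction d with
    | zero => simp
    | add d d' hd hd' =>
      simp only [map_add, LinearMap.add_apply, mul_add, add_mul] at hd hd' ⊢
      linear_combination (norm := abel) hd + hd'
    | tmul d d' =>
      have h1 := congrArg (polar m c' d' • ·)
        (commutator_tri_map_left hn hm (hn.tri_mem_skewTriples c d) i j a b)
      have h2 := congrArg (polar n c d • ·)
        (commutator_tri_map_right hn hm (hm.tri_mem_skewTriples c' d') i j a b)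
      simp only [smul_sub, smul_add] at h1 h2
      simp only [tri_tmul hn hm _ c d, mul_smul_comm, smul_mul_assoc, LinearMap.smul_apply,
        LinearMap.add_apply, map_smul]
      simp only [map_add, LinearMap.add_apply, map_smul, LinearMap.smul_apply, add_mul, mul_add,
        mul_smul_comm, smul_mul_assoc]
      linear_combination (norm := module) (⅟2 : E) • h1 + (⅟2 : E) • h2

theorem isTrialitarian_tensor (hn : IsOctonionAlgebra n) (hm : IsOctonionAlgebra m)
    [Invertible (2 : E)] : IsTrialitarian (tensorConj n m) where
  bar_bar a := by
    induction a with
    | zero => simp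
    | add a a' ha ha' => rw [map_add, map_add, ha, ha']
    | tmul a a' => simp only [TensorProduct.map_tmul, hn.octConj_octConj, hm.octConj_octConj]
  bar_mul a b := by
    induction a with
    | zero => simp
    | add a a' ha ha' => rw [map_add, mul_add, add_mul, map_add, ha, ha']
    | tmul a a' =>
      induction b with
      | zero => simp
      | add b b' hb hb' => rw [map_add, mul_add, add_mul, map_add, hb, hb']
      | tmul b b' => simp only [TensorProduct.map_tmul, Algebra.TensorProduct.tmul_mul_tmul,
          hn.octConj_mul, hm.octConj_mul]
  related := isRelated_tri_tensor hn hm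
  commutator i j a b c d x := DFunLike.congr_fun (commutator_tri_tensor hn hm i j a b c d) x
  cyclic a b c := by
    induction a with
    | zero => simp
    | add a a' ha ha' =>
      simp only [map_add, LinearMap.add_apply]
      linear_combination (norm := abel) ha + ha'
    | tmul a a' =>
      induction b with
      | zero => simp
      | add b b' hb hb' =>
        simp only [map_add, LinearMap.add_apply]
        linear_combination (norm := abel) hb + hb'
      | tmul b b' =>
        induction c with
        | zero => simp
        | add c c' hc hc' =>
          simp only [map_add, LinearMap.add_apply]
          linear_combination (norm := abel) hc + hc'
        | tmul c c' =>
          refine (isUnit_of_invertible (2 : E)).smul_left_cancel.1 ?_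
          simp only [smul_add, ← LinearMap.smul_apply, two_smul_tri_tmul hn hm]
          simp only [LinearMap.add_apply, LinearMap.smul_apply, TensorProduct.map_tmul, hn.tri_two,
            hm.tri_two, LinearMap.id_apply, TensorProduct.tmul_sub, TensorProduct.sub_tmul,
            TensorProduct.tmul_smul, ← TensorProduct.smul_tmul', smul_zero,
            QuadraticMap.polar_comm n c, QuadraticMap.polar_comm m c',
            QuadraticMap.polar_comm n b a, QuadraticMap.polar_comm m b' a']
          module
  sum j a b c x := by
    induction a with
    | zero => simp
    | add a a' ha ha' =>
      simp only [map_add, LinearMap.add_apply, mul_add, add_mul]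
      linear_combination (norm := abel) ha + ha'
    | tmul a a' =>
      induction b with
      | zero => simp
      | add b b' hb hb' =>
        simp only [map_add, LinearMap.add_apply, mul_add, add_mul]
        linear_combination (norm := abel) hb + hb'
      | tmul b b' =>
        induction c with
        | zero => simp
        | add c c' hc hc' =>
          simp only [map_add, LinearMap.add_apply, mul_add, add_mul]
          linear_combination (norm := abel) hc + hc'
        | tmul c c' =>
          simp only [Algebra.TensorProduct.tmul_mul_tmul, TensorProduct.map_tmul, tri_tmul hn hm]
          -- The scalar $n(a,\overline{bc})$ is cyclically invariant, so each factor contributes one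
          -- common coefficient and the sum splits into the identities for $C$ and for $D$.
          rw [← hn.polar_octConj_mul_rotate a b c, hn.polar_octConj_mul_rotate c a b,
            ← hm.polar_octConj_mul_rotate a' b' c', hm.polar_octConj_mul_rotate c' a' b']
          have h1 := fun y => hn.tri_add_tri_add_tri j a b c y
          have h2 := fun y => hm.tri_add_tri_add_tri j a' b' c' y
          induction x with
          | zero => simp
          | add x x' hx hx' =>
            simp only [map_add]
            linear_combination (norm := abel) hx + hx'
          | tmul y y' =>
            have h3 := congrArg (fun v => polar m a' (octConj m (b' * c')) • (v ⊗ₜ[E] y')) (h1 y)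
            have h4 := congrArg (fun v => polar n a (octConj n (b * c)) • (y ⊗ₜ[E] v)) (h2 y')
            simp only [TensorProduct.tmul_add, TensorProduct.add_tmul, smul_add,
              TensorProduct.tmul_zero, TensorProduct.zero_tmul, smul_zero] at h3 h4
            simp only [LinearMap.smul_apply, LinearMap.add_apply, TensorProduct.map_tmul,
              LinearMap.id_apply]
            linear_combination (norm := module) (⅟2 : E) • h3 + (⅟2 : E) • h4

end IsOctonionAlgebra

/-! ### The conjugate octonion algebra and the transfer -/

section Conjugate

variable {K E C : Type*} [Field K] [CommRing E] [Algebra K E] {ι : E ≃ₐ[K] E}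
  (hι : orderOf ι = 2) [NonAssocRing C] [Module E C] [Module K C] [IsScalarTower K E C]
  {n : QuadraticForm E C}

/-- The module structure on `ᶥC`, over the additive group underlying the ring `ᶥC`. -/
instance conjugateModule (ι : E ≃ₐ[K] E) :
    @Module E (Conjugate ι C) _ NonUnitalNonAssocSemiring.toAddCommMonoid :=
  (inferInstance : @Module E (Conjugate ι C) _ AddCommGroup.toAddCommMonoid)

/-- The norm of the conjugate octonion algebra. -/
abbrev conjNorm (hι : orderOf ι = 2) (n : QuadraticForm E C) : QuadraticForm E (Conjugate ι C) :=
  Conjugate.quadraticForm hι n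

theorem polar_conjugate (x y : Conjugate ι C) :
    polar (conjNorm hι n) x y =
      ι (polar n ((Conjugate.of ι).symm x) ((Conjugate.of ι).symm y)) := by
  simp [polar, conjNorm, Conjugate.quadraticForm]

/-- The basis of `ᶥC` underlying a basis of `C`. -/
def conjugateBasis {I : Type*} (b : Module.Basis I E C) : Module.Basis I E (Conjugate ι C) :=
  Module.Basis.ofRepr
    { toFun := fun x => (b.repr ((Conjugate.of ι).symm x)).mapRange ι (map_zero ι)
      invFun := fun f => Conjugate.of ι (b.repr.symm (f.mapRange ι (map_zero ι)))
      map_add' := fun x y => by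
        ext i; simp
      map_smul' := fun e x => by
        ext i
        simp [Conjugate.of_symm_smul, apply_apply_of_orderOf_eq_two hι]
      left_inv := fun x => by
        have : ∀ f : I →₀ E, (f.mapRange ι (map_zero ι)).mapRange ι (map_zero ι) = f := fun f => by
          ext i; simp [apply_apply_of_orderOf_eq_two hι]
        simp [this]
      right_inv := fun f => by
        have : ∀ f : I →₀ E, (f.mapRange ι (map_zero ι)).mapRange ι (map_zero ι) = f := fun f => by
          ext i; simp [apply_apply_of_orderOf_eq_two hι]
        simp [this] }

theorem IsOctonionAlgebra.conjugate (hn : IsOctonionAlgebra n) :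
    IsOctonionAlgebra (conjNorm hι n) := by
  have := hn.free
  have := hn.finite
  have := hn.nontrivial
  let b := conjugateBasis hι (Module.finBasisOfFinrankEq E C hn.finrank_eq)
  have hs : ∀ x : Conjugate ι C, (∀ y, polar (conjNorm hι n) x y = 0) → x = 0 := by
    intro x hx
    apply (Conjugate.of ι).symm.injective
    rw [map_zero]
    refine hn.eq_of_polar fun z => ?_
    have h1 := hx (Conjugate.of ι z)
    rw [polar_conjugate] at h1
    rw [QuadraticMap.polar_zero_left]
    simpa using h1
  refine ⟨Module.Free.of_basis b, ?_, ⟨hs, fun x hx => hs x fun y => ?_⟩, fun x y => ?_⟩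
  · rw [Module.finrank_eq_card_basis b, Fintype.card_fin]
  · rw [QuadraticMap.polar_comm]; exact hx y
  · exact (congrArg ι (hn.map_mul _ _)).trans (_root_.map_mul ι _ _)

theorem octConj_conjugate [SMulCommClass E C C] [IsScalarTower E C C] :
    octConj (conjNorm hι n) = Conjugate.map ι (octConj n) := by
  ext x
  rw [octConj_apply, polar_conjugate, Conjugate.smul_def, apply_apply_of_orderOf_eq_two hι]
  rfl

end Conjugate

/-! ### The transfer as a $K$-form of ${}^\iota C\otimes_E C$ -/

section Transfer

variable {K E C : Type*} [Field K] [CommRing E] [Algebra K E] {ι : E ≃ₐ[K] E}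
  (hι : orderOf ι = 2) [NonAssocRing C] [Module E C] [Module K C] [IsScalarTower K E C]
  [SMulCommClass E C C] [IsScalarTower E C C] {n : QuadraticForm E C}

theorem conjTensorInvolution_eq :
    conjTensorInvolution ι n =
      IsOctonionAlgebra.tensorConj (conjNorm hι n) n := by
  rw [IsOctonionAlgebra.tensorConj, octConj_conjugate]
  rfl

theorem Transfer.val_involution (x : Transfer hι C) :
    (transferInvolution hι n x).val hι C =
      IsOctonionAlgebra.tensorConj (conjNorm hι n) n (x.val hι C) := by
  rw [← conjTensorInvolution_eq]
  rfl

theorem isTrialitarian_transferInvolution (hn : IsOctonionAlgebra n) [Invertible (2 : E)] :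
    IsTrialitarian (transferInvolution hι n) :=
  ((hn.conjugate hι).isTrialitarian_tensor hn).of_injective
    (Transfer.val hι C).toAddMonoidHom (Transfer.val_injective hι)
    (Transfer.val_mul hι) (Transfer.val_involution hι)

theorem Transfer.val_tri (j : Fin 3) (a b x : Transfer hι C) :
    (tri (transferInvolution hι n) j a b x).val hι C =
      tri (IsOctonionAlgebra.tensorConj (conjNorm hι n) n) j (a.val hι C)
        (b.val hι C) (x.val hι C) := by
  fin_cases j
  · change (tri _ 0 a b x).val hι C = tri _ 0 _ _ _
    simp only [tri_zero_apply, map_sub, Transfer.val_mul, Transfer.val_involution]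
  · change (tri _ 1 a b x).val hι C = tri _ 1 _ _ _
    simp only [tri_one_apply, map_sub, Transfer.val_mul, Transfer.val_involution]
  · change (tri _ 2 a b x).val hι C = tri _ 2 _ _ _
    simp only [tri_two_apply, map_sub, map_add, Transfer.val_mul, Transfer.val_involution]

/-- The fixed space of $\iota$ is a proper subspace of the plane $E$ and contains $1$, so it is the
line $K$. -/
theorem exists_algebraMap_eq_of_fixed (hE : Module.finrank K E = 2) (hι : orderOf ι = 2) {x : E}
    (hx : ι x = x) : ∃ c : K, algebraMap K E c = x := by
  have : Module.Finite K E := Module.finite_of_finrank_pos (by omega)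
  have : Nontrivial E := Module.nontrivial_of_finrank_pos (R := K) (by omega)
  set F : Submodule K E := LinearMap.eqLocus ι.toLinearMap LinearMap.id with hF
  have h1 : (1 : E) ∈ F := by simp [hF]
  have hlt : Module.finrank K F < 2 := by
    rw [← hE]
    refine Submodule.finrank_lt fun htop => ?_
    have : ι = 1 := by
      ext e
      have : e ∈ F := htop ▸ Submodule.mem_top
      exact this
    rw [this, orderOf_one] at hι
    omega
  have hpos : 0 < Module.finrank K F :=
    Module.finrank_pos_iff_exists_ne_zero.2
      ⟨⟨1, h1⟩, fun h => one_ne_zero (congrArg Subtype.val h)⟩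
  obtain ⟨c, hc⟩ := exists_smul_eq_of_finrank_eq_one (by omega : Module.finrank K F = 1)
    (x := ⟨1, h1⟩) (fun h => one_ne_zero (congrArg Subtype.val h)) (⟨x, hx⟩ : F)
  exact ⟨c, by rw [Algebra.algebraMap_eq_smul_one]; exact congrArg Subtype.val hc⟩

/-- A quadratic étale algebra has an invertible element of trace zero. -/
theorem exists_isUnit_conj_eq_neg [IsReduced E] (hE : Module.finrank K E = 2)
    (hι : orderOf ι = 2) : ∃ d : E, IsUnit d ∧ ι d = -d := by
  obtain ⟨e, he⟩ : ∃ e, ι e ≠ e := by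
    by_contra! h
    have : ι = 1 := AlgEquiv.ext h
    rw [this, orderOf_one] at hι
    omega
  have hd : ι (e - ι e) = -(e - ι e) := by
    rw [map_sub, apply_apply_of_orderOf_eq_two hι, neg_sub]
  have hd0 : e - ι e ≠ 0 := fun h => he (sub_eq_zero.1 h).symm
  -- The square of $e-\iota(e)$ is fixed by $\iota$, hence a scalar; it is nonzero since $E$ is
  -- reduced, which makes $e-\iota(e)$ a unit even when $E$ is split.
  obtain ⟨c, hc⟩ := exists_algebraMap_eq_of_fixed hE hι
    (show ι ((e - ι e) * (e - ι e)) = (e - ι e) * (e - ι e) by rw [map_mul, hd, neg_mul_neg])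
  have hc0 : c ≠ 0 := by
    rintro rfl
    rw [map_zero, eq_comm, ← pow_two, pow_eq_zero_iff two_ne_zero] at hc
    exact hd0 hc
  refine ⟨_, isUnit_of_mul_isUnit_left (y := e - ι e) ?_, hd⟩
  rw [← hc]
  exact (Ne.isUnit hc0).map (algebraMap K E)

theorem switch_smul (e : E) (t : Conjugate ι C ⊗[E] C) :
    switch hι C (e • t) = ι e • switch hι C t := by
  induction t with
  | zero => simp
  | add s t hs ht => simp only [smul_add, map_add, hs, ht]
  | tmul x y =>
    rw [← TensorProduct.tmul_smul, switch_tmul, switch_tmul, TensorProduct.smul_tmul',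
      Conjugate.smul_def, apply_apply_of_orderOf_eq_two hι]
    rfl

theorem switch_switch (t : Conjugate ι C ⊗[E] C) : switch hι C (switch hι C t) = t := by
  induction t with
  | zero => simp
  | add s t hs ht => simp only [map_add, hs, ht]
  | tmul x y => rfl


theorem Transfer.exists_val_eq {t : Conjugate ι C ⊗[E] C} (ht : switch hι C t = t) :
    ∃ a : Transfer hι C, a.val hι C = t := ⟨⟨t, ht⟩, rfl⟩

/-- A trace-zero unit `d` of `E` gives a decomposition of `ᶥC ⊗ C` into two copies of the
transfer. -/
theorem exists_transfer_prod_equiv [Invertible (2 : E)] {d : E} (hd : IsUnit d)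
    (hd' : ι d = -d) : ∃ φ : (Transfer hι C × Transfer hι C) ≃ₗ[K] (Conjugate ι C ⊗[E] C),
      ∀ a b, φ (a, b) = a.val hι C + d • b.val hι C := by
  have h2 : IsUnit (2 : E) := isUnit_of_invertible _
  have hι2 : ι ⅟2 = ⅟2 := by
    apply h2.mul_left_cancel
    have h := congrArg ι (mul_invOf_self (2 : E))
    rw [map_mul, map_ofNat, map_one] at h
    rw [h, mul_invOf_self]
  let φ : (Transfer hι C × Transfer hι C) →ₗ[K] (Conjugate ι C ⊗[E] C) :=
    (Transfer.val hι C).coprod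
      ((Module.toModuleEnd K (S := E) (Conjugate ι C ⊗[E] C) d) ∘ₗ Transfer.val hι C)
  have hφ : ∀ a b, φ (a, b) = a.val hι C + d • b.val hι C := fun a b => rfl
  refine ⟨LinearEquiv.ofBijective φ ⟨?_, ?_⟩, hφ⟩
  · rw [← LinearMap.ker_eq_bot, LinearMap.ker_eq_bot']
    rintro ⟨a, b⟩ hab
    rw [hφ] at hab
    have h1 := congrArg (switch hι C) hab
    rw [map_add, switch_smul, a.switch_val, b.switch_val, hd', map_zero] at h1
    have ha : a.val hι C = 0 := by
      refine h2.smul_left_cancel.1 ?_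
      linear_combination (norm := module) hab + h1
    rw [ha, zero_add] at hab
    have hb : b.val hι C = 0 := hd.smul_left_cancel.1 (hab.trans (smul_zero d).symm)
    have ha' : a = 0 := Transfer.val_injective hι (by rw [ha, map_zero])
    have hb' : b = 0 := Transfer.val_injective hι (by rw [hb, map_zero])
    rw [ha', hb']; rfl
  · intro t
    obtain ⟨d', hd1⟩ := hd.exists_left_inv
    have hd2 : ι d' = -d' := by
      apply hd.mul_left_cancel
      have h := congrArg ι hd1
      rw [map_mul, hd', map_one] at h
      linear_combination -h + hd1
    -- The two components are the symmetric part of $t$ and $d^{-1}$ times its antisymmetric part.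
    -- The latter is fixed because the switch is $\iota$-semilinear and $\iota(d^{-1})=-d^{-1}$.
    obtain ⟨a, ha⟩ := Transfer.exists_val_eq hι (t := (⅟2 : E) • (t + switch hι C t)) (by
      rw [switch_smul, hι2, map_add, switch_switch, add_comm])
    obtain ⟨b, hb⟩ := Transfer.exists_val_eq hι (t := (⅟2 : E) • d' • (t - switch hι C t)) (by
      rw [switch_smul, hι2, switch_smul, hd2, map_sub, switch_switch]
      module)
    refine ⟨(a, b), ?_⟩
    rw [hφ, ha, hb]
    have h3 : (⅟2 : E) * 2 = 1 := invOf_mul_self _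
    calc _ = ((⅟2 : E) * (1 + d' * d)) • t + ((⅟2 : E) * (1 - d' * d)) • switch hι C t := by module
      _ = t := by
        rw [hd1, sub_self, mul_zero, zero_smul, add_zero, one_add_one_eq_two, h3, one_smul]

/-- Over $K$ the map $f$ is two copies of $g$, by the decomposition along $1$ and $d$. Hence
$\operatorname{Tr}_{E/K}(\operatorname{tr}_E f)=2\operatorname{tr}_K g$. -/
theorem Transfer.trace_eq [IsReduced E] (hE : Module.finrank K E = 2) [Invertible (2 : K)]
    [Invertible (2 : E)] (hn : IsOctonionAlgebra n)
    (f : (Conjugate ι C ⊗[E] C) →ₗ[E] (Conjugate ι C ⊗[E] C)) (g : Module.End K (Transfer hι C))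
    (hfg : ∀ a, (g a).val hι C = f (a.val hι C)) :
    LinearMap.trace K _ g = ⅟(2 : K) * Algebra.trace K E (LinearMap.trace E _ f) := by
  have := hn.free
  have := hn.finite
  have := (hn.conjugate hι).free
  have := (hn.conjugate hι).finite
  have : Module.Finite K E := Module.finite_of_finrank_pos (by omega)
  have : Module.Finite K (Conjugate ι C ⊗[E] C) := Module.Finite.trans E _
  have : Module.Finite K (Transfer hι C) :=
    Module.Finite.of_injective (Transfer.val hι C) (Transfer.val_injective hι)
  obtain ⟨d, hd, hd'⟩ := exists_isUnit_conj_eq_neg hE hι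
  obtain ⟨φ, hφ⟩ := exists_transfer_prod_equiv (C := C) hι hd hd'
  have h : f.restrictScalars K = φ.conj (g.prodMap g) := by
    ext t
    obtain ⟨⟨a, b⟩, rfl⟩ := φ.surjective t
    rw [LinearEquiv.conj_apply_apply, φ.symm_apply_apply, LinearMap.prodMap_apply, hφ, hφ, hfg,
      hfg, LinearMap.restrictScalars_apply, map_add, map_smul]
  rw [← LinearMap.trace_restrictScalars_eq, h, LinearMap.trace_conj', LinearMap.trace_prodMap',
    ← two_mul, invOf_mul_cancel_left]

end Transfer

/-! ### The trace form on a tensor product of octonion algebras -/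

namespace IsOctonionAlgebra

variable {E C D : Type*} [CommRing E] [NonAssocRing C] [Module E C] [NonAssocRing D] [Module E D]
  [SMulCommClass E C C] [IsScalarTower E C C] [SMulCommClass E D D] [IsScalarTower E D D]
  {n : QuadraticForm E C} {m : QuadraticForm E D}

/-- The tensor product of the polar forms of two norms. -/
def polarTensor (n : QuadraticForm E C) (m : QuadraticForm E D) :
    LinearMap.BilinForm E (C ⊗[E] D) :=
  LinearMap.BilinForm.tmul n.polarBilin m.polarBilin

theorem polarTensor_tmul (a b : C) (a' b' : D) :
    polarTensor n m (a ⊗ₜ a') (b ⊗ₜ b') = polar n a b * polar m a' b' := by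
  rw [polarTensor, LinearMap.BilinForm.tensorDistrib_tmul]
  simp [mul_comm]

/-- The operator on a tensor product of octonion algebras whose trace gives the Killing form on
one of the components `A[ij]`. -/
def killingOp (n : QuadraticForm E C) (m : QuadraticForm E D) :
    (C ⊗[E] D) →ₗ[E] (C ⊗[E] D) →ₗ[E] Module.End E (C ⊗[E] D) :=
  LinearMap.mk₂ E (fun a b =>
    (tri (tensorConj n m) 2 b).flip a + (tri (tensorConj n m) 2 a).flip b
      + LinearMap.mulLeft E (tensorConj n m a) ∘ₗ LinearMap.mulLeft E b
      + LinearMap.mulRight E (tensorConj n m a) ∘ₗ LinearMap.mulRight E b)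
    (fun a a' b => by refine LinearMap.ext fun c => ?_; simp [add_mul, mul_add]; abel)
    (fun r a b => by refine LinearMap.ext fun c => ?_; simp [smul_add, smul_mul_assoc, mul_smul_comm])
    (fun a b b' => by refine LinearMap.ext fun c => ?_; simp [add_mul, mul_add]; abel)
    (fun r a b => by refine LinearMap.ext fun c => ?_; simp [smul_add, smul_mul_assoc, mul_smul_comm])

theorem killingOp_apply (a b c : C ⊗[E] D) :
    killingOp n m a b c = tri (tensorConj n m) 2 b c a + tri (tensorConj n m) 2 a c b
      + tensorConj n m a * (b * c) + (c * b) * tensorConj n m a := rfl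

/-- The four summands contribute $14+14+16+16$; the last two are products of traces $4n(a,b)\cdot
4n(a',b')$. -/
theorem trace_killingOp (hn : IsOctonionAlgebra n) (hm : IsOctonionAlgebra m) [IsArtinianRing E]
    [Invertible (2 : E)] (a b : C ⊗[E] D) :
    LinearMap.trace E _ (killingOp n m a b) = 60 * polarTensor n m a b := by
  have h2 : IsUnit (2 : E) := isUnit_of_invertible _
  have := hn.free
  have := hn.finite
  have := hm.free
  have := hm.finite
  induction a with
  | zero => simp
  | add a a' ha ha' => rw [map_add, LinearMap.add_apply, map_add, ha, ha', map_add,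
      LinearMap.add_apply]; ring
  | tmul a a' =>
    induction b with
    | zero => simp
    | add b b' hb hb' => rw [map_add, map_add, hb, hb', map_add]; ring
    | tmul b b' =>
      -- As a function of $c\otimes c'$ the value is a combination of two maps with one identity
      -- factor of rank 8 and two tensor products of rank-one maps: $14=8+8-1-1$.
      have key : ∀ (a b : C) (a' b' : D), LinearMap.trace E _
          ((tri (tensorConj n m) 2 (b ⊗ₜ b')).flip (a ⊗ₜ a')) = 14 * (polar n a b * polar m a' b')
          := by
        intro a b a' b'
        have h : (tri (tensorConj n m) 2 (b ⊗ₜ b')).flip (a ⊗ₜ a') =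
            polar n a b • TensorProduct.map LinearMap.id ((m.polarBilin b').smulRight a')
            + polar m a' b' • TensorProduct.map ((n.polarBilin b).smulRight a) LinearMap.id
            - TensorProduct.map ((n.polarBilin a).smulRight b) ((m.polarBilin b').smulRight a')
            - TensorProduct.map ((n.polarBilin b).smulRight a) ((m.polarBilin a').smulRight b')
            := by
          ext c c'
          simp only [TensorProduct.AlgebraTensorModule.curry_apply,
            LinearMap.restrictScalars_self, TensorProduct.curry_apply, LinearMap.flip_apply]
          refine h2.smul_left_cancel.1 ?_
          rw [← LinearMap.smul_apply, two_smul_tri_tmul hn hm]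
          simp only [LinearMap.smul_apply, LinearMap.add_apply, LinearMap.sub_apply,
            TensorProduct.map_tmul, hn.tri_two, hm.tri_two, LinearMap.id_apply,
            LinearMap.smulRight_apply, QuadraticMap.polarBilin_apply_apply,
            TensorProduct.tmul_sub, TensorProduct.sub_tmul,
            TensorProduct.tmul_smul, ← TensorProduct.smul_tmul']
          rw [QuadraticMap.polar_comm n c a, QuadraticMap.polar_comm m c' a',
            QuadraticMap.polar_comm n b a, QuadraticMap.polar_comm m b' a']
          module
        rw [h]
        simp only [map_add, map_sub, map_smul, LinearMap.trace_tensorProduct', hn.trace_id,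
          hm.trace_id, LinearMap.trace_smulRight, QuadraticMap.polarBilin_apply_apply, smul_eq_mul,
          QuadraticMap.polar_comm n b a, QuadraticMap.polar_comm m b' a']
        ring
      have e1 : LinearMap.mulLeft E (tensorConj n m (a ⊗ₜ a')) ∘ₗ LinearMap.mulLeft E (b ⊗ₜ b') =
          TensorProduct.map (LinearMap.mulLeft E (octConj n a) ∘ₗ LinearMap.mulLeft E b)
            (LinearMap.mulLeft E (octConj m a') ∘ₗ LinearMap.mulLeft E b') := by
        ext c c'; simp
      have e2 : LinearMap.mulRight E (tensorConj n m (a ⊗ₜ a')) ∘ₗ LinearMap.mulRight E (b ⊗ₜ b') =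
          TensorProduct.map (LinearMap.mulRight E (octConj n a) ∘ₗ LinearMap.mulRight E b)
            (LinearMap.mulRight E (octConj m a') ∘ₗ LinearMap.mulRight E b') := by
        ext c c'; simp
      rw [killingOp, LinearMap.mk₂_apply, e1, e2, map_add, map_add, map_add, key, key,
        LinearMap.trace_tensorProduct', LinearMap.trace_tensorProduct',
        hn.trace_mulLeft_mulLeft h2, hm.trace_mulLeft_mulLeft h2, hn.trace_mulRight_mulRight h2,
        hm.trace_mulRight_mulRight h2, polarTensor_tmul, QuadraticMap.polar_comm n b,
        QuadraticMap.polar_comm m b']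
      ring

end IsOctonionAlgebra

/-! ### The inner triples of a bi-octonion algebra -/

section

open IsOctonionAlgebra AllisonFaulkner

variable {K E C : Type*} [Field K] [CommRing E] [Algebra K E] {ι : E ≃ₐ[K] E}
  (hι : orderOf ι = 2) [NonAssocRing C] [Module E C] [Module K C] [IsScalarTower K E C]
  [SMulCommClass E C C] [IsScalarTower E C C] (n : QuadraticForm E C)

/-- The endomorphism `ᶥf ⊗ 1 + 1 ⊗ f` of `ᶥC ⊗ C`. -/
def diagTensor (ι : E ≃ₐ[K] E) (f : Module.End E C) :
    (Conjugate ι C ⊗[E] C) →ₗ[E] (Conjugate ι C ⊗[E] C) :=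
  TensorProduct.map (Conjugate.map ι f) LinearMap.id + TensorProduct.map LinearMap.id f

theorem switch_map_right (f : Module.End E C) (t : Conjugate ι C ⊗[E] C) :
    switch hι C (TensorProduct.map LinearMap.id f t) =
      TensorProduct.map (Conjugate.map ι f) LinearMap.id (switch hι C t) := by
  induction t with
  | zero => simp
  | add s t hs ht => simp only [map_add, hs, ht]
  | tmul x y => rfl

theorem switch_diagTensor (f : Module.End E C) (t : Conjugate ι C ⊗[E] C) :
    switch hι C (diagTensor ι f t) = diagTensor ι f (switch hι C t) := by
  have h := switch_map_right hι f (switch hι C t)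
  rw [switch_switch] at h
  rw [diagTensor, LinearMap.add_apply, map_add, switch_map_right, ← h, switch_switch, add_comm,
    LinearMap.add_apply]

/-- The restriction of `ᶥf ⊗ 1 + 1 ⊗ f` to the transfer. -/
def diagEnd : Module.End E C →ₗ[K] Module.End K (Transfer hι C) where
  toFun f := ((diagTensor ι f).restrictScalars K).restrict (p := transferSubmodule hι C)
    (q := transferSubmodule hι C) fun t ht => by
      change switch hι C _ = _
      rw [LinearMap.restrictScalars_apply, switch_diagTensor]
      exact congrArg _ ht
  map_add' f g := by
    refine LinearMap.ext fun a => Transfer.val_injective hι ?_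
    change diagTensor ι (f + g) (Transfer.val hι C a) =
      diagTensor ι f (Transfer.val hι C a) + diagTensor ι g (Transfer.val hι C a)
    have h : Conjugate.map ι (f + g) = Conjugate.map ι f + Conjugate.map ι g := rfl
    simp only [diagTensor, h, TensorProduct.map_add_left, TensorProduct.map_add_right,
      LinearMap.add_apply]
    abel
  map_smul' c f := by
    refine LinearMap.ext fun a => Transfer.val_injective hι ?_
    change diagTensor ι (c • f) (Transfer.val hι C a) = c • diagTensor ι f (Transfer.val hι C a)
    have h1 : c • f = algebraMap K E c • f := (algebraMap_smul E c f).symm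
    have h : Conjugate.map ι (algebraMap K E c • f) = algebraMap K E c • Conjugate.map ι f := by
      ext x
      rw [LinearMap.smul_apply, Conjugate.smul_def, AlgEquiv.commutes]
      rfl
    rw [← algebraMap_smul E c (diagTensor ι f (Transfer.val hι C a)), h1]
    simp only [diagTensor, h, TensorProduct.map_smul_left, TensorProduct.map_smul_right,
      LinearMap.add_apply, LinearMap.smul_apply, smul_add]

theorem val_diagEnd (f : Module.End E C) (a : Transfer hι C) :
    (diagEnd hι f a).val hι C = diagTensor ι f (a.val hι C) := rfl

/-- The triples of endomorphisms of the transfer given by elements of `⋀² C`. -/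
def wedgeTriple : ⋀[E]^2 C →ₗ[K] (Fin 3 → Module.End K (Transfer hι C)) :=
  LinearMap.pi fun k => diagEnd hι ∘ₗ (extTri n k).restrictScalars K

theorem wedgeTriple_apply (w : ⋀[E]^2 C) (k : Fin 3) :
    wedgeTriple hι n w k = diagEnd hι (extTri n k w) := rfl

/-- The bilinear map `(a₁ ⊗ a₂, b₁ ⊗ b₂) ↦ n(a₁,b₁) a₂ ∧ b₂`. -/
def wedgePairing : (Conjugate ι C ⊗[E] C) →ₗ[E] (Conjugate ι C ⊗[E] C) →ₗ[E] ⋀[E]^2 C :=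
  (TensorProduct.map₂ (conjNorm hι n).polarBilin wedge).compr₂
    (TensorProduct.lid E (⋀[E]^2 C)).toLinearMap

theorem wedgePairing_tmul (a b : Conjugate ι C) (a' b' : C) :
    wedgePairing hι n (a ⊗ₜ a') (b ⊗ₜ b') = polar (conjNorm hι n) a b • wedge a' b' := by
  simp [wedgePairing]

variable {n}

theorem tri_conjugate (j : Fin 3) (x y : Conjugate ι C) :
    tri (octConj (conjNorm hι n)) j x y =
      Conjugate.map ι (tri (octConj n) j ((Conjugate.of ι).symm x) ((Conjugate.of ι).symm y)) := by
  rw [octConj_conjugate]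
  ext z
  fin_cases j
  · change tri _ 0 x y z = Conjugate.map ι (tri _ 0 _ _) z
    rw [tri_zero_apply]
    exact (congrArg (Conjugate.of ι) (tri_zero_apply (octConj n) _ _ _)).symm
  · change tri _ 1 x y z = Conjugate.map ι (tri _ 1 _ _) z
    rw [tri_one_apply]
    exact (congrArg (Conjugate.of ι) (tri_one_apply (octConj n) _ _ _)).symm
  · change tri _ 2 x y z = Conjugate.map ι (tri _ 2 _ _) z
    rw [tri_two_apply]
    exact (congrArg (Conjugate.of ι) (tri_two_apply (octConj n) _ _ _)).symm

/-- Restates `two_smul_tri_tmul` with both coefficients as elements of $\bigwedge^2C$; switching the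
tensors exposes the coefficient of the conjugate factor. -/
theorem two_smul_tri_eq (hn : IsOctonionAlgebra n) (j : Fin 3) (a b : Conjugate ι C ⊗[E] C) :
    (2 : E) • tri (tensorConj (conjNorm hι n) n) j a b =
      TensorProduct.map (Conjugate.map ι
        (extTri n j (wedgePairing hι n (switch hι C a) (switch hι C b)))) LinearMap.id
      + TensorProduct.map LinearMap.id (extTri n j (wedgePairing hι n a b)) := by
  have h0 : Conjugate.map ι (0 : Module.End E C) = 0 := rfl
  have h : ∀ f g : Module.End E C,
    Conjugate.map ι (f + g) = Conjugate.map ι f + Conjugate.map ι g := fun f g => rfl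
  induction a with
  | zero => simp [h0]
  | add a a' ha ha' =>
    simp only [map_add, LinearMap.add_apply, smul_add, ha, ha', h, TensorProduct.map_add_left,
      TensorProduct.map_add_right]
    abel
  | tmul a a' =>
    induction b with
    | zero => simp [h0]
    | add b b' hb hb' =>
      simp only [map_add, smul_add, hb, hb', h, TensorProduct.map_add_left,
        TensorProduct.map_add_right]
      abel
    | tmul b b' =>
      have h2 : ∀ (e : E) (f : Module.End E C), Conjugate.map ι (ι e • f) =
          e • Conjugate.map ι f := fun e f => rfl
      rw [two_smul_tri_tmul (hn.conjugate hι) hn, switch_tmul, switch_tmul, wedgePairing_tmul,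
        wedgePairing_tmul, polar_conjugate hι a b, polar_conjugate, LinearEquiv.symm_apply_apply,
        LinearEquiv.symm_apply_apply, map_smul, map_smul, h2, extTri_wedge, extTri_wedge,
        TensorProduct.map_smul_left, TensorProduct.map_smul_right, tri_conjugate]

/-- On tensors fixed by the switch both halves come from the same element of $\bigwedge^2C$, so the
operator is diagonal. -/
theorem two_smul_triple_zero (hn : IsOctonionAlgebra n) [Invertible (2 : E)]
    (j : Fin 3) (a b : Transfer hι C) :
    (2 : K) • tri (transferInvolution hι n) j a b =
      diagEnd hι (extTri n j (wedgePairing hι n (a.val hι C) (b.val hι C))) := by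
  refine LinearMap.ext fun x => Transfer.val_injective hι ?_
  rw [val_diagEnd, LinearMap.smul_apply, map_smul, Transfer.val_tri,
    ← algebraMap_smul E (2 : K), map_ofNat, ← LinearMap.smul_apply, two_smul_tri_eq hι hn,
    a.switch_val, b.switch_val]
  rfl

/-- The symmetric tensor `1 ⊗ x + x ⊗ 1` in the transfer. -/
def Transfer.sym (x : C) : Transfer hι C :=
  ⟨Conjugate.of ι 1 ⊗ₜ[E] x + Conjugate.of ι x ⊗ₜ[E] 1, by
    change switch hι C _ = _
    rw [map_add, switch_tmul, switch_tmul, add_comm]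
    rfl⟩

theorem Transfer.val_sym (x : C) :
    (Transfer.sym hι x).val hι C = Conjugate.of ι 1 ⊗ₜ[E] x + Conjugate.of ι x ⊗ₜ[E] 1 := rfl

/-- The products of elements of the transfer span the exterior square. -/
theorem eq_top_of_wedgePairing_mem (hn : IsOctonionAlgebra n) (h2 : (2 : K) ≠ 0)
    (M : Submodule K (⋀[E]^2 C))
    (hM : ∀ a b : Transfer hι C, wedgePairing hι n (a.val hι C) (b.val hι C) ∈ M) : M = ⊤ := by
  -- This is the pairing of $1\otimes x+x\otimes 1$ with $1\otimes y+y\otimes 1$. Taking $y=1$ gives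
  -- $4\,x\wedge 1$, after which the two correction terms can be removed.
  have key : ∀ x y : C, (2 : E) • wedge (R := E) x y
      + wedge (R := E) (ι (polar n 1 y) • x) 1 + wedge (R := E) 1 (ι (polar n x 1) • y) ∈ M := by
    intro x y
    have h := hM (Transfer.sym hι x) (Transfer.sym hι y)
    simp only [Transfer.val_sym, map_add, LinearMap.add_apply, wedgePairing_tmul,
      polar_conjugate, LinearEquiv.symm_apply_apply, wedge_self, smul_zero, add_zero,
      hn.polar_one_one, map_ofNat] at h
    convert h using 1
    simp only [map_smul, LinearMap.smul_apply]
    abel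
  have hsmul : ∀ (r : K), r ≠ 0 → ∀ x, algebraMap K E r • x ∈ M → x ∈ M := by
    intro r hr x hx
    rw [algebraMap_smul] at hx
    exact (M.smul_mem_iff hr).1 hx
  have h1 : ∀ x : C, wedge (R := E) x 1 ∈ M := by
    intro x
    have h := key x 1
    rw [hn.polar_one_one, wedge_swap 1] at h
    refine hsmul 2 h2 _ (hsmul 2 h2 _ ?_)
    rw [map_ofNat, smul_smul]
    have h0 : wedge (R := E) (ι (polar n x 1) • 1) (1 : C) = 0 := by
      rw [map_smul, LinearMap.smul_apply, wedge_self, smul_zero]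
    rw [h0, neg_zero, add_zero, map_ofNat, map_smul, LinearMap.smul_apply, ← add_smul] at h
    convert h using 2
    norm_num
  rw [eq_top_iff]
  rintro w -
  induction w using wedge_induction with
  | hw x y =>
    refine hsmul 2 h2 _ ?_
    have h := M.sub_mem (M.add_mem (key x y) (h1 (ι (polar n x 1) • y)))
      (h1 (ι (polar n 1 y) • x))
    rw [wedge_swap 1] at h
    rw [map_ofNat]
    convert h using 1
    abel
  | hz => exact M.zero_mem
  | ha x y hx hy => exact M.add_mem hx hy

/-- The triples with $i=0$ already give the whole range. A triple with another $i$ is a cyclic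
shift, still related and skew over $C$, so local triality attaches it to some other element of
$\bigwedge^2C$. -/
theorem range_wedgeTriple (hn : IsOctonionAlgebra n) [IsArtinianRing E] [IsReduced E]
    [Invertible (2 : E)] (h2 : (2 : K) ≠ 0) (h6 : IsUnit (6 : E)) :
    LinearMap.range (wedgeTriple hι n) = innerTriples (transferInvolution hι n) := by
  apply le_antisymm
  · rw [LinearMap.range_eq_map, ← eq_top_of_wedgePairing_mem hι hn h2
      ((innerTriples (transferInvolution hι n)).comap (wedgeTriple hι n)), Submodule.map_le_iff_le_comap]
    intro a b
    have : wedgeTriple hι n (wedgePairing hι n (a.val hι C) (b.val hι C)) =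
        (2 : K) • triple (transferInvolution hι n) 0 a b := by
      funext k
      rw [wedgeTriple_apply, ← two_smul_triple_zero hι hn, Pi.smul_apply, triple_apply, sub_zero]
    rw [Submodule.mem_comap, this]
    exact Submodule.smul_mem _ _ (IsTrialitarian.triple_mem _ _ _ _)
  · refine Submodule.span_le.2 ?_
    rintro _ ⟨i, a, b, rfl⟩
    have hs := hn.extTri_mem_skewTriples (wedgePairing hι n (a.val hι C) (b.val hι C))
    have hs' : (fun k => extTri n (k - i) (wedgePairing hι n (a.val hι C) (b.val hι C))) ∈
        skewTriples n := by
      refine ⟨fun k => hs.1 (k - i), fun k x y => ?_⟩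
      have := hs.2 (k - i) x y
      simpa only [sub_add_eq_add_sub] using this
    obtain ⟨w, hw⟩ := hn.exists_extTri_eq h6 hs'
    refine (SetLike.mem_coe).2 ((Submodule.smul_mem_iff _ h2).1 ⟨w, ?_⟩)
    funext k
    rw [wedgeTriple_apply, ← hw, ← two_smul_triple_zero hι hn, Pi.smul_apply, tripleFun_apply]

/-- A diagonal operator ${}^\iota f\otimes1+1\otimes f$ that vanishes on the transfer vanishes on
the whole tensor product. Evaluating at $x\otimes1$ and pairing with $z\otimes1$ isolates
$n(f(x),z)$, since $n(f(1),1)=0$ by skewness. -/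
theorem wedgeTriple_injective [IsReduced E] (hn : IsOctonionAlgebra n) [IsArtinianRing E]
    (hE : Module.finrank K E = 2) [Invertible (2 : E)] :
    Function.Injective (wedgeTriple hι n) := by
  have h2 : IsUnit (2 : E) := isUnit_of_invertible _
  rw [← LinearMap.ker_eq_bot, LinearMap.ker_eq_bot']
  intro w hw
  apply hn.extTri_injective h2
  rw [map_zero]
  have hf : ∀ x y, polar n (extTri n 2 w x) y = - polar n x (extTri n 2 w y) :=
    (hn.extTri_mem_skewTriples w).1 2
  have h0 : diagEnd hι (extTri n 2 w) = 0 := congrFun hw 2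
  set f := extTri n 2 w
  obtain ⟨d, hd, hd'⟩ := exists_isUnit_conj_eq_neg hE hι
  obtain ⟨φ, hφ⟩ := exists_transfer_prod_equiv (C := C) hι hd hd'
  have h1 : ∀ t, diagTensor ι f t = 0 := by
    intro t
    obtain ⟨⟨a, b⟩, rfl⟩ := φ.surjective t
    rw [hφ, map_add, map_smul, ← val_diagEnd, ← val_diagEnd, h0, LinearMap.zero_apply,
      LinearMap.zero_apply, map_zero, smul_zero, add_zero]
  have hf1 : polar n (f 1) 1 = 0 := by
    have h := hf 1 1
    rw [QuadraticMap.polar_comm n 1, eq_neg_iff_add_eq_zero, ← two_mul,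
      h2.mul_right_eq_zero] at h
    exact h
  ext x
  refine hn.eq_of_polar fun z => ?_
  have h := congrArg (fun t => polarTensor (conjNorm hι n) n t (Conjugate.of ι z ⊗ₜ[E] (1 : C)))
    (h1 (Conjugate.of ι x ⊗ₜ[E] 1))
  simp only [diagTensor, LinearMap.add_apply, TensorProduct.map_tmul, map_add, polarTensor_tmul,
    LinearMap.id_apply, hf1, mul_zero, add_zero, map_zero, LinearMap.zero_apply,
    hn.polar_one_one, polar_conjugate] at h
  rw [mul_comm, h2.mul_right_eq_zero] at h
  rw [LinearMap.zero_apply, QuadraticMap.polar_zero_left]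
  exact (map_eq_zero_iff ι ι.injective).1 h

/-! ### Pairings -/

theorem polarTensor_switch (s t : Conjugate ι C ⊗[E] C) :
    polarTensor (conjNorm hι n) n (switch hι C s) (switch hι C t) =
      ι (polarTensor (conjNorm hι n) n s t) := by
  induction s with
  | zero => simp
  | add s s' hs hs' => simp only [map_add, LinearMap.add_apply, hs, hs']
  | tmul x y =>
    induction t with
    | zero => simp
    | add t t' ht ht' => simp only [map_add, ht, ht']
    | tmul x' y' =>
      rw [switch_tmul, switch_tmul, polarTensor_tmul, polarTensor_tmul, polar_conjugate,
        polar_conjugate, _root_.map_mul, apply_apply_of_orderOf_eq_two hι, mul_comm]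
      rfl

/-- The constant is $-2\cdot4$: the $2$ of the rotation formula and the $4$ of
`lambdaSq_bilin_wedge`. -/
theorem polarTensor_map_right (hn : IsOctonionAlgebra n) [Invertible (2 : E)] (w : ⋀[E]^2 C)
    (s t : Conjugate ι C ⊗[E] C) :
    polarTensor (conjNorm hι n) n s (TensorProduct.map LinearMap.id (extTri n 2 w) t) =
      -8 * (exteriorPower.pairingDual E C 2 ∘ₗ exteriorPower.map 2 (QuadraticMap.associated n))
        w (wedgePairing hι n s t) := by
  induction w using wedge_induction with
  | hw u v =>
    induction s with
    | zero => simp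
    | add s s' hs hs' =>
      simp only [map_add, LinearMap.add_apply] at hs hs' ⊢
      rw [hs, hs']; ring
    | tmul x y =>
      induction t with
      | zero => simp
      | add t t' ht ht' =>
        simp only [map_add] at ht ht' ⊢
        rw [ht, ht']; ring
      | tmul x' y' =>
        have h := lambdaSq_bilin_wedge n u v y y'
        rw [TensorProduct.map_tmul, polarTensor_tmul, wedgePairing_tmul, extTri_wedge, hn.tri_two,
          map_smul, smul_eq_mul, LinearMap.id_apply, QuadraticMap.polar_smul_right,
          QuadraticMap.polar_sub_right, QuadraticMap.polar_smul_right,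
          QuadraticMap.polar_smul_right, smul_eq_mul, smul_eq_mul, smul_eq_mul,
          QuadraticMap.polar_comm n y, QuadraticMap.polar_comm n y]
        linear_combination (2 * polar (conjNorm hι n) x x') * h
  | hz => simp
  | ha x y hx hy =>
    simp only [map_add, TensorProduct.map_add_right, LinearMap.add_apply, hx, hy]
    ring

/-- The two halves of the diagonal operator contribute values conjugate under $\iota$, with equal
traces; this doubles the constant $-8$. -/
theorem trace_polarTensor_diagEnd (hn : IsOctonionAlgebra n) [Invertible (2 : E)]
    (w : ⋀[E]^2 C) (a b : Transfer hι C) :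
    Algebra.trace K E (polarTensor (conjNorm hι n) n (a.val hι C)
      ((diagEnd hι (extTri n 2 w) b).val hι C)) =
      -16 * Algebra.trace K E
        ((exteriorPower.pairingDual E C 2 ∘ₗ exteriorPower.map 2 (QuadraticMap.associated n))
          w (wedgePairing hι n (a.val hι C) (b.val hι C))) := by
  have h1 : polarTensor (conjNorm hι n) n (a.val hι C) (TensorProduct.map
      (Conjugate.map ι (extTri n 2 w)) LinearMap.id (b.val hι C)) =
      ι (polarTensor (conjNorm hι n) n (a.val hι C)
        (TensorProduct.map LinearMap.id (extTri n 2 w) (b.val hι C))) := by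
    rw [← polarTensor_switch, switch_map_right, a.switch_val, b.switch_val]
  rw [val_diagEnd, diagTensor, LinearMap.add_apply, map_add, h1, map_add,
    Algebra.trace_eq_of_algEquiv, polarTensor_map_right hι hn]
  have h8 : ∀ x : E, -8 * x = (-8 : K) • x := fun x => by
    rw [Algebra.smul_def, map_neg, map_ofNat]
  rw [h8, map_smul, smul_eq_mul]
  ring

end

/-! ### The Killing form of the Allison–Faulkner construction -/

/-- Only the resolution of the identity is needed: $f$ is the sum of the maps $(f i)p$ and $(f
j_k)q_k$, and the trace is cyclic. -/
theorem LinearMap.trace_eq_add_sum_of_projections {K M N P I : Type*} [Field K] [AddCommGroup M]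
    [Module K M] [AddCommGroup N] [Module K N] [AddCommGroup P] [Module K P] [Module.Finite K M]
    [Module.Finite K N] [Module.Finite K P] [Fintype I] (i : N →ₗ[K] M) (p : M →ₗ[K] N)
    (j : I → P →ₗ[K] M) (q : I → M →ₗ[K] P) (h : ∀ x, x = i (p x) + ∑ k, j k (q k x))
    (f : Module.End K M) :
    LinearMap.trace K M f =
      LinearMap.trace K N (p ∘ₗ f ∘ₗ i) + ∑ k, LinearMap.trace K P (q k ∘ₗ f ∘ₗ j k) := by
  have hf : f = (f ∘ₗ i) ∘ₗ p + ∑ k, (f ∘ₗ j k) ∘ₗ q k := by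
    ext x
    conv_lhs => rw [h x]
    simp [LinearMap.sum_apply]
  conv_lhs => rw [hf]
  simp only [map_add, map_sum]
  rw [LinearMap.trace_comp_comm']
  congr 1
  exact Finset.sum_congr rfl fun k _ => LinearMap.trace_comp_comm' _ _

namespace IsTrialitarian

open AllisonFaulkner

variable {K A : Type*} [Field K] [NonUnitalNonAssocRing A] [Module K A] [SMulCommClass K A A]
  [IsScalarTower K A A] {bar : A →ₗ[K] A} {γ : Fin 3 → Kˣ}

variable (h : IsLieOn (bracket bar γ) (space bar))

/-- The inclusion of the inner triples. -/
def inT : innerTriples bar →ₗ[K] LieOn h where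
  toFun T := ⟨(T.1, 0), T.2, trivial⟩
  map_add' _ _ := Subtype.ext (Prod.ext rfl (add_zero (0 : Fin 3 → A)).symm)
  map_smul' c _ := Subtype.ext (Prod.ext rfl (smul_zero c).symm)

/-- The inclusion of the copy `A[ij]` of `A`, where `(i j k)` is cyclic. -/
def inA (k : Fin 3) : A →ₗ[K] LieOn h where
  toFun a := ⟨(0, Pi.single k a), Submodule.zero_mem _, trivial⟩
  map_add' a b := Subtype.ext (Prod.ext (add_zero _).symm ((LinearMap.single K (fun _ => A) k).map_add a b))
  map_smul' c a := Subtype.ext (Prod.ext (smul_zero c).symm ((LinearMap.single K (fun _ => A) k).map_smul c a))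

/-- The projection to the inner triples. -/
def prT : LieOn h →ₗ[K] innerTriples bar where
  toFun x := ⟨x.1.1, x.2.1⟩
  map_add' _ _ := rfl
  map_smul' _ _ := rfl

/-- The projection to the copy `A[ij]` of `A`, where `(i j k)` is cyclic. -/
def prA (k : Fin 3) : LieOn h →ₗ[K] A where
  toFun x := x.1.2 k
  map_add' _ _ := rfl
  map_smul' _ _ := rfl

theorem prT_inT (T : innerTriples bar) : prT h (inT h T) = T := rfl

theorem prT_inA (k : Fin 3) (a : A) : prT h (inA h k a) = 0 := rfl

theorem prA_inT (k : Fin 3) (T : innerTriples bar) : prA h k (inT h T) = 0 := rfl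

theorem prA_inA (k l : Fin 3) (a : A) :
    prA h k (inA h l a) = (Pi.single l a : Fin 3 → A) k := rfl

theorem lieOn_ext {x y : LieOn h} (h1 : prT h x = prT h y) (h2 : ∀ k, prA h k x = prA h k y) :
    x = y :=
  Subtype.ext (Prod.ext (congrArg Subtype.val h1) (funext h2))

theorem eq_inT_add_sum (x : LieOn h) : x = inT h (prT h x) + ∑ k, inA h k (prA h k x) := by
  refine lieOn_ext h ?_ fun l => ?_
  · simp [prT_inT, prT_inA]
  · simp [prA_inT, prA_inA, Finset.sum_pi_single]

theorem prT_lie (x y : LieOn h) : (prT h ⁅x, y⁆ : Fin 3 → Module.End K A) =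
    prT h x * prT h y - prT h y * prT h x + ∑ k : Fin 3,
      ((γ (k + 1) : K) * (γ (k + 2) : K)⁻¹) • triple bar (k + 1) (prA h k x) (prA h k y) := rfl

theorem prA_lie (x y : LieOn h) (k : Fin 3) : prA h k ⁅x, y⁆ =
    (prT h x : Fin 3 → Module.End K A) k (prA h k y)
      - (prT h y : Fin 3 → Module.End K A) k (prA h k x)
      - ((γ (k + 2) : K) * (γ (k + 1) : K)⁻¹) •
          bar (prA h (k + 1) x * prA h (k + 2) y - prA h (k + 1) y * prA h (k + 2) x) := rfl

theorem lie_inT_inA (T : innerTriples bar) (k : Fin 3) (a : A) :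
    ⁅inT h T, inA h k a⁆ = inA h k ((T : Fin 3 → Module.End K A) k a) := by
  refine lieOn_ext h (Subtype.ext ?_) fun l => ?_
  · rw [prT_lie]
    simp [prT_inT, prT_inA, prA_inT]
  · rw [prA_lie]
    simp only [prT_inT, prT_inA, prA_inT, prA_inA]
    rcases eq_or_ne l k with rfl | hl
    · simp
    · simp [hl]

theorem lie_inA_inA (k : Fin 3) (a b : A) : ⁅inA h k a, inA h k b⁆ =
    ((γ (k + 1) : K) * (γ (k + 2) : K)⁻¹) •
      inT h ⟨triple bar (k + 1) a b, triple_mem bar _ a b⟩ := by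
  refine lieOn_ext h (Subtype.ext ?_) fun l => ?_
  · rw [prT_lie, map_smul, Finset.sum_eq_single k]
    · simp [prT_inA, prA_inA, prT_inT]
    · intro l _ hl
      simp [prA_inA, hl]
    · simp
  · rw [prA_lie, map_smul, prA_inT]
    simp only [prT_inA, prA_inA]
    have : l + 1 ≠ l + 2 := by revert l; decide
    rcases eq_or_ne (l + 1) k with rfl | hl
    · simp [this.symm]
    · simp [hl]

theorem lie_inA_inA_add_one (k : Fin 3) (a b : A) : ⁅inA h k a, inA h (k + 1) b⁆ =
    -inA h (k + 2) (((γ (k + 1) : K) * (γ k : K)⁻¹) • bar (a * b)) := by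
  refine lieOn_ext h (Subtype.ext ?_) fun l => ?_
  · rw [prT_lie, map_neg, prT_inA, Finset.sum_eq_zero]
    · simp [prT_inA]
    · intro l _
      have : k ≠ k + 1 := by revert k; decide
      rcases eq_or_ne l k with rfl | hl
      · simp [prA_inA, this]
      · simp [prA_inA, hl]
  · rw [prA_lie, map_neg]
    simp only [prT_inA, prA_inA]
    fin_cases k <;> fin_cases l <;> simp

theorem lie_inA_inA_add_two (k : Fin 3) (a b : A) : ⁅inA h k a, inA h (k + 2) b⁆ =
    inA h (k + 1) (((γ k : K) * (γ (k + 2) : K)⁻¹) • bar (b * a)) := by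
  have h1 := lie_inA_inA_add_one h (k + 2) b a
  have e1 : k + 2 + 1 = k := by clear * -; revert k; decide
  have e2 : k + 2 + 2 = k + 1 := by clear * -; revert k; decide
  rw [e1, e2] at h1
  rw [← lie_skew, h1, neg_neg]

/-- The operator whose trace gives the Killing form on `A[ij]`. -/
def killingEnd (bar : A →ₗ[K] A) (a b : A) : Module.End K A :=
  (tri bar 2 b).flip a + (tri bar 2 a).flip b + LinearMap.mulLeft K (bar a) ∘ₗ LinearMap.mulLeft K b
    + LinearMap.mulRight K (bar a) ∘ₗ LinearMap.mulRight K b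

theorem killingEnd_apply (a b c : A) : killingEnd bar a b c =
    tri bar 2 b c a + tri bar 2 a c b + bar a * (b * c) + (c * b) * bar a := rfl

variable [Module.Finite K A]

instance : Module.Finite K (LieOn h) := inferInstanceAs (Module.Finite K ↥(space bar))

/-- The map $\operatorname{ad}a\operatorname{ad}b$ preserves the four summands of the algebra, and
its blocks on $\mathcal T_I$ and the three copies of $A$ contribute the four terms of `killingEnd`,
each with the factor $-g$. -/
theorem killingForm_inA_inA_self (hbar : ∀ a, bar (bar a) = a)
    (hmul : ∀ a b, bar (a * b) = bar b * bar a) (k : Fin 3) (a b : A) :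
    killingForm K (LieOn h) (inA h k a) (inA h k b) =
      -((γ (k + 1) : K) * (γ (k + 2) : K)⁻¹) * LinearMap.trace K A (killingEnd bar a b) := by
  set g := (γ (k + 1) : K) * (γ (k + 2) : K)⁻¹ with hg
  have hsum : ∀ f : Fin 3 → K, ∑ l, f l = f k + f (k + 1) + f (k + 2) := by
    intro f
    fin_cases k <;> simp [Fin.sum_univ_three] <;> ring
  have e2 : k - (k + 1) = 2 := by clear * -; revert k; decide
  have e3 : k + 1 + 1 = k + 2 := by clear * -; revert k; decide
  have e4 : k + 2 + 2 = k + 1 := by clear * -; revert k; decide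
  -- The block on $\mathcal T_I$ factors through $A$ as $s\circ r$, so its trace equals that of
  -- $r\circ s$ on $A$.
  let s : A →ₗ[K] innerTriples bar :=
    LinearMap.codRestrict _ (triple bar (k + 1) a) fun c => triple_mem bar _ a c
  let r : innerTriples bar →ₗ[K] A :=
    (LinearMap.applyₗ b) ∘ₗ (LinearMap.proj k) ∘ₗ (innerTriples bar).subtype
  have hT : prT h ∘ₗ (LieAlgebra.ad K (LieOn h) (inA h k a) ∘ₗ
      LieAlgebra.ad K (LieOn h) (inA h k b)) ∘ₗ inT h = (-g) • (s ∘ₗ r) := by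
    ext1 T
    change prT h ⁅inA h k a, ⁅inA h k b, inT h T⁆⁆ = _
    rw [← lie_skew (inA h k b), lie_neg, map_neg, lie_inT_inA, lie_inA_inA, map_smul, prT_inT,
      LinearMap.smul_apply, neg_smul]
    rfl
  have h0 : prA h k ∘ₗ (LieAlgebra.ad K (LieOn h) (inA h k a) ∘ₗ
      LieAlgebra.ad K (LieOn h) (inA h k b)) ∘ₗ inA h k = (-g) • (tri bar 2 b).flip a := by
    ext1 c
    change prA h k ⁅inA h k a, ⁅inA h k b, inA h k c⁆⁆ = _
    rw [lie_inA_inA, lie_smul, ← lie_skew, lie_inT_inA, smul_neg, ← neg_smul, map_smul, prA_inA,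
      Pi.single_eq_same]
    change -_ • (triple bar (k + 1) b c k) a = _
    rw [triple_apply, e2]
    rfl
  have h1 : prA h (k + 1) ∘ₗ (LieAlgebra.ad K (LieOn h) (inA h k a) ∘ₗ
      LieAlgebra.ad K (LieOn h) (inA h k b)) ∘ₗ inA h (k + 1) =
      (-g) • (LinearMap.mulLeft K (bar a) ∘ₗ LinearMap.mulLeft K b) := by
    ext1 c
    change prA h (k + 1) ⁅inA h k a, ⁅inA h k b, inA h (k + 1) c⁆⁆ = _
    rw [lie_inA_inA_add_one, lie_neg, lie_inA_inA_add_two, map_neg, prA_inA, Pi.single_eq_same,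
      smul_mul_assoc, map_smul, hmul, hbar, smul_smul, ← neg_smul, hg]
    congr 1
    field_simp
  have h2 : prA h (k + 2) ∘ₗ (LieAlgebra.ad K (LieOn h) (inA h k a) ∘ₗ
      LieAlgebra.ad K (LieOn h) (inA h k b)) ∘ₗ inA h (k + 2) =
      (-g) • (LinearMap.mulRight K (bar a) ∘ₗ LinearMap.mulRight K b) := by
    ext1 c
    change prA h (k + 2) ⁅inA h k a, ⁅inA h k b, inA h (k + 2) c⁆⁆ = _
    rw [lie_inA_inA_add_two, lie_inA_inA_add_one, map_neg, prA_inA, Pi.single_eq_same,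
      mul_smul_comm, map_smul, hmul, hbar, smul_smul, ← neg_smul, hg]
    congr 1
    field_simp
  have hrs : r ∘ₗ s = (tri bar 2 a).flip b := by
    ext1 c
    change triple bar (k + 1) a c k b = _
    rw [triple_apply, e2]
    rfl
  rw [killingForm_apply_apply, LinearMap.trace_eq_add_sum_of_projections (inT h) (prT h) (inA h)
    (prA h) (eq_inT_add_sum h), hsum, hT, h0, h1, h2, map_smul, map_smul, map_smul, map_smul,
    LinearMap.trace_comp_comm', hrs, killingEnd]
  simp only [map_add, smul_eq_mul]
  ring

/-- The sign change which is `1` on `𝒯_I` and on one copy of `A`, and `-1` on the other two. -/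
def signMap (m : Fin 3) : LieOn h →ₗ[K] LieOn h :=
  inT h ∘ₗ prT h + ∑ k, (if k = m then (1 : K) else -1) • (inA h k ∘ₗ prA h k)

theorem prT_signMap (m : Fin 3) (x : LieOn h) : prT h (signMap h m x) = prT h x := by
  simp only [signMap, LinearMap.add_apply, LinearMap.sum_apply, LinearMap.smul_apply,
    LinearMap.comp_apply, map_add, map_sum, map_smul, prT_inT, prT_inA, smul_zero,
    Finset.sum_const_zero, add_zero]

theorem prA_signMap (m k : Fin 3) (x : LieOn h) :
    prA h k (signMap h m x) = (if k = m then (1 : K) else -1) • prA h k x := by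
  simp [signMap, prA_inT, prA_inA, LinearMap.sum_apply, -ite_smul, Pi.single_apply]

theorem signMap_signMap (m : Fin 3) (x : LieOn h) : signMap h m (signMap h m x) = x := by
  refine lieOn_ext h (by rw [prT_signMap, prT_signMap]) fun k => ?_
  rw [prA_signMap, prA_signMap, smul_smul]
  split_ifs <;> simp

/-- `signMap` as an automorphism. -/
def signEquiv (m : Fin 3) : LieOn h ≃ₗ⁅K⁆ LieOn h :=
  { signMap h m with
    map_lie' := fun {x y} => by
      change signMap h m ⁅x, y⁆ = ⁅signMap h m x, signMap h m y⁆
      refine lieOn_ext h (Subtype.ext ?_) fun k => ?_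
      · rw [prT_signMap, prT_lie, prT_lie, prT_signMap, prT_signMap]
        congr 1
        refine Finset.sum_congr rfl fun k _ => ?_
        rw [prA_signMap, prA_signMap]
        split_ifs <;> simp
      · rw [prA_signMap, prA_lie, prA_lie, prT_signMap, prT_signMap]
        simp only [prA_signMap]
        -- The product of two of the signs is the third: the algebra is graded by the Klein
        -- four-group, and the sign maps are its characters.
        have e : (if k + 1 = m then (1 : K) else -1) * (if k + 2 = m then (1 : K) else -1) =
            if k = m then (1 : K) else -1 := by
          clear * -
          fin_cases m <;> fin_cases k <;> simp
        rw [smul_mul_smul_comm, smul_mul_smul_comm, e, ← smul_sub _ (_ * _), map_smul, map_smul,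
          map_smul, smul_comm _ (if k = m then (1 : K) else -1), smul_sub, smul_sub]
    invFun := signMap h m
    left_inv := signMap_signMap h m
    right_inv := signMap_signMap h m }

theorem signEquiv_apply (m : Fin 3) (x : LieOn h) : signEquiv h m x = signMap h m x := rfl

theorem signEquiv_inT (m : Fin 3) (T : innerTriples bar) : signEquiv h m (inT h T) = inT h T := by
  refine lieOn_ext h (prT_signMap h m _) fun l => ?_
  rw [signEquiv_apply, prA_signMap, prA_inT, smul_zero]

theorem signEquiv_inA (m k : Fin 3) (a : A) :
    signEquiv h m (inA h k a) = (if k = m then (1 : K) else -1) • inA h k a := by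
  refine lieOn_ext h ?_ fun l => ?_
  · rw [signEquiv_apply, prT_signMap, map_smul, prT_inA, smul_zero]
  · rw [signEquiv_apply, prA_signMap, map_smul, prA_inA]
    rcases eq_or_ne l k with rfl | hl
    · rfl
    · rw [Pi.single_eq_of_ne hl, smul_zero, smul_zero]

/-- An automorphism fixing one vector and negating the other preserves the Killing form. -/
theorem killingForm_inA_inA_of_ne (h2 : (2 : K) ≠ 0) {k l : Fin 3} (hkl : k ≠ l) (a b : A) :
    killingForm K (LieOn h) (inA h k a) (inA h l b) = 0 := by
  have h1 := LieAlgebra.killingForm_of_equiv_apply (signEquiv h k) (inA h k a) (inA h l b)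
  rw [signEquiv_inA, signEquiv_inA, if_pos rfl, if_neg hkl.symm, one_smul, neg_one_smul, map_neg, neg_eq_iff_add_eq_zero,
    ← two_mul] at h1
  exact (mul_eq_zero.1 h1).resolve_left h2

theorem killingForm_inT_inA (h2 : (2 : K) ≠ 0) (T : innerTriples bar) (k : Fin 3) (a : A) :
    killingForm K (LieOn h) (inT h T) (inA h k a) = 0 := by
  have hk : k ≠ k + 1 := by revert k; decide
  have h1 := LieAlgebra.killingForm_of_equiv_apply (signEquiv h (k + 1)) (inT h T) (inA h k a)
  rw [signEquiv_inT, signEquiv_inA, if_neg hk, neg_one_smul, map_neg, neg_eq_iff_add_eq_zero, ← two_mul] at h1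
  exact (mul_eq_zero.1 h1).resolve_left h2

/-- By invariance $\kappa([a,b],S)=\kappa(a,[b,S])$, which reduces $\mathcal T_I$ to a copy of $A$.
The factor $\gamma_i\gamma_j^{-1}$ occurs on both sides and cancels. -/
theorem killingForm_inT_inT (hbar : ∀ a, bar (bar a) = a)
    (hmul : ∀ a b, bar (a * b) = bar b * bar a) (k : Fin 3) (a b : A) (S : innerTriples bar) :
    killingForm K (LieOn h) (inT h ⟨triple bar (k + 1) a b, triple_mem bar _ a b⟩) (inT h S) =
      LinearMap.trace K A (killingEnd bar a ((S : Fin 3 → Module.End K A) k b)) := by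
  have h1 := LieModule.traceForm_apply_lie_apply K (LieOn h) (LieOn h) (inA h k a) (inA h k b)
    (inT h S)
  change killingForm K (LieOn h) _ _ = killingForm K (LieOn h) _ _ at h1
  rw [lie_inA_inA, ← lie_skew, lie_inT_inA, map_neg, killingForm_inA_inA_self h hbar hmul,
    map_smul, LinearMap.smul_apply, neg_mul, neg_neg, smul_eq_mul] at h1
  exact mul_left_cancel₀ (by simp) h1

end IsTrialitarian

/-! ### The Killing form in terms of the transfers -/

open IsTrialitarian

theorem IsTrialitarian.killingForm_self {K A : Type*} [Field K] [NonUnitalNonAssocRing A]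
    [Module K A] [SMulCommClass K A A] [IsScalarTower K A A] [Module.Finite K A]
    {bar : A →ₗ[K] A} {γ : Fin 3 → Kˣ}
    (h : IsLieOn (AllisonFaulkner.bracket bar γ) (AllisonFaulkner.space bar)) (h2 : (2 : K) ≠ 0)
    (T : AllisonFaulkner.innerTriples bar) (v : Fin 3 → A) :
    killingForm K (LieOn h) (inT h T + ∑ k, inA h k (v k)) (inT h T + ∑ k, inA h k (v k)) =
      killingForm K (LieOn h) (inT h T) (inT h T) +
        ∑ k, killingForm K (LieOn h) (inA h k (v k)) (inA h k (v k)) := by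
  have h1 : ∀ k a, killingForm K (LieOn h) (inA h k a) (inT h T) = 0 := fun k a => by
    rw [← killingForm_inT_inA h h2 T k a]
    exact LieModule.traceForm_comm K (LieOn h) (LieOn h) _ _
  simp only [map_add, map_sum, LinearMap.add_apply, LinearMap.sum_apply, killingForm_inT_inA h h2,
    h1, Finset.sum_const_zero, add_zero, zero_add]
  congr 1
  refine Finset.sum_congr rfl fun k _ => ?_
  rw [Finset.sum_eq_single k]
  · intro l _ hl
    exact killingForm_inA_inA_of_ne h h2 hl _ _
  · simp

section

variable {K E C : Type*} [Field K] [CommRing E] [Algebra K E] {ι : E ≃ₐ[K] E}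
  (hι : orderOf ι = 2) [NonAssocRing C] [Module E C] [Module K C] [IsScalarTower K E C]
  [SMulCommClass E C C] [IsScalarTower E C C] {n : QuadraticForm E C}

theorem Transfer.finite (hn : IsOctonionAlgebra n) [Module.Finite K E] :
    Module.Finite K (Transfer hι C) := by
  have := hn.finite
  have := (hn.conjugate hι).finite
  have : Module.Finite K (Conjugate ι C ⊗[E] C) := Module.Finite.trans E _
  exact Module.Finite.of_injective (Transfer.val hι C) (Transfer.val_injective hι)

theorem trace_killingEnd (hn : IsOctonionAlgebra n) [IsReduced E] [IsArtinianRing E]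
    (hE : Module.finrank K E = 2) [Invertible (2 : K)] [Invertible (2 : E)]
    (a b : Transfer hι C) :
    LinearMap.trace K _ (killingEnd (transferInvolution hι n) a b) =
      30 * Algebra.trace K E (IsOctonionAlgebra.polarTensor (conjNorm hι n) n (a.val hι C) (b.val hι C)) := by
  have h60 : ∀ x : E, 60 * x = (60 : K) • x := fun x => by
    rw [Algebra.smul_def, map_ofNat]
  rw [Transfer.trace_eq hι hE hn
    (IsOctonionAlgebra.killingOp (conjNorm hι n) n (a.val hι C) (b.val hι C)),
    IsOctonionAlgebra.trace_killingOp (hn.conjugate hι) hn, h60, map_smul, smul_eq_mul,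
    ← mul_assoc]
  · congr 1
    rw [invOf_mul_eq_iff_eq_mul_left]
    norm_num
  · intro c
    rw [IsOctonionAlgebra.killingOp_apply, killingEnd_apply, map_add, map_add, map_add,
      Transfer.val_tri, Transfer.val_tri, Transfer.val_mul, Transfer.val_mul, Transfer.val_mul,
      Transfer.val_mul, Transfer.val_involution]

/-- The inner triples of a bi-octonion algebra form an exterior square. -/
def wedgeEquiv (hn : IsOctonionAlgebra n) [IsArtinianRing E] [IsReduced E]
    (hE : Module.finrank K E = 2) [Invertible (2 : E)] (h2 : (2 : K) ≠ 0) (h6 : IsUnit (6 : E)) :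
    (⋀[E]^2 C) ≃ₗ[K] AllisonFaulkner.innerTriples (transferInvolution hι n) :=
  (LinearEquiv.ofInjective (wedgeTriple hι n) (wedgeTriple_injective hι hn hE)).trans
    (LinearEquiv.ofEq _ _ (range_wedgeTriple hι hn h2 h6))

theorem wedgeEquiv_apply (hn : IsOctonionAlgebra n) [IsArtinianRing E] [IsReduced E]
    (hE : Module.finrank K E = 2) [Invertible (2 : E)] (h2 : (2 : K) ≠ 0) (h6 : IsUnit (6 : E))
    (w : ⋀[E]^2 C) : (wedgeEquiv hι hn hE h2 h6 w : Fin 3 → Module.End K (Transfer hι C)) =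
      wedgeTriple hι n w := rfl

/-- The constant is $2\cdot30\cdot(-16)$: the factor $2$ of `two_smul_triple_zero`, the trace of
`killingEnd`, and `trace_polarTensor_diagEnd`. -/
theorem killingForm_wedgeEquiv (hn : IsOctonionAlgebra n) [IsArtinianRing E] [IsReduced E]
    [Module.Finite K E] [Module.Finite K (Transfer hι C)]
    (hE : Module.finrank K E = 2) [Invertible (2 : K)] [Invertible (2 : E)] (h2 : (2 : K) ≠ 0)
    (h6 : IsUnit (6 : E)) {γ : Fin 3 → Kˣ}
    (h : IsLieOn (AllisonFaulkner.bracket (transferInvolution hι n) γ)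
      (AllisonFaulkner.space (transferInvolution hι n))) (w w' : ⋀[E]^2 C) :
    killingForm K (LieOn h) (inT h (wedgeEquiv hι hn hE h2 h6 w))
      (inT h (wedgeEquiv hι hn hE h2 h6 w')) =
      -960 * Algebra.trace K E ((exteriorPower.pairingDual E C 2 ∘ₗ
        exteriorPower.map 2 (QuadraticMap.associated n)) w' w) := by
  let f : (⋀[E]^2 C) →ₗ[K] K := (killingForm K (LieOn h)).flip
    (inT h (wedgeEquiv hι hn hE h2 h6 w')) ∘ₗ inT h ∘ₗ (wedgeEquiv hι hn hE h2 h6).toLinearMap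
  let g : (⋀[E]^2 C) →ₗ[K] K := (-960 : K) • (Algebra.trace K E ∘ₗ ((exteriorPower.pairingDual E C 2
    ∘ₗ exteriorPower.map 2 (QuadraticMap.associated n)) w').restrictScalars K)
  have htri := isTrialitarian_transferInvolution hι hn
  -- Both sides are $K$-linear in $w$, so it is enough to treat the spanning elements given by pairs
  -- from the transfer.
  have hM := eq_top_of_wedgePairing_mem hι hn h2 (LinearMap.eqLocus f g) fun a b => by
    change killingForm K (LieOn h) (inT h (wedgeEquiv hι hn hE h2 h6 _)) (inT h _) =
      (-960 : K) • Algebra.trace K E _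
    have h1 : wedgeEquiv hι hn hE h2 h6 (wedgePairing hι n (a.val hι C) (b.val hι C)) =
        (2 : K) • ⟨AllisonFaulkner.triple (transferInvolution hι n) (2 + 1) a b,
          triple_mem _ _ a b⟩ := by
      apply Subtype.ext
      funext k
      rw [wedgeEquiv_apply, wedgeTriple_apply, ← two_smul_triple_zero hι hn]
      change _ = (2 : K) • AllisonFaulkner.triple (transferInvolution hι n) 0 a b k
      rw [AllisonFaulkner.triple_apply, sub_zero]
    rw [h1, map_smul, map_smul, LinearMap.smul_apply,
      killingForm_inT_inT h htri.bar_bar htri.bar_mul, trace_killingEnd hι hn hE,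
      wedgeEquiv_apply, wedgeTriple_apply, trace_polarTensor_diagEnd hι hn, smul_eq_mul,
      smul_eq_mul]
    change _ = _ * Algebra.trace K E ((exteriorPower.pairingDual E C 2 ∘ₗ
        exteriorPower.map 2 (QuadraticMap.associated n)) w' _)
    ring
  have hw : w ∈ LinearMap.eqLocus f g := hM ▸ Submodule.mem_top
  exact hw

/-- A polar form is twice the bilinear form in each tensor factor, and $N_{E/K}(n)$ is half of a
trace: $8=2\cdot2\cdot2$. -/
theorem eight_mul_transferForm [Invertible (2 : K)] [Invertible (2 : E)] (v : Transfer hι C) :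
    8 * transferForm hι n v =
      Algebra.trace K E (IsOctonionAlgebra.polarTensor (conjNorm hι n) n (v.val hι C) (v.val hι C)) := by
  have h1 : IsOctonionAlgebra.polarTensor (conjNorm hι n) n (v.val hι C) (v.val hι C) =
      (4 : K) • conjTensorForm hι n (v.val hι C) := by
    have e : QuadraticMap.associated (conjTensorForm hι n) =
        LinearMap.BilinForm.tmul (QuadraticMap.associated (conjNorm hι n))
          (QuadraticMap.associated n) := QuadraticForm.associated_tmul _ _
    have h : ∀ s t, IsOctonionAlgebra.polarTensor (conjNorm hι n) n s t =
        (4 : E) * QuadraticMap.associated (conjTensorForm hι n) s t := by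
      intro s t
      rw [e]
      induction s with
      | zero => simp
      | add s s' hs hs' => simp only [map_add, LinearMap.add_apply, hs, hs', mul_add]
      | tmul x y =>
        induction t with
        | zero => simp
        | add t t' ht ht' => simp only [map_add, ht, ht', mul_add]
        | tmul x' y' =>
          have h1 := QuadraticMap.two_nsmul_associated E (conjNorm hι n)
          have h2 := QuadraticMap.two_nsmul_associated E n
          have h3 := LinearMap.congr_fun₂ h1 x x'
          have h4 := LinearMap.congr_fun₂ h2 y y'
          rw [IsOctonionAlgebra.polarTensor_tmul, LinearMap.BilinForm.tensorDistrib_tmul]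
          simp only [LinearMap.smul_apply, nsmul_eq_mul, Nat.cast_ofNat,
            QuadraticMap.polarBilin_apply_apply] at h3 h4
          rw [← h3, ← h4, smul_eq_mul]
          ring
    rw [h, QuadraticMap.associated_eq_self_apply, Algebra.smul_def, map_ofNat (algebraMap K E)]
  rw [h1, map_smul, smul_eq_mul]
  change 8 * ⅟(2 : K) • Algebra.trace K E (conjTensorForm hι n (v.val hι C)) = _
  rw [smul_eq_mul, ← mul_assoc]
  congr 1
  rw [mul_invOf_eq_iff_eq_mul_right]
  norm_num

/-- The linear isomorphism underlying the computation of the Killing form. -/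
def lieOnEquiv (hn : IsOctonionAlgebra n) [IsArtinianRing E] [IsReduced E]
    (hE : Module.finrank K E = 2) [Invertible (2 : E)] (h2 : (2 : K) ≠ 0)
    (h6 : IsUnit (6 : E)) {γ : Fin 3 → Kˣ}
    (h : IsLieOn (AllisonFaulkner.bracket (transferInvolution hι n) γ)
      (AllisonFaulkner.space (transferInvolution hι n))) :
    ((⋀[E]^2 C) × (Fin 3 → Transfer hι C)) ≃ₗ[K] LieOn h :=
  LinearEquiv.ofLinearMap
    -- The scalars are chosen so that $-960/8^2=-240/4^2=-15$. The shift $k+1$ matches the copy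
    -- $A[ij]$, stored at $k$ with $i=k+1$, with the summand
    -- $\langle\gamma_i\gamma_{i+1}^{-1}\rangle$.
    (((8 : K)⁻¹ • (inT h ∘ₗ (wedgeEquiv hι hn hE h2 h6).toLinearMap)).coprod
      (∑ k, (4 : K)⁻¹ • (inA h k ∘ₗ LinearMap.proj (k + 1))))
    (((8 : K) • ((wedgeEquiv hι hn hE h2 h6).symm.toLinearMap ∘ₗ prT h)).prod
      (LinearMap.pi fun m => (4 : K) • prA h (m + 2)))
    (LinearMap.ext fun x => by
      have h4 : (4 : K) ≠ 0 := by
        rw [show (4 : K) = 2 * 2 by norm_num]; exact mul_ne_zero h2 h2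
      have h8 : (8 : K) ≠ 0 := by
        rw [show (8 : K) = 2 * 4 by norm_num]; exact mul_ne_zero h2 h4
      have e : ∀ k : Fin 3, k + 1 + 2 = k := by clear * -; decide
      conv_rhs => rw [LinearMap.id_apply, eq_inT_add_sum h x]
      simp [smul_smul, h4, h8, e])
    (LinearMap.ext fun x => by
      have h4 : (4 : K) ≠ 0 := by
        rw [show (4 : K) = 2 * 2 by norm_num]; exact mul_ne_zero h2 h2
      have h8 : (8 : K) ≠ 0 := by
        rw [show (8 : K) = 2 * 4 by norm_num]; exact mul_ne_zero h2 h4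
      have e : ∀ k : Fin 3, k + 2 + 1 = k := by clear * -; decide
      refine Prod.ext ?_ (funext fun m => ?_)
      · simp [LinearMap.sum_apply, prT_inT, prT_inA, h8]
      · simp [LinearMap.sum_apply, prA_inT, prA_inA, h4, Finset.sum_pi_single, e])

theorem lieOnEquiv_apply (hn : IsOctonionAlgebra n) [IsArtinianRing E] [IsReduced E]
    (hE : Module.finrank K E = 2) [Invertible (2 : E)] (h2 : (2 : K) ≠ 0)
    (h6 : IsUnit (6 : E)) {γ : Fin 3 → Kˣ}
    (h : IsLieOn (AllisonFaulkner.bracket (transferInvolution hι n) γ)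
      (AllisonFaulkner.space (transferInvolution hι n)))
    (x : (⋀[E]^2 C) × (Fin 3 → Transfer hι C)) :
    lieOnEquiv hι hn hE h2 h6 h x = inT h ((8 : K)⁻¹ • wedgeEquiv hι hn hE h2 h6 x.1) +
      ∑ k, inA h k ((4 : K)⁻¹ • x.2 (k + 1)) := by
  simp [lieOnEquiv, LinearMap.sum_apply]

end

/-! ### The Lie algebra and its Killing form -/

theorem mainTheorem4 {K E C : Type*} [Field K] [Invertible (2 : K)] (h3 : (3 : K) ≠ 0)
    [CommRing E] [Algebra K E] [Algebra.Etale K E] (hE : Module.finrank K E = 2)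
    [Invertible (2 : E)] (ι : E ≃ₐ[K] E) (hι : orderOf ι = 2)
    [NonAssocRing C] [Module E C] [SMulCommClass E C C] [IsScalarTower E C C]
    [Module K C] [IsScalarTower K E C]
    (n : QuadraticForm E C) (hn : IsOctonionAlgebra n) (γ : Fin 3 → Kˣ) :
    ∃ h : IsLieOn (AllisonFaulkner.bracket (transferInvolution hι n) γ)
        (AllisonFaulkner.space (transferInvolution hι n)),
      QuadraticMap.Equivalent
        (LinearMap.BilinMap.toQuadraticMap (killingForm K (LieOn h)))
        ((-15 : K) • (traceTransfer K (lambdaSq n)).prod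
          (QuadraticMap.pi fun m : Fin 3 =>
            ((γ m : K) * (γ (m + 1) : K)⁻¹) • transferForm hι n)) := by
  -- Étale over a field and finite: $E$ is reduced and Artinian, which replaces being a field in all
  -- arguments on nondegeneracy and units.
  have : IsReduced E := Algebra.FormallyUnramified.isReduced_of_field K E
  have : Module.Finite K E := Module.finite_of_finrank_pos (by omega)
  have : IsArtinianRing E := IsArtinianRing.of_finite K E
  have : Module.Finite K (Transfer hι C) := Transfer.finite hι hn
  have h2 : (2 : K) ≠ 0 := Invertible.ne_zero 2
  have h6 : IsUnit (6 : E) := by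
    have : (6 : K) ≠ 0 := by
      rw [show (6 : K) = 2 * 3 by norm_num]; exact mul_ne_zero h2 h3
    rw [← map_ofNat (algebraMap K E) 6]
    exact this.isUnit.map (algebraMap K E)
  have htri := isTrialitarian_transferInvolution hι hn
  have h := htri.isLieOn γ
  refine ⟨h, QuadraticMap.Equivalent.symm ⟨⟨lieOnEquiv hι hn hE h2 h6 h, ?_⟩⟩⟩
  rintro ⟨w, v⟩
  change killingForm K (LieOn h) (lieOnEquiv hι hn hE h2 h6 h (w, v))
    (lieOnEquiv hι hn hE h2 h6 h (w, v)) = _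
  have hsum : ∀ f : Fin 3 → K, ∑ m, f m = ∑ k, f (k + 1) := fun f =>
    (Equiv.sum_comp (Equiv.addRight (1 : Fin 3)) f).symm
  have h4 : (4 : K) ≠ 0 := by
    rw [show (4 : K) = 2 * 2 by norm_num]; exact mul_ne_zero h2 h2
  have h8 : (8 : K) ≠ 0 := by
    rw [show (8 : K) = 2 * 4 by norm_num]; exact mul_ne_zero h2 h4
  rw [lieOnEquiv_apply, killingForm_self h h2, _root_.smul_apply, QuadraticMap.prod_apply,
    QuadraticMap.pi_apply, smul_add,
    hsum fun m => (((γ m : K) * (γ (m + 1) : K)⁻¹) • transferForm hι n) (v m), Finset.smul_sum, ← map_smul (wedgeEquiv hι hn hE h2 h6),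
    killingForm_wedgeEquiv]
  congr 1
  · change _ = -15 • Algebra.trace K E ((exteriorPower.pairingDual E C 2 ∘ₗ
        exteriorPower.map 2 (QuadraticMap.associated n)) w w)
    simp only [map_smul, LinearMap.map_smul_of_tower, LinearMap.smul_apply, smul_eq_mul]
    field_simp
    ring
  · refine Finset.sum_congr rfl fun k _ => ?_
    rw [map_smul, map_smul, map_smul, LinearMap.smul_apply,
      killingForm_inA_inA_self h htri.bar_bar htri.bar_mul, trace_killingEnd hι hn hE,
      ← eight_mul_transferForm, _root_.smul_apply, add_assoc k, show (1 : Fin 3) + 1 = 2 from rfl, smul_eq_mul, smul_eq_mul,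
      smul_eq_mul, smul_eq_mul]
    field_simp
    ring

end
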